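/- **General construction.** Let $L$ be a relational language containing a binary symbol $E$, and let $M_0$ be an $L$-structure in which $E$ is an equivalence relation with exactly $\omega$ many classes, all finite and of strictly increasing sizes. Let $L'$ be the relational language with a $2n$-ary symbol $R'$ for each $n$-ary symbol $R$ of $L$, binary symbols $\tilde E, S$ and a $4$-ary symbol $U$. Call an $L'$-structure $N_0$ a *coding* of $M_0$ if it arises as follows. $\tilde E$ is an equivalence relation on $N_0$ whose classes are finite and correspond bijectively to the $E$-classes of $M_0$. $S$ is the edge relation of a graph without edges between distinct $\tilde E$-classes, and on the $\tilde E$-class $\tilde{\mathfrak e}$ corresponding to an $E$-class $\mathfrak e$ of size $n$ this graph is regular of degree $n$ and has no cycles of length $\le n$. $U$ is an equivalence relation on the edges, $U$-equivalent edges lie in the same $\tilde E$-class, every vertex of $\tilde{\mathfrak e}$ lies on exactly one edge from each $U$-class of edges of $\tilde{\mathfrak e}$, and a bijection $\pi$ is fixed between the $U$-classes of edges of $\tilde{\mathfrak e}$ and the elements of $\mathfrak e$. Finally, $R'(x_1,y_1,\dots,x_n,y_n)$ holds iff $S(x_i,y_i)$ for all $i$ and $M_0\models R(\pi(x_1,y_1),\dots,\pi(x_n,y_n))$.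 Then codings of $M_0$ exist, and for every coding $N_0$ of $M_0$: 1. if $\mathrm{Th}(M_0)$ is NIP, then $\mathrm{Th}(N_0)$ is NIP; 2. if all imaginary types over $M_0$ of a new $E$-class are definable, then all $1$-types over $N_0$ are definable. (The imaginary type of the $E$-class of an element $c\notin\bigcup_{b\in M_0}b/E$ of an elementary extension consists of the formulas $\varphi(x,b)$, $b\in M_0$, true of $c$, with $\varphi(x,y)$ invariant under $E$ in the single variable $x$.) **Example.** Let $M_0$ be the full binary tree $2^{<\omega}$ in the language $\{\le,E\}$, where $\le$ is the tree order and $E$ is the relation of having the same distance from the root. Then $M_0$ has codings, and for every coding $N_0$ of $M_0$, with $T'=\mathrm{Th}(N_0)$: * $T'$ is NIP; * all $1$-types over $N_0$ are definable, but for every $n\ge 2$ there is an $n$-type over $N_0$ that is not definable; * $N_0$ is $(\infty,1)$-stably embedded in every elementary extension, but there is an elementary extension in which, for every $m\ge2$, it is not $(\infty,m)$-stably embedded. Here a subset $A$ of a structure $N$ is $(\infty,m)$-stably embedded in $N$ if for every $n$, every subset of $A^n$ of the form $\varphi(A,a)$ with $a$ a tuple from $N$ of length $\le m$ is of the form $\psi(A,b)$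 with $b$ a tuple from $A$. In particular, in NIP theories $(\infty,1)$-stable embeddedness of a model does not imply its $(\infty,m)$-stable embeddedness for any $m\ge2$. -/

import Mathlib

open FirstOrder FirstOrder.Language

namespace GraphCoding

/-! ### NIP, definable types, stable embeddedness -/

/-- A theory is NIP if no formula `φ(x; y)` has, in any model, tuples `a_t` (`t ∈ ω`) and
`b_s` (`s ⊆ ω`) such that `φ(a_t; b_s)` holds if and only if `t ∈ s`. -/
def IsNIP {L : FirstOrder.Language.{0, 0}} (T : L.Theory) : Prop :=
  ∀ (n m : ℕ) (φ : L.Formula (Fin n ⊕ Fin m)) (M : Type) [L.Structure M] [Nonempty M], M ⊨ T →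
    ¬ ∃ (a : ℕ → Fin n → M) (b : Set ℕ → Fin m → M),
      ∀ (t : ℕ) (s : Set ℕ), φ.Realize (Sum.elim (a t) (b s)) ↔ t ∈ s

/-- The space `S_n(M)` of complete `n`-types over `M`. -/
abbrev TypeOver (L : FirstOrder.Language.{0, 0}) (M : Type) [L.Structure M] (n : ℕ) : Type :=
  (L.elementaryDiagram M).CompleteType (Fin n)

/-- The formula `φ(x; b)` with parameters `b` from `M`, where the variables `x` are replaced by
the constants by which Mathlib represents the variables of a complete type. -/
def plug {L : FirstOrder.Language.{0, 0}} {M : Type} {n m : ℕ} (φ : L.Formula (Fin n ⊕ Fin m))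
    (b : Fin m → M) : (L[[M]])[[Fin n]].Sentence :=
  Formula.equivSentence
    (((L.lhomWithConstants M).onFormula φ).subst
      (Sum.elim (fun i => Term.var i) (fun j => Constants.term (L.con (b j)))))

/-- The set `{b ∈ M^m : φ(x; b) ∈ p}` attached to a type `p` over `M` and a formula `φ(x; y)`. -/
def defSet {L : FirstOrder.Language.{0, 0}} {M : Type} [L.Structure M] {n m : ℕ} (p : TypeOver L M n)
    (φ : L.Formula (Fin n ⊕ Fin m)) : Set (Fin m → M) :=
  {b | plug φ b ∈ p}

/-- A type over `M` is definable if for every `φ(x; y)` the set `{b : φ(x; b) ∈ p}` is definable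
in `M` with parameters from `M`. -/
def IsDefinableType {L : FirstOrder.Language.{0, 0}} {M : Type} [L.Structure M] {n : ℕ}
    (p : TypeOver L M n) : Prop :=
  ∀ (m : ℕ) (φ : L.Formula (Fin n ⊕ Fin m)), (Set.univ : Set M).Definable L (defSet p φ)

/-- `A ⊆ M` is `(n, m)`-stably embedded in `M`: every subset of `A^n` of the form `φ(A, a)` with
`a` from `M` and `|a| ≤ m` is of the form `ψ(A, b)` with `b` from `A`. -/
def StablyEmbedded (L : FirstOrder.Language.{0, 0}) {M : Type} [L.Structure M] (A : Set M) (n m : ℕ) : Prop :=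
  ∀ k ≤ m, ∀ (φ : L.Formula (Fin n ⊕ Fin k)) (a : Fin k → M),
    ∃ (l : ℕ) (ψ : L.Formula (Fin n ⊕ Fin l)) (b : Fin l → M), (∀ j, b j ∈ A) ∧
      ∀ x : Fin n → M, (∀ i, x i ∈ A) →
        (φ.Realize (Sum.elim x a) ↔ ψ.Realize (Sum.elim x b))

/-- `(∞, m)`-stable embeddedness. -/
def InfStablyEmbedded (L : FirstOrder.Language.{0, 0}) {M : Type} [L.Structure M] (A : Set M) (m : ℕ) : Prop :=
  ∀ n : ℕ, StablyEmbedded L A n m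

/-! ### The general construction -/

/-- The relation `E` of `M` is an equivalence relation with `ω` many classes, the `k`-th one being
`{a | lev a = k}`; the classes are finite, of strictly increasing sizes. -/
structure Layering {L : FirstOrder.Language.{0, 0}} (M : Type) [L.Structure M] (E : L.Relations 2) where
  lev : M → ℕ
  rel_iff : ∀ a b : M, Structure.RelMap E ![a, b] ↔ lev a = lev b
  nonempty : ∀ k : ℕ, {a : M | lev a = k}.Nonempty
  finite : ∀ k : ℕ, {a : M | lev a = k}.Finite
  strictMono : StrictMono fun k : ℕ => {a : M | lev a = k}.ncard

/-- The size of the `k`-th class. -/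
noncomputable def Layering.size {L : FirstOrder.Language.{0, 0}} {M : Type} [L.Structure M]
    {E : L.Relations 2} (D : Layering M E) (k : ℕ) : ℕ :=
  {a : M | D.lev a = k}.ncard

/-- The data of which the structure `N₀` is made: a graph `S` on `V`, split into finite pieces
(the classes of `Ẽ`, given by `lev`), one for each `E`-class of `M`. The piece for a class of size
`n` is `n`-regular without cycles of length at most `n`. Edges carry an equivalence
relation `U`, whose classes are matched by `π` with the elements of `M`, so that the `U`-classes of
edges in the `k`-th piece correspond to the elements of the `k`-th `E`-class, and every vertex is
on exactly one edge from each `U`-class of its piece. -/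
structure Coding {L : FirstOrder.Language.{0, 0}} {M : Type} [L.Structure M] {E : L.Relations 2}
    (D : Layering M E) where
  V : Type
  lev : V → ℕ
  nonempty : ∀ k : ℕ, {v : V | lev v = k}.Nonempty
  finite : ∀ k : ℕ, {v : V | lev v = k}.Finite
  S : SimpleGraph V
  lev_eq_of_adj : ∀ u v : V, S.Adj u v → lev u = lev v
  regular : ∀ v : V, (S.neighborSet v).ncard = D.size (lev v)
  no_short_cycle : ∀ (v : V) (c : S.Walk v v), c.IsCycle → D.size (lev v) < c.length
  U : Setoid S.edgeSet
  π : Quotient U ≃ M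
  lev_π : ∀ e : S.edgeSet, ∀ v ∈ (e : Sym2 V), D.lev (π (Quotient.mk U e)) = lev v
  existsUnique_edge : ∀ (v : V) (q : Quotient U), D.lev (π q) = lev v →
    ∃! e : S.edgeSet, v ∈ (e : Sym2 V) ∧ Quotient.mk U e = q

/-- The relation symbols of `L'`: a symbol `R'` of arity `2n` for every `n`-ary symbol `R` of `L`,
and `Ẽ`, `S`, `U`. -/
inductive CodeRel (L : FirstOrder.Language.{0, 0}) : ℕ → Type
  | coded {n : ℕ} (R : L.Relations n) : CodeRel L (n * 2)
  | cls : CodeRel L 2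
  | edge : CodeRel L 2
  | par : CodeRel L 4

/-- The relational language `L'`. -/
def codeLanguage (L : FirstOrder.Language.{0, 0}) : FirstOrder.Language.{0, 0} where
  Functions := fun _ => Empty
  Relations := CodeRel L

section

variable {L : FirstOrder.Language.{0, 0}} {M : Type} [L.Structure M] {E : L.Relations 2} {D : Layering M E}

/-- The element of `M` coded by the edge between `u` and `v`. -/
def Coding.color (C : Coding D) {u v : C.V} (h : C.S.Adj u v) : M :=
  C.π (Quotient.mk C.U ⟨s(u, v), h⟩)

/-- Interpretation of the symbols of `L'`. A tuple of length `2n` is read as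
`(x₁, y₁, …, xₙ, yₙ)`; `finProdFinEquiv (i, 0)` and `finProdFinEquiv (i, 1)` are
the positions of `xᵢ` and `yᵢ`. -/
def Coding.relMap (C : Coding D) : ∀ {n : ℕ}, CodeRel L n → (Fin n → C.V) → Prop
  | _, .coded R, v =>
      ∃ h : ∀ i, C.S.Adj (v (finProdFinEquiv (i, 0))) (v (finProdFinEquiv (i, 1))),
        Structure.RelMap R fun i => C.color (h i)
  | _, .cls, v => C.lev (v 0) = C.lev (v 1)
  | _, .edge, v => C.S.Adj (v 0) (v 1)
  | _, .par, v => ∃ (h : C.S.Adj (v 0) (v 1)) (h' : C.S.Adj (v 2) (v 3)),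
      C.U.r ⟨s(v 0, v 1), h⟩ ⟨s(v 2, v 3), h'⟩

/-- The `L'`-structure `N₀`. -/
instance Coding.instStructure (C : Coding D) : (codeLanguage L).Structure C.V where
  funMap := fun f => Empty.elim f
  RelMap := fun R v => C.relMap R v

end

/-- All imaginary types over `M` of a new `E`-class are definable. Such an imaginary type is given
by the formulas `φ(x; b)`, with `φ(x; y)` invariant under `E` in the single variable `x`, in a
`1`-type `p(x)` over `M` that contains no formula `E(x, b)` with `b ∈ M`. -/
def NewClassTypesDefinable {L : FirstOrder.Language.{0, 0}} (M : Type) [L.Structure M]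
    (E : L.Relations 2) : Prop :=
  ∀ p : TypeOver L M 1,
    (∀ b : M, plug (E.formula₂ (Term.var (Sum.inl 0)) (Term.var (Sum.inr 0)) :
      L.Formula (Fin 1 ⊕ Fin 1)) ![b] ∉ p) →
    ∀ (m : ℕ) (φ : L.Formula (Fin 1 ⊕ Fin m)),
      (∀ (a a' : M) (b : Fin m → M), Structure.RelMap E ![a, a'] →
        (φ.Realize (Sum.elim ![a] b) ↔ φ.Realize (Sum.elim ![a'] b))) →
      (Set.univ : Set M).Definable L (defSet p φ)

/-! ### The binary tree with the level equivalence relation -/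

/-- The symbols `≤` and `E`. -/
inductive TreeRel : ℕ → Type
  | le : TreeRel 2
  | eqv : TreeRel 2

/-- The language `L₀ = {≤, E}`. -/
def treeLanguage : FirstOrder.Language.{0, 0} where
  Functions := fun _ => Empty
  Relations := TreeRel

/-- The binary tree of height `ω`: finite binary sequences, `≤` being "is an initial segment
of" and `E` being "has the same length as" (the distance from the root is the length). -/
instance treeStructure : treeLanguage.Structure (List Bool) where
  funMap := fun f => Empty.elim f
  RelMap := fun R v => match R with
    | .le => v 0 <+: v 1
    | .eqv => (v 0).length = (v 1).length

/-- The symbol `E` of `L₀`. -/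
def treeE : treeLanguage.Relations 2 := TreeRel.eqv

theorem ncard_length (k : ℕ) : {l : List Bool | l.length = k}.ncard = 2 ^ k := by
  have h := card_vector (α := Bool) k
  rw [Fintype.card_bool, ← Nat.card_eq_fintype_card] at h
  rw [← h]
  rfl

/-- The levels of the tree. -/
def treeLayering : Layering (List Bool) treeE where
  lev := List.length
  rel_iff := fun _ _ => Iff.rfl
  nonempty := fun k => ⟨List.replicate k true, by simp⟩
  finite := fun k => List.finite_length_eq Bool k
  strictMono := by
    simp only [ncard_length]
    exact pow_right_strictMono₀ (by norm_num)

/-- The language `L'` for `L₀ = {≤, E}`. -/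
abbrev treeCodeLanguage : FirstOrder.Language.{0, 0} := codeLanguage treeLanguage

end GraphCoding

/-! In a coding every colour `c : M` acts on vertices as an involution: it moves a vertex of its own
piece along the edge of colour `c` and fixes all other pieces. The girth condition says that a word
of colours no longer than the size of a class fixes a vertex of the corresponding piece only if it
becomes empty once the letters of other classes are dropped and equal neighbours are cancelled. So
high pieces look locally like regular trees, and for a vertex of high level that is far from all
others under consideration only its level matters (`Simple.generic`). Far vertices exist in every
high piece (`Coding.exists_far`). Hence a quantifier over vertices reduces to finitely many vertices
of low level, to short words applied to vertices already present, and to a quantifier over colours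
(`Simple.exV`): every formula of the coding is a `Simple` relation.

NIP is used in the form of polynomially many traces on finite families of parameters (Sauer–Shelah).
The same trichotomy of low, near and far removes vertices from objects and parameters one at a time
at polynomial cost, until a relation on `M` remains (`Simple.polyBounded`).

A `1`-type over the coding is a limit of single vertices along an ultrafilter. If the levels stay
bounded, the ultrafilter is principal. Otherwise the vertex finally lies in a higher piece than any
given parameters, so it is far from them, and only the limit of its level matters. That limit is an
imaginary type of a new class, whose definability passes from colours to vertices
(`Simple.eventually_lev`, `Coding.pDef_eventually`). Two adjacent vertices, however, name a colour,
so a limit of edges can carry a type of `M` that is not definable; in the tree it carries a branch.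

In the tree, the truth of a formula depends only on the differences, up to a finite bound, of the
lengths of common prefixes (`exists_sim_realize`, by back-and-forth). This gives NIP, the
definability of types of new levels, and the undefinability of the branch. Codings exist because
left multiplication in suitable finite permutation groups has no short relations
(`nonempty_coding`). -/

namespace GraphCoding

/-! ### Relations definable with parameters -/

section PDef

variable {L : FirstOrder.Language.{0, 0}} {M : Type} [L.Structure M] {γ δ : Type}

/-- A relation on `M` that is definable with parameters from `M`. The parameters are kept as
variables of a formula, indexed by `M` and interpreted by themselves. -/
def PDef (L : FirstOrder.Language.{0, 0}) {M : Type} [L.Structure M] {γ : Type}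
    (P : (γ → M) → Prop) : Prop :=
  ∃ φ : L.Formula (γ ⊕ M), ∀ v, φ.Realize (Sum.elim v id) ↔ P v

theorem PDef.congr {P P' : (γ → M) → Prop} (h : PDef L P) (e : ∀ v, P v ↔ P' v) : PDef L P' := by
  obtain ⟨φ, hφ⟩ := h
  exact ⟨φ, fun v => (hφ v).trans (e v)⟩

theorem definable_iff_pDef {s : Set (γ → M)} :
    (Set.univ : Set M).Definable L s ↔ PDef L (fun v => v ∈ s) := by
  rw [Set.definable_iff_exists_formula_sum]
  constructor
  · rintro ⟨φ, rfl⟩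
    refine ⟨φ.relabel (Sum.elim (fun a => Sum.inr a.1) Sum.inl), fun v => ?_⟩
    rw [Formula.realize_relabel]
    change _ ↔ φ.Realize _
    refine iff_of_eq (congrArg _ (funext ?_))
    rintro (a | a) <;> rfl
  · rintro ⟨φ, hφ⟩
    refine ⟨φ.relabel (Sum.elim Sum.inr fun a => Sum.inl ⟨a, Set.mem_univ a⟩), Set.ext fun v => ?_⟩
    refine (hφ v).symm.trans ?_
    rw [Set.mem_ofPred_eq, Formula.realize_relabel]
    refine iff_of_eq (congrArg _ (funext ?_))
    rintro (a | a) <;> rfl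

theorem PDef.of_formula (φ : L.Formula γ) : PDef L (M := M) fun v => φ.Realize v :=
  ⟨φ.relabel Sum.inl, fun v => by rw [Formula.realize_relabel, Sum.elim_comp_inl]⟩

/-- Parameters are variables too, so plugging in elements of `M` is a relabelling. -/
theorem PDef.subst {P : (γ → M) → Prop} (h : PDef L P) (s : γ → δ ⊕ M) :
    PDef L fun v : δ → M => P fun g => Sum.elim v id (s g) := by
  obtain ⟨φ, hφ⟩ := h
  refine ⟨φ.relabel (Sum.elim s Sum.inr), fun v => ?_⟩
  rw [Formula.realize_relabel]
  refine Iff.trans (iff_of_eq ?_) (hφ _)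
  refine (congrArg _ (funext ?_))
  rintro (a | a) <;> rfl

theorem PDef.comp {P : (γ → M) → Prop} (h : PDef L P) (s : γ → δ) :
    PDef L fun v : δ → M => P fun g => v (s g) :=
  h.subst fun g => Sum.inl (s g)

theorem PDef.not {P : (γ → M) → Prop} (h : PDef L P) : PDef L fun v => ¬ P v := by
  obtain ⟨φ, hφ⟩ := h
  exact ⟨φ.not, fun v => by rw [Formula.realize_not, hφ]⟩

theorem PDef.and {P Q : (γ → M) → Prop} (h : PDef L P) (h' : PDef L Q) :
    PDef L fun v => P v ∧ Q v := by
  obtain ⟨φ, hφ⟩ := h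
  obtain ⟨ψ, hψ⟩ := h'
  exact ⟨φ ⊓ ψ, fun v => by rw [Formula.realize_inf, hφ, hψ]⟩

theorem PDef.or {P Q : (γ → M) → Prop} (h : PDef L P) (h' : PDef L Q) :
    PDef L fun v => P v ∨ Q v :=
  (h.not.and h'.not).not.congr fun v => by tauto

theorem PDef.imp {P Q : (γ → M) → Prop} (h : PDef L P) (h' : PDef L Q) :
    PDef L fun v => P v → Q v :=
  (h.and h'.not).not.congr fun v => by tauto

theorem PDef.ex {P : (Option γ → M) → Prop} (h : PDef L P) :
    PDef L fun v : γ → M => ∃ c, P fun o => o.elim c v := by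
  obtain ⟨φ, hφ⟩ := h
  let g : Option γ ⊕ M → (γ ⊕ M) ⊕ Unit
    | .inl none => .inr ()
    | .inl (some a) => .inl (.inl a)
    | .inr c => .inl (.inr c)
  have key : ∀ (v : γ → M) (w : Unit → M),
      (Sum.elim (Sum.elim v id) w) ∘ g = Sum.elim (fun o : Option γ => o.elim (w ()) v) id := by
    intro v w
    funext o
    rcases o with (_ | o) | o <;> rfl
  refine ⟨(φ.relabel g).iExs Unit, fun v => ?_⟩
  rw [Formula.realize_iExs]
  constructor
  · rintro ⟨w, hw⟩
    rw [Formula.realize_relabel, key, hφ] at hw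
    exact ⟨_, hw⟩
  · rintro ⟨c, hc⟩
    refine ⟨fun _ => c, ?_⟩
    rw [Formula.realize_relabel, key, hφ]
    exact hc

theorem PDef.all {P : (Option γ → M) → Prop} (h : PDef L P) :
    PDef L fun v : γ → M => ∀ c, P fun o => o.elim c v :=
  h.not.ex.not.congr fun v => by simp

theorem PDef.eq (a b : γ) : PDef L fun v : γ → M => v a = v b :=
  (PDef.of_formula (Term.equal (Term.var a) (Term.var b))).congr fun v => by simp

theorem PDef.eqConst (a : γ) (c : M) : PDef L fun v : γ → M => v a = c :=
  (PDef.eq (none : Option γ) (some a)).subst (fun o => o.elim (Sum.inr c) Sum.inl) |>.congr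
    fun v => by simp [eq_comm]

theorem PDef.rel {n : ℕ} (R : L.Relations n) (a : Fin n → γ) :
    PDef L fun v : γ → M => Structure.RelMap R fun i => v (a i) :=
  (PDef.of_formula (R.formula fun i => Term.var (a i))).congr fun v => by
    rw [Formula.realize_rel]; rfl

/-- Every formula uses only finitely many of its free variables. -/
theorem exists_formula_fin (φ : L.Formula γ) : ∃ (n : ℕ) (g : Fin n → γ) (ψ : L.Formula (Fin n)),
    ∀ v : γ → M, φ.Realize v ↔ ψ.Realize fun i => v (g i) := by
  classical
  let e := φ.freeVarFinset.equivFin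
  refine ⟨_, fun i => (e.symm i).1, φ.restrictFreeVar e, fun v => ?_⟩
  exact (BoundedFormula.realize_restrictFreeVar _ (by simp [e])).symm

end PDef

/-! ### Types and ultrafilters -/

section Types

variable {L : FirstOrder.Language.{0, 0}} {M : Type} [L.Structure M]

/-- The traces on an elementary substructure of the sets defined over a tuple are given by
an ultrafilter. -/
theorem exists_ultrafilter_of_elementary {N : Type} [L.Structure N] (f : M ↪ₑ[L] N) {n : ℕ}
    (a : Fin n → N) : ∃ u : Ultrafilter (Fin n → M), ∀ (m : ℕ) (φ : L.Formula (Fin n ⊕ Fin m))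
      (b : Fin m → M), φ.Realize (Sum.elim a (f ∘ b)) ↔ ∀ᶠ x in u, φ.Realize (Sum.elim x b) := by
  -- The filter generated by the sets that formulas over `M` true of `a` define in `M`. It is proper
  -- because `f` is elementary.
  let F : Filter (Fin n → M) :=
    { sets := {S | ∃ φ : L.Formula (Fin n ⊕ M), φ.Realize (Sum.elim a f) ∧
        ∀ x, φ.Realize (Sum.elim x id) → x ∈ S}
      univ_sets := ⟨⊤, by simp, by simp⟩
      sets_of_superset := by
        rintro S T ⟨φ, h, h'⟩ hST
        exact ⟨φ, h, fun x hx => hST (h' x hx)⟩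
      inter_sets := by
        rintro S T ⟨φ, h, h'⟩ ⟨ψ, k, k'⟩
        refine ⟨φ ⊓ ψ, by simp [h, k], fun x hx => ?_⟩
        rw [Formula.realize_inf] at hx
        exact ⟨h' x hx.1, k' x hx.2⟩ }
  have hF : F.NeBot := by
    rw [Filter.neBot_iff]
    intro hb
    have h0 : (∅ : Set (Fin n → M)) ∈ F := by rw [hb]; trivial
    obtain ⟨φ, h, h'⟩ := h0
    let ψ : L.Formula M := (φ.relabel Sum.swap).iExs (Fin n)
    have h1 : ψ.Realize (f ∘ id) := by
      rw [Formula.realize_iExs]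
      refine ⟨a, ?_⟩
      rw [Formula.realize_relabel]
      convert h using 1
      funext o
      rcases o with o | o <;> rfl
    rw [f.map_formula, Formula.realize_iExs] at h1
    obtain ⟨x, hx⟩ := h1
    rw [Formula.realize_relabel] at hx
    refine h' x ?_
    convert hx using 1
    funext o
    rcases o with o | o <;> rfl
  have key : ∀ (m : ℕ) (φ : L.Formula (Fin n ⊕ Fin m)) (b : Fin m → M),
      φ.Realize (Sum.elim a (f ∘ b)) → ∀ᶠ x in Ultrafilter.of F, φ.Realize (Sum.elim x b) := by
    intro m φ b h
    refine Ultrafilter.of_le F ⟨φ.relabel (Sum.map id b), ?_, fun x hx => ?_⟩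
    · rw [Formula.realize_relabel]
      convert h using 1
      funext o
      rcases o with o | o <;> rfl
    · rw [Formula.realize_relabel] at hx
      change φ.Realize (Sum.elim x b)
      convert hx using 1
      funext o
      rcases o with o | o <;> rfl
  refine ⟨Ultrafilter.of F, fun m φ b => ⟨key m φ b, fun h => ?_⟩⟩
  by_contra hn
  have h2 := key m φ.not b (by rwa [Formula.realize_not])
  obtain ⟨x, hx, hx'⟩ := (h.and h2).exists
  rw [Formula.realize_not] at hx'
  exact hx' hx

/-- A realisation of the type in an elementary extension yields the ultrafilter. Definability of
types thus becomes definability of limits along ultrafilters. -/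
theorem exists_ultrafilter_of_type {n : ℕ} (p : TypeOver L M n) :
    ∃ u : Ultrafilter (Fin n → M), ∀ (m : ℕ) (φ : L.Formula (Fin n ⊕ Fin m)) (b : Fin m → M),
      plug φ b ∈ p ↔ ∀ᶠ x in u, φ.Realize (Sum.elim x b) := by
  obtain ⟨N, a, rfl⟩ := Theory.exists_modelType_is_realized_in _ p
  let _ : L.Structure N := (L.lhomWithConstants M).reduct N
  have : (L.lhomWithConstants M).IsExpansionOn N := LHom.isExpansionOn_reduct _ _
  obtain ⟨u, hu⟩ := exists_ultrafilter_of_elementary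
    (ElementaryEmbedding.ofModelsElementaryDiagram L M N) a
  refine ⟨u, fun m φ b => ?_⟩
  rw [← hu, plug, Theory.CompleteType.formula_mem_typeOf]
  refine BoundedFormula.realize_subst.trans
    ((LHom.realize_onFormula (L.lhomWithConstants M) φ).trans ?_)
  refine iff_of_eq (congrArg (fun w => φ.Realize w) (funext ?_))
  rintro (o | o)
  · rfl
  · exact Term.realize_constants

/-- By Łoś, the limit type is realised by the class of the family `x` in the ultraproduct. -/
theorem exists_completeType_of_ultrafilter {K : FirstOrder.Language.{0, 0}} [K.Structure M]
    [Nonempty M] {ι : Type} (u : Ultrafilter ι) {n : ℕ} (x : ι → Fin n → M) :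
    ∃ p : (K.completeTheory M).CompleteType (Fin n), ∀ ψ : K.Formula (Fin n),
      Formula.equivSentence ψ ∈ p ↔ ∀ᶠ i in u, ψ.Realize (x i) := by
  have : ((u : Filter ι).Product fun _ => M) ⊨ K.completeTheory M := by
    refine ⟨fun σ hσ => ?_⟩
    rw [Ultraproduct.sentence_realize]
    exact Filter.Eventually.of_forall fun _ => hσ
  let y : Fin n → (u : Filter ι).Product fun _ => M := fun j => ((fun i => x i j : ι → M) :
    (u : Filter ι).Product fun _ => M)
  refine ⟨(K.completeTheory M).typeOf y, fun ψ => ?_⟩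
  rw [Theory.CompleteType.formula_mem_typeOf]
  exact Ultraproduct.realize_formula_cast ψ fun j i => x i j

theorem exists_type_of_ultrafilter [Nonempty M] {ι : Type} (u : Ultrafilter ι) {n : ℕ}
    (x : ι → Fin n → M) : ∃ p : TypeOver L M n, ∀ (m : ℕ) (φ : L.Formula (Fin n ⊕ Fin m))
      (b : Fin m → M), plug φ b ∈ p ↔ ∀ᶠ i in u, φ.Realize (Sum.elim (x i) b) := by
  obtain ⟨p, hp⟩ := exists_completeType_of_ultrafilter (K := L[[M]]) u x
  refine ⟨p, fun m φ b => ?_⟩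
  rw [plug, hp]
  refine Filter.eventually_congr (Filter.Eventually.of_forall fun i => ?_)
  refine BoundedFormula.realize_subst.trans
    ((LHom.realize_onFormula (L.lhomWithConstants M) φ).trans ?_)
  refine iff_of_eq (congrArg (fun w => φ.Realize w) (funext ?_))
  rintro (o | o)
  · rfl
  · exact Term.realize_constants

/-- The diagonal embedding into an ultrapower. -/
theorem exists_ultrapower [Nonempty M] {ι : Type} (u : Ultrafilter ι) :
    ∃ (N : Type) (_ : L.Structure N) (f : M ↪ₑ[L] N) (c : (ι → M) → N),
      (∀ m, f m = c fun _ => m) ∧ ∀ (γ : Type) (φ : L.Formula γ) (x : γ → ι → M),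
        φ.Realize (fun g => c (x g)) ↔ ∀ᶠ i in u, φ.Realize fun g => x g i := by
  have key : ∀ (γ : Type) (φ : L.Formula γ) (x : γ → ι → M),
      φ.Realize (fun g => ((x g : ∀ _ : ι, M) : (u : Filter ι).Product fun _ => M)) ↔
        ∀ᶠ i in u, φ.Realize fun g => x g i :=
    fun γ φ x => Ultraproduct.realize_formula_cast φ x
  refine ⟨(u : Filter ι).Product fun _ => M, inferInstance,
    ⟨fun m => ((fun _ => m : ∀ _ : ι, M) : (u : Filter ι).Product fun _ => M), ?_⟩,
    fun x => ((x : ∀ _ : ι, M) : (u : Filter ι).Product fun _ => M), fun _ => rfl, key⟩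
  intro n φ x
  refine (key _ φ fun g _ => x g).trans ?_
  exact Filter.eventually_const

end Types

end GraphCoding

namespace GraphCoding

/-! ### Relations with polynomially many traces -/

section PolyBounded

/-- The number of traces of `Q` on families of `k` parameters is bounded by a polynomial in `k`. -/
def PolyBounded {X Y : Type} (Q : X → Y → Prop) : Prop :=
  ∃ d : ℕ, ∀ (T : Type) [Fintype T] (b : T → Y),
    (Set.range fun x t => Q x (b t)).ncard ≤ (Fintype.card T + 2) ^ d

variable {X Y X' Y' : Type}

theorem PolyBounded.comp {Q : X → Y → Prop} (h : PolyBounded Q) (f : X' → X) (g : Y' → Y) :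
    PolyBounded fun x y => Q (f x) (g y) := by
  obtain ⟨d, hd⟩ := h
  refine ⟨d, fun T _ b => (Set.ncard_le_ncard ?_ (Set.toFinite _)).trans (hd T fun t => g (b t))⟩
  rintro _ ⟨x, rfl⟩
  exact ⟨f x, rfl⟩

theorem PolyBounded.congr {Q Q' : X → Y → Prop} (h : PolyBounded Q) (e : ∀ x y, Q x y ↔ Q' x y) :
    PolyBounded Q' := by
  have : Q = Q' := by
    funext x y
    exact propext (e x y)
  rwa [← this]

theorem PolyBounded.of_subsingleton [Subsingleton X] (Q : X → Y → Prop) : PolyBounded Q :=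
  ⟨0, fun T _ b => by
    rw [pow_zero]
    refine Set.ncard_le_one_iff_subsingleton.2 ?_
    rintro _ ⟨x, rfl⟩ _ ⟨x', rfl⟩
    rw [Subsingleton.elim x x']⟩

theorem ncard_range_le_prod {I : Type} [Fintype I] {B : Type} {A : I → Type} [∀ i, Finite (A i)]
    (f : X → B) (g : ∀ i, X → A i) (h : ∀ x x', (∀ i, g i x = g i x') → f x = f x') :
    (Set.range f).ncard ≤ ∏ i, (Set.range (g i)).ncard := by
  have hc : ∀ y : Set.range f, ∃ x, f x = y := fun y => y.2
  choose x hx using hc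
  have := Nat.card_le_card_of_injective
    (fun (y : Set.range f) (i : I) => (⟨g i (x y), x y, rfl⟩ : Set.range (g i))) (by
      intro y y' e
      refine Subtype.ext ?_
      rw [← hx y, ← hx y']
      exact h _ _ fun i => congrArg Subtype.val (congrFun e i))
  rw [Nat.card_pi] at this
  exact this

/-- A relation is polynomially bounded if it is determined by such relations. -/
theorem PolyBounded.of_determined {Q : X → Y → Prop} {I : Type} [Finite I] {P : I → X → Y → Prop}
    (hP : ∀ i, PolyBounded (P i))
    (h : ∀ x x' y, (∀ i, P i x y ↔ P i x' y) → (Q x y ↔ Q x' y)) : PolyBounded Q := by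
  have := Fintype.ofFinite I
  choose d hd using hP
  refine ⟨∑ i, d i, fun T _ b => ?_⟩
  refine (ncard_range_le_prod _ (fun i x t => P i x (b t)) ?_).trans ?_
  · intro x x' e
    funext t
    exact propext (h _ _ _ fun i => iff_of_eq (congrFun (e i) t))
  · rw [← Finset.prod_pow_eq_pow_sum]
    exact Finset.prod_le_prod' fun i _ => hd i T b

/-- A relation is polynomially bounded if its parameters fall into finitely many kinds such that
for each of them the relation reduces to a polynomially bounded one. -/
theorem PolyBounded.of_param_cover {Q : X → Y → Prop} {I : Type} [Finite I] {Z : I → Type}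
    {P : ∀ i, X → Z i → Prop} (hP : ∀ i, PolyBounded (P i))
    (h : ∀ y, ∃ i, ∃ z : Z i, ∀ x, Q x y ↔ P i x z) : PolyBounded Q := by
  classical
  have := Fintype.ofFinite I
  choose d hd using hP
  choose k z hz using h
  refine ⟨∑ i, d i, fun T _ b => ?_⟩
  let z' : ∀ i, {t : T // k (b t) = i} → Z i := fun i t => t.2 ▸ z (b t.1)
  have hz' : ∀ i (t : {t : T // k (b t) = i}) x, Q x (b t.1) ↔ P i x (z' i t) := by
    rintro i ⟨t, rfl⟩ x
    exact hz (b t) x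
  refine (ncard_range_le_prod _ (fun i x t => P i x (z' i t)) ?_).trans ?_
  · intro x x' e
    funext t
    refine propext ?_
    have := congrFun (e (k (b t))) ⟨t, rfl⟩
    rw [hz' _ ⟨t, rfl⟩ x, hz' _ ⟨t, rfl⟩ x']
    exact iff_of_eq this
  · rw [← Finset.prod_pow_eq_pow_sum]
    refine Finset.prod_le_prod' fun i _ => (hd i _ (z' i)).trans ?_
    exact Nat.pow_le_pow_left (Nat.add_le_add_right (Fintype.card_subtype_le _) 2) _

/-- A relation is polynomially bounded if, over a family of parameters, its objects fall into
polynomially many kinds such that for each of them the relation reduces to a polynomially bounded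
one. -/
theorem PolyBounded.of_object_cover {Q : X → Y → Prop} {I : Type} [Finite I] (c : ℕ)
    {W Z : I → Type} {P : ∀ i, W i → Z i → Prop} (hP : ∀ i, PolyBounded (P i))
    (h : ∀ (T : Type) [Fintype T] (b : T → Y),
      ∃ b' : ∀ i, (Fin c → Option T) → T → Z i, ∀ x, ∃ i o, ∃ w : W i,
        ∀ t, Q x (b t) ↔ P i w (b' i o t)) : PolyBounded Q := by
  classical
  have := Fintype.ofFinite I
  choose d hd using hP
  -- There are `card I * (card T + 1) ^ c` kinds. As the base `card T + 2` is at least `2`, the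
  -- constant factor `card I` is absorbed into the exponent.
  refine ⟨Fintype.card I + c + ∑ i, d i, fun T _ b => ?_⟩
  obtain ⟨b', hb'⟩ := h T b
  have hsub : (Set.range fun x t => Q x (b t)) ⊆
      ⋃ j : I × (Fin c → Option T), Set.range fun w t => P j.1 w (b' j.1 j.2 t) := by
    rintro _ ⟨x, rfl⟩
    obtain ⟨i, o, w, hw⟩ := hb' x
    refine Set.mem_iUnion.2 ⟨(i, o), w, ?_⟩
    funext t
    exact propext (hw t).symm
  refine (Set.ncard_le_ncard hsub (Set.toFinite _)).trans ?_
  have hle : ∀ j : I × (Fin c → Option T),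
      (Set.range fun w t => P j.1 w (b' j.1 j.2 t)).ncard ≤ (Fintype.card T + 2) ^ ∑ i, d i := by
    intro j
    refine (hd j.1 T _).trans (Nat.pow_le_pow_right (by omega) ?_)
    exact Finset.single_le_sum (f := d) (fun _ _ => Nat.zero_le _) (Finset.mem_univ j.1)
  have h1 : (⋃ j : I × (Fin c → Option T), Set.range fun w t => P j.1 w (b' j.1 j.2 t)).ncard ≤
      Fintype.card (I × (Fin c → Option T)) * (Fintype.card T + 2) ^ ∑ i, d i := by
    refine (Set.ncard_iUnion_le_of_fintype _).trans ?_
    exact Finset.sum_le_card_nsmul _ _ _ fun j _ => hle j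
  refine h1.trans ?_
  rw [pow_add]
  refine Nat.mul_le_mul_right _ ?_
  rw [Fintype.card_prod, Fintype.card_fun, Fintype.card_option, Fintype.card_fin, pow_add]
  refine Nat.mul_le_mul ?_ (Nat.pow_le_pow_left (by omega) _)
  exact (Nat.lt_two_pow_self).le.trans (Nat.pow_le_pow_left (by omega) _)

/-- A nonempty trace is determined by a parameter in it with the least value, so the choice of one
parameter or none suffices. -/
theorem PolyBounded.le {A : Type} [LinearOrder A] : PolyBounded fun n h : A => n ≤ h := by
  refine PolyBounded.of_object_cover (I := Unit) (W := fun _ => Unit) (Z := fun _ => Prop)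
    (P := fun _ _ p => p) 1 (fun _ => PolyBounded.of_subsingleton _) fun T _ b => ?_
  refine ⟨fun _ o t => (o 0).elim False fun t₀ => b t₀ ≤ b t, fun n => ?_⟩
  by_cases hn : ∃ t, n ≤ b t
  · obtain ⟨t₀, ht₀, hmin⟩ := (Finset.univ.filter fun t => n ≤ b t).exists_min_image b
      (by obtain ⟨t, ht⟩ := hn; exact ⟨t, by simpa using ht⟩)
    refine ⟨(), fun _ => some t₀, (), fun t => ⟨fun h => hmin t (by simpa using h), fun h => ?_⟩⟩
    exact (Finset.mem_filter.1 ht₀).2.trans h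
  · refine ⟨(), fun _ => none, (), fun t => ⟨fun h => hn ⟨t, h⟩, False.elim⟩⟩

/-- This is the Sauer–Shelah lemma: VC dimension below `d` leaves at most a sum of `d` binomial
coefficients. -/
theorem PolyBounded.of_not_shatters {Q : X → Y → Prop} (d : ℕ)
    (h : ¬ ∃ (a : Fin d → Y) (b : Set (Fin d) → X), ∀ t s, Q (b s) (a t) ↔ t ∈ s) :
    PolyBounded Q := by
  classical
  rcases isEmpty_or_nonempty X with hX | ⟨⟨x₀⟩⟩
  · exact PolyBounded.of_subsingleton Q
  have hd : ⊥ < d := by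
    rw [bot_eq_zero, Nat.pos_iff_ne_zero]
    rintro rfl
    exact h ⟨Fin.elim0, fun _ => x₀, fun t => t.elim0⟩
  refine ⟨d + d, fun T _ b => ?_⟩
  let tr : X → Finset T := fun x => Finset.univ.filter fun t => Q x (b t)
  let 𝒜 : Finset (Finset T) := (Set.toFinite (Set.range tr)).toFinset
  have hcard : (Set.range fun x t => Q x (b t)).ncard = 𝒜.card := by
    rw [← Set.ncard_eq_toFinset_card]
    have : (Set.range fun x t => Q x (b t)) = (fun (s : Finset T) t => t ∈ s) '' Set.range tr := by
      rw [← Set.range_comp]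
      congr 1
      funext x t
      simp [tr]
    rw [this, Set.ncard_image_of_injective]
    intro s s' e
    ext t
    exact iff_of_eq (congrFun e t)
  have hvc : 𝒜.vcDim < d := by
    by_contra hlt
    obtain ⟨s, hs, hsd⟩ : ∃ s ∈ 𝒜.shatterer, d ≤ s.card := by
      by_contra hc
      push Not at hc
      exact hlt ((Finset.sup_lt_iff hd).2 hc)
    obtain ⟨s', hs's, hs'⟩ := Finset.exists_subset_card_eq hsd
    have hsh := (Finset.mem_shatterer.1 hs).mono_right hs's
    let e := s'.equivFinOfCardEq hs'
    have hx : ∀ S : Set (Fin d), ∃ x, ∀ t, Q x (b (e.symm t).1) ↔ t ∈ S := by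
      intro S
      obtain ⟨u, hu, hu'⟩ := hsh (t := s'.filter fun t => ∃ h : t ∈ s', e ⟨t, h⟩ ∈ S)
        (Finset.filter_subset _ _)
      obtain ⟨x, rfl⟩ : ∃ x, tr x = u := by simpa [𝒜] using hu
      refine ⟨x, fun t => ?_⟩
      have := Finset.ext_iff.1 hu' (e.symm t).1
      simpa [tr] using this
    choose x hx using hx
    exact h ⟨_, x, fun t S => hx S t⟩
  rw [hcard]
  refine (Finset.card_le_card_shatterer 𝒜).trans (Finset.card_shatterer_le_sum_vcDim.trans ?_)
  refine (Finset.sum_le_card_nsmul _ _ ((Fintype.card T + 2) ^ d) fun k hk => ?_).trans ?_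
  · refine (Nat.choose_le_pow _ _).trans ((Nat.pow_le_pow_left (by omega) k).trans
      (Nat.pow_le_pow_right (by omega) ?_))
    exact (Finset.mem_Iic.1 hk).trans hvc.le
  · rw [Nat.card_Iic, smul_eq_mul, pow_add]
    refine Nat.mul_le_mul_right _ ((Nat.succ_le_of_lt hvc).trans ?_)
    exact (Nat.lt_two_pow_self).le.trans (Nat.pow_le_pow_left (Nat.le_add_left _ _) _)

end PolyBounded

/-! ### NIP in terms of traces -/

section NIP

variable {L : FirstOrder.Language.{0, 0}} {M : Type} [L.Structure M]

theorem exists_pow_lt_two_pow (d : ℕ) : ∃ k : ℕ, (k + 2) ^ d < 2 ^ k := by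
  have h := tendsto_pow_const_div_const_pow_of_one_lt d (r := (2 : ℝ)) (by norm_num)
  have h' := (h.eventually (gt_mem_nhds (show (0 : ℝ) < 1 / 4 by norm_num))).exists_forall_of_atTop
  obtain ⟨N, hN⟩ := h'
  refine ⟨N, ?_⟩
  have := hN (N + 2) (by omega)
  rw [div_lt_iff₀ (by positivity), pow_add] at this
  have h2 : ((N + 2 : ℕ) : ℝ) ^ d < 2 ^ N := by linarith
  exact_mod_cast h2

/-- That some `k` tuples are shattered is a single sentence, so it passes from any model to `M`.
There it produces `2 ^ k` traces, more than the polynomial bound allows for suitable `k`. -/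
theorem isNIP_of_polyBounded
    (h : ∀ (n m : ℕ) (φ : L.Formula (Fin n ⊕ Fin m)),
      PolyBounded fun (b : Fin m → M) (a : Fin n → M) => φ.Realize (Sum.elim a b)) :
    IsNIP (L.completeTheory M) := by
  classical
  rintro n m φ N _ _ hN ⟨a, b, hab⟩
  obtain ⟨d, hd⟩ := h n m φ
  obtain ⟨k, hk⟩ := exists_pow_lt_two_pow d
  let γ := (Fin k × Fin n) ⊕ (Set (Fin k) × Fin m)
  let lit : Fin k × Set (Fin k) → L.Formula γ := fun p =>
    let ψ : L.Formula γ := φ.relabel (Sum.map (fun i => (p.1, i)) fun j => (p.2, j))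
    if p.1 ∈ p.2 then ψ else ψ.not
  have hlit : ∀ (K : Type) [L.Structure K] (p) (v : γ → K), (lit p).Realize v ↔
      (φ.Realize (Sum.elim (fun i => v (.inl (p.1, i))) fun j => v (.inr (p.2, j))) ↔
        p.1 ∈ p.2) := by
    intro K _ p v
    have e : v ∘ Sum.map (fun i => (p.1, i)) (fun j => (p.2, j)) =
        Sum.elim (fun i => v (.inl (p.1, i))) fun j => v (.inr (p.2, j)) := by
      funext o
      rcases o with o | o <;> rfl
    by_cases hp : p.1 ∈ p.2
    · simp only [lit, hp, if_true, Formula.realize_relabel, e, iff_true]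
    · simp only [lit, hp, if_false, Formula.realize_not, Formula.realize_relabel, e, iff_false]
  let σ : L.Sentence := ((Formula.iInf lit).relabel (Sum.inr : γ → Empty ⊕ γ)).iExs γ
  have hσ : ∀ (K : Type) [L.Structure K], K ⊨ σ ↔ ∃ v : γ → K, ∀ p, (lit p).Realize v := by
    intro K _
    simp only [Sentence.Realize, σ, Formula.realize_iExs, Formula.realize_relabel,
      Formula.realize_iInf, Sum.elim_comp_inr]
  have hσN : N ⊨ σ := by
    refine (hσ N).2 ⟨Sum.elim (fun q => a q.1 q.2) fun q => b (Fin.val '' q.1) q.2, fun p => ?_⟩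
    rw [hlit]
    refine (hab p.1 (Fin.val '' p.2)).trans ?_
    simp [Fin.val_inj]
  have hσM : M ⊨ σ := by
    by_contra hc
    have h1 : σ.not ∈ L.completeTheory M := hc
    exact (hN.realize_of_mem _ h1) hσN
  obtain ⟨v, hv⟩ := (hσ M).1 hσM
  simp only [hlit, Prod.forall] at hv
  have h1 := hd (Fin k) fun t i => v (.inl (t, i))
  have h2 : (Set.univ : Set (Fin k → Prop)) ⊆ Set.range fun (b : Fin m → M) (t : Fin k) =>
      φ.Realize (Sum.elim (fun i => v (.inl (t, i))) b) := by
    intro f _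
    refine ⟨fun j => v (.inr ({t | f t}, j)), ?_⟩
    funext t
    exact propext (hv t {t | f t})
  have h3 := Set.ncard_le_ncard h2 (Set.toFinite _)
  rw [Set.ncard_univ, Nat.card_eq_fintype_card, Fintype.card_fun, Fintype.card_prop,
    Fintype.card_fin] at h3
  rw [Fintype.card_fin] at h1
  exact absurd (h3.trans h1) (not_le.2 hk)

/-- Without a polynomial bound, families of every finite size are shattered; a nonprincipal
ultrapower glues them into an infinite shattered family. -/
theorem IsNIP.polyBounded [Nonempty M] (h : IsNIP (L.completeTheory M)) (n m : ℕ)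
    (φ : L.Formula (Fin n ⊕ Fin m)) :
    PolyBounded fun (b : Fin m → M) (a : Fin n → M) => φ.Realize (Sum.elim a b) := by
  by_contra hc
  have hsh : ∀ d : ℕ, ∃ (a : Fin d → Fin n → M) (b : Set (Fin d) → Fin m → M),
      ∀ t s, φ.Realize (Sum.elim (a t) (b s)) ↔ t ∈ s := by
    intro d
    by_contra hd
    exact hc (PolyBounded.of_not_shatters d hd)
  choose a b hab using hsh
  let u : Ultrafilter ℕ := Filter.hyperfilter ℕ
  obtain ⟨N, _, f, c, -, hc⟩ := exists_ultrapower (L := L) (M := M) u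
  obtain ⟨x₀⟩ := ‹Nonempty M›
  have : Nonempty N := ⟨f x₀⟩
  have hN : N ⊨ L.completeTheory M := by
    refine ⟨fun σ hσ => ?_⟩
    exact (f.map_sentence σ).1 hσ
  let A : ℕ → Fin n → ℕ → M := fun t i d => if ht : t < d then a d ⟨t, ht⟩ i else x₀
  let B : Set ℕ → Fin m → ℕ → M := fun s j d => b d {t | t.1 ∈ s} j
  refine h n m φ N hN ⟨fun t i => c (A t i), fun s j => c (B s j), fun t s => ?_⟩
  have h1 := hc _ φ (Sum.elim (A t) (B s))
  have e : (fun g => c (Sum.elim (A t) (B s) g)) =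
      Sum.elim (fun i => c (A t i)) fun j => c (B s j) := by
    funext o
    rcases o with o | o <;> rfl
  rw [e] at h1
  refine h1.trans ?_
  have h2 : ∀ᶠ d in (u : Filter ℕ), (φ.Realize fun g => Sum.elim (A t) (B s) g d) ↔ t ∈ s := by
    have hgt : ∀ᶠ d in (u : Filter ℕ), t < d :=
      Filter.Tendsto.eventually_gt_atTop (Nat.hyperfilter_le_atTop) t
    filter_upwards [hgt] with d hd
    refine Iff.trans (iff_of_eq (congrArg φ.Realize ?_)) (hab d ⟨t, hd⟩ {t | t.1 ∈ s})
    funext o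
    rcases o with o | o
    · simp [A, hd]
    · rfl
  rw [Filter.eventually_congr h2]
  exact Filter.eventually_const

/-- Polynomial boundedness for relations defined with parameters, in arbitrary variables. -/
theorem IsNIP.polyBounded_pDef [Nonempty M] (h : IsNIP (L.completeTheory M)) {α α' : Type}
    {Q : (α ⊕ α' → M) → Prop} (hQ : PDef L Q) :
    PolyBounded fun (x : α → M) (y : α' → M) => Q (Sum.elim x y) := by
  classical
  obtain ⟨φ, hφ⟩ := hQ
  obtain ⟨n, g, ψ, hψ⟩ := exists_formula_fin (M := M) φ
  obtain ⟨x₀⟩ := ‹Nonempty M›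
  -- The constants from `M` are counted among the parameters. The coordinates belonging to the other
  -- side are filled with `x₀` or a constant and are never read.
  have h1 := IsNIP.polyBounded h n n (ψ.relabel fun i =>
    if (∃ a, g i = .inl (.inl a)) then (Sum.inr i : Fin n ⊕ Fin n) else Sum.inl i)
  have h2 := h1.comp
    (fun (x : α → M) i => Sum.elim (Sum.elim x fun _ : α' => x₀) id (g i))
    (fun (y : α' → M) i => Sum.elim (Sum.elim (fun _ : α => x₀) y) id (g i))
  refine h2.congr fun x y => ?_
  rw [← hφ, hψ, Formula.realize_relabel]
  refine iff_of_eq (congrArg _ (funext fun i => ?_))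
  rcases hg : g i with (a | a) | a <;> simp [hg]

end NIP

end GraphCoding

namespace GraphCoding

/-! ### The action of colours on the vertices of a coding -/

section Action

variable {L : FirstOrder.Language.{0, 0}} {M : Type} [L.Structure M] {E : L.Relations 2}
  {D : Layering M E} (C : Coding D)

theorem Layering.lt_size (D : Layering M E) (k : ℕ) : k < D.size k := by
  have h0 : 0 < D.size 0 := (Set.ncard_pos (D.finite 0)).2 (D.nonempty 0)
  induction k with
  | zero => exact h0
  | succ k ih => exact (Nat.succ_le_of_lt ih).trans_lt (D.strictMono (Nat.lt_succ_self k))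

theorem Coding.color_symm {u v : C.V} (h : C.S.Adj u v) : C.color h.symm = C.color h := by
  unfold Coding.color
  congr 2
  exact Subtype.ext Sym2.eq_swap

theorem Coding.lev_color {u v : C.V} (h : C.S.Adj u v) : D.lev (C.color h) = C.lev u :=
  C.lev_π ⟨s(u, v), h⟩ u (Sym2.mem_mk_left u v)

theorem Coding.existsUnique_neighbor (c : M) (v : C.V) (h : D.lev c = C.lev v) :
    ∃! w, ∃ h : C.S.Adj v w, C.color h = c := by
  obtain ⟨⟨e, he⟩, ⟨hv, hq⟩, huniq⟩ := C.existsUnique_edge v (C.π.symm c) (by simpa using h)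
  obtain ⟨w, rfl⟩ := Sym2.mem_iff_exists.1 hv
  refine ⟨w, ⟨he, ?_⟩, ?_⟩
  · unfold Coding.color
    exact (Equiv.eq_symm_apply _).1 hq
  · rintro w' ⟨hw', hc⟩
    have := huniq ⟨s(v, w'), hw'⟩ ⟨Sym2.mem_mk_left _ _, (Equiv.eq_symm_apply _).2 hc⟩
    exact Sym2.congr_right.1 (congrArg Subtype.val this)

open Classical in
/-- The neighbour of `v` along the edge of colour `c`; the vertex `v` itself if its piece has no
edges of this colour. -/
noncomputable def Coding.act (c : M) (v : C.V) : C.V :=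
  if h : D.lev c = C.lev v then (C.existsUnique_neighbor c v h).choose else v

theorem Coding.act_of_ne {c : M} {v : C.V} (h : D.lev c ≠ C.lev v) : C.act c v = v :=
  dif_neg h

theorem Coding.act_eq_iff {c : M} {v w : C.V} (h : D.lev c = C.lev v) :
    C.act c v = w ↔ ∃ h : C.S.Adj v w, C.color h = c := by
  have hs := (C.existsUnique_neighbor c v h).choose_spec
  rw [Coding.act, dif_pos h]
  constructor
  · rintro rfl
    exact hs.1
  · exact fun hw => (hs.2 w hw).symm

theorem Coding.adj_act {c : M} {v : C.V} (h : D.lev c = C.lev v) : C.S.Adj v (C.act c v) :=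
  ((C.act_eq_iff h).1 rfl).1

theorem Coding.color_adj_act {c : M} {v : C.V} (h : D.lev c = C.lev v) :
    C.color (C.adj_act h) = c :=
  ((C.act_eq_iff h).1 rfl).2

theorem Coding.lev_act (c : M) (v : C.V) : C.lev (C.act c v) = C.lev v := by
  by_cases h : D.lev c = C.lev v
  · exact (C.lev_eq_of_adj _ _ (C.adj_act h)).symm
  · rw [C.act_of_ne h]

theorem Coding.act_act (c : M) (v : C.V) : C.act c (C.act c v) = v := by
  by_cases h : D.lev c = C.lev v
  · refine (C.act_eq_iff (h.trans (C.lev_act c v).symm)).2 ⟨(C.adj_act h).symm, ?_⟩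
    exact (C.color_symm (C.adj_act h)).trans (C.color_adj_act h)
  · rw [C.act_of_ne h, C.act_of_ne h]

theorem Coding.act_eq_comm {c : M} {v w : C.V} : C.act c v = w ↔ v = C.act c w := by
  constructor
  · rintro rfl
    rw [C.act_act]
  · rintro rfl
    rw [C.act_act]

theorem Coding.eq_of_act_eq {c d : M} {v : C.V} (hc : D.lev c = C.lev v) (hd : D.lev d = C.lev v)
    (h : C.act c v = C.act d v) : c = d := by
  obtain ⟨h1, h2⟩ := (C.act_eq_iff hc).1 h
  obtain ⟨h3, h4⟩ := (C.act_eq_iff hd).1 rfl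
  exact h2.symm.trans h4

/-- The action of words of colours, the last letter acting first. -/
noncomputable def Coding.actL (l : List M) (v : C.V) : C.V :=
  l.foldr C.act v

@[simp]
theorem Coding.actL_nil (v : C.V) : C.actL [] v = v := rfl

@[simp]
theorem Coding.actL_cons (c : M) (l : List M) (v : C.V) :
    C.actL (c :: l) v = C.act c (C.actL l v) := rfl

theorem Coding.actL_append (l l' : List M) (v : C.V) :
    C.actL (l ++ l') v = C.actL l (C.actL l' v) :=
  List.foldr_append

theorem Coding.lev_actL (l : List M) (v : C.V) : C.lev (C.actL l v) = C.lev v := by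
  induction l with
  | nil => rfl
  | cons c l ih => rw [C.actL_cons, C.lev_act, ih]

/-- The letters are involutions, so the reversed word is the inverse. -/
theorem Coding.actL_eq_comm {l : List M} {v w : C.V} :
    C.actL l v = w ↔ v = C.actL l.reverse w := by
  induction l generalizing v w with
  | nil => rfl
  | cons c l ih =>
    rw [C.actL_cons, C.act_eq_comm, ih, List.reverse_cons, C.actL_append]
    rfl

/-! ### Girth, reduced words and distances -/

/-- The walk along a word all of whose letters are colours of the piece of the vertex. -/
theorem Coding.exists_walk (l : List M) (v : C.V) (hl : ∀ c ∈ l, D.lev c = C.lev v) :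
    ∃ p : C.S.Walk (C.actL l v) v, p.length = l.length ∧
      p.support = l.tails.map fun t => C.actL t v := by
  induction l with
  | nil => exact ⟨.nil, rfl, rfl⟩
  | cons c l ih =>
    obtain ⟨p, hp, hp'⟩ := ih fun d hd => hl d (List.mem_cons_of_mem _ hd)
    have hc : D.lev c = C.lev (C.actL l v) :=
      (hl c List.mem_cons_self).trans (C.lev_actL l v).symm
    refine ⟨.cons (C.adj_act hc).symm p, by simp [hp], ?_⟩
    rw [List.tails_cons, List.map_cons, ← hp']
    exact SimpleGraph.Walk.support_cons _ _

/-- A nonempty reduced word that is not longer than the girth allows has no fixed points. -/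
theorem Coding.actL_ne_of_reduced {l : List M} {v : C.V} (hne : l ≠ [])
    (hchain : l.IsChain (· ≠ ·)) (hl : ∀ c ∈ l, D.lev c = C.lev v)
    (hlen : l.length ≤ D.size (C.lev v)) : C.actL l v ≠ v := by
  induction hn : l.length using Nat.strong_induction_on generalizing l v with
  | _ n ih =>
  intro hfix
  obtain ⟨c, l', rfl⟩ := List.exists_cons_of_ne_nil hne
  have hl' : ∀ d ∈ l', D.lev d = C.lev v := fun d hd => hl d (List.mem_cons_of_mem _ hd)
  have hc : D.lev c = C.lev v := hl c List.mem_cons_self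
  obtain ⟨p, hp, hp'⟩ := C.exists_walk l' v hl'
  -- A vertex visited twice would be a fixed point of a shorter reduced word, so the walk along `l'`
  -- is a path.
  have hnodup : p.support.Nodup := by
    rw [hp']
    have hsuf : ∀ t, t <:+ l' → (t.tails.map fun t => C.actL t v).Nodup := by
      intro t
      induction t with
      | nil => intro _; simp
      | cons d t iht =>
        intro ht
        rw [List.tails_cons, List.map_cons, List.nodup_cons]
        refine ⟨fun hmem => ?_, iht ((List.suffix_cons d t).trans ht)⟩
        obtain ⟨t', ht', he⟩ := List.mem_map.1 hmem
        obtain ⟨s, rfl⟩ := (List.mem_tails _ _).1 ht'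
        have hsub : (d :: s) <:+: l' := by
          refine List.IsInfix.trans ?_ ht.isInfix
          exact (List.prefix_append (d :: s) t').isInfix
        have hlen' := hsub.length_le
        simp only [List.length_cons] at hlen hlen' hn
        refine ih (d :: s).length (by simp only [List.length_cons]; omega) (l := d :: s)
          (v := C.actL t' v) (List.cons_ne_nil _ _)
          (hchain.infix (hsub.trans (List.suffix_cons c l').isInfix)) ?_ ?_ rfl ?_
        · intro e he'
          rw [C.lev_actL]
          exact hl' e (hsub.subset he')
        · rw [C.lev_actL, List.length_cons]
          omega
        · rw [← C.actL_append]
          exact he.symm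
    exact hsuf l' List.suffix_rfl
  have hadj : C.S.Adj v (C.actL l' v) := by
    rw [C.actL_cons, C.act_eq_comm] at hfix
    rw [hfix]
    exact C.adj_act hc
  -- The edge of colour `c` closes the path. It could lie on the path only if `l'` were a single
  -- letter, which would then equal `c`, against reducedness.
  have hcyc : (SimpleGraph.Walk.cons hadj p).IsCycle := by
    rw [SimpleGraph.Walk.cons_isCycle_iff]
    refine ⟨(SimpleGraph.Walk.isPath_def p).2 hnodup, fun he => ?_⟩
    have h1 := ((SimpleGraph.Walk.isPath_def p).2 hnodup).length_eq_one_of_mem_edges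
      (by rwa [Sym2.eq_swap])
    rw [hp] at h1
    obtain ⟨d, rfl⟩ := List.length_eq_one_iff.1 h1
    rw [C.actL_cons, C.act_eq_comm] at hfix
    have hcd := C.eq_of_act_eq (hl' d (by simp)) hc hfix
    simp [hcd] at hchain
  have := C.no_short_cycle v _ hcyc
  simp only [SimpleGraph.Walk.length_cons, hp] at this
  simp only [List.length_cons] at hlen
  omega

/-- Every word acts on a piece like a reduced word, and so it does in every other action by
involutions in which the colours of other pieces act trivially. -/
theorem Coding.exists_reduced (l : List M) (k : ℕ) : ∃ r : List M, r.IsChain (· ≠ ·) ∧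
    (∀ c ∈ r, D.lev c = k) ∧ r.length ≤ l.length ∧
    (∀ v : C.V, C.lev v = k → C.actL l v = C.actL r v) ∧
    ∀ f : M → ℤ → ℤ, (∀ c x, f c (f c x) = x) → (∀ c x, D.lev c ≠ k → f c x = x) →
      ∀ x, l.foldr f x = r.foldr f x := by
  induction l with
  | nil => exact ⟨[], by simp⟩
  | cons c l ih =>
    obtain ⟨r, h1, h2, h3, h4, h5⟩ := ih
    by_cases hc : D.lev c = k
    · by_cases hr : r.head? = some c
      · obtain ⟨r', rfl⟩ : ∃ r', r = c :: r' := List.head?_eq_some_iff.1 hr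
        refine ⟨r', h1.tail, fun d hd => h2 d (List.mem_cons_of_mem _ hd), ?_, ?_, ?_⟩
        · simp only [List.length_cons] at h3 ⊢
          omega
        · intro v hv
          rw [C.actL_cons, h4 v hv, C.actL_cons, C.act_act]
        · intro f hf hf' x
          rw [List.foldr_cons, h5 f hf hf', List.foldr_cons, hf]
      · refine ⟨c :: r, ?_, ?_, ?_, ?_, ?_⟩
        · refine List.isChain_cons.2 ⟨fun d hd => ?_, h1⟩
          rintro rfl
          exact hr hd
        · intro d hd
          rcases List.mem_cons.1 hd with rfl | hd
          exacts [hc, h2 d hd]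
        · simp only [List.length_cons]
          omega
        · intro v hv
          rw [C.actL_cons, h4 v hv, C.actL_cons]
        · intro f hf hf' x
          rw [List.foldr_cons, h5 f hf hf', List.foldr_cons]
    · refine ⟨r, h1, h2, h3.trans (by simp), ?_, ?_⟩
      · intro v hv
        rw [C.actL_cons, C.act_of_ne, h4 v hv]
        rwa [C.lev_actL, hv]
      · intro f hf hf' x
        rw [List.foldr_cons, hf' _ _ hc, h5 f hf hf']

/-- The reduced form of `l` is short and has a fixed point, so it is empty. Hence vertices can be
told apart by comparing words in any convenient action on `ℤ`. -/
theorem Coding.foldr_eq_of_actL_eq {l : List M} {v : C.V} (h : C.actL l v = v)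
    (hlen : l.length ≤ D.size (C.lev v)) (f : M → ℤ → ℤ) (hf : ∀ c x, f c (f c x) = x)
    (hf' : ∀ c x, D.lev c ≠ C.lev v → f c x = x) (x : ℤ) : l.foldr f x = x := by
  obtain ⟨r, h1, h2, h3, h4, h5⟩ := C.exists_reduced l (C.lev v)
  have hr : r = [] := by
    by_contra hr
    refine C.actL_ne_of_reduced hr h1 h2 (h3.trans hlen) ?_
    rw [← h4 v rfl, h]
  rw [h5 f hf hf', hr, List.foldr_nil]

/-- Pieces of high level contain many vertices that are far from each other. -/
theorem Coding.exists_pairwise_far (n R k : ℕ) (hk : 4 * n * (R + 1) + R + 2 ≤ k) :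
    ∃ v : ℕ → C.V, (∀ i, C.lev (v i) = k) ∧ ∀ i ≤ n, ∀ j ≤ n, i ≠ j →
      ∀ l : List M, l.length ≤ R → C.actL l (v i) ≠ v j := by
  classical
  have hsize := D.lt_size k
  obtain ⟨a, ha, b, hb, hab⟩ := (Set.one_lt_ncard_iff_nontrivial_and_finite.1
    (show 1 < {a : M | D.lev a = k}.ncard from lt_of_le_of_lt (by omega) hsize)).1
  obtain ⟨u, hu⟩ := C.nonempty k
  let w : ℕ → List M := fun i => (List.replicate i [a, b]).flatten
  -- The infinite dihedral group on `ℤ`: `w i` is the power `(ab) ^ i` and takes `0` to `-i`,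
  -- whereas a word of length at most `R` changes the absolute value by at most `R`.
  let f : M → ℤ → ℤ := fun c x => if c = a then -x else if c = b then 1 - x else x
  have hf : ∀ c x, f c (f c x) = x := by
    intro c x
    simp only [f]
    split_ifs <;> ring
  have hf' : ∀ c x, D.lev c ≠ k → f c x = x := by
    intro c x hc
    have h1 : c ≠ a := by rintro rfl; exact hc ha
    have h2 : c ≠ b := by rintro rfl; exact hc hb
    simp [f, h1, h2]
  have hw : ∀ i : ℕ, (w i).foldr f 0 = -(i : ℤ) := by
    intro i
    induction i with
    | zero => rfl
    | succ i ih =>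
      have : w (i + 1) = a :: b :: w i := by simp [w, List.replicate_succ]
      rw [this, List.foldr_cons, List.foldr_cons, ih]
      have hba : b ≠ a := hab.symm
      simp only [f, if_true, if_neg hba]
      push_cast
      ring
  have hwl : ∀ i : ℕ, (w i).length = 2 * i := by
    intro i
    simp [w, mul_comm]
  have hfl : ∀ (l : List M) (x : ℤ), |l.foldr f x - x| ≤ l.length ∨
      |l.foldr f x + x| ≤ l.length := by
    intro l x
    induction l with
    | nil => left; simp
    | cons c l ih =>
      rw [List.foldr_cons, List.length_cons]
      generalize l.foldr f x = y at ih
      simp only [f]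
      push_cast
      split_ifs
      · rcases ih with h | h
        · right
          rw [abs_le] at h ⊢
          constructor <;> linarith [h.1, h.2]
        · left
          rw [abs_le] at h ⊢
          constructor <;> linarith [h.1, h.2]
      · rcases ih with h | h
        · right
          rw [abs_le] at h ⊢
          constructor <;> linarith [h.1, h.2]
        · left
          rw [abs_le] at h ⊢
          constructor <;> linarith [h.1, h.2]
      · rcases ih with h | h
        · left; linarith
        · right; linarith
  -- A word `l` joining two of these vertices would give a relation of length at most `4 * n * (R +
  -- 1) + R`, which the girth excludes unless it also holds on `ℤ`. There the images of `0` have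
  -- absolute values at least `R + 1` apart.
  refine ⟨fun i => C.actL (w (i * (R + 1))) u, fun i => (C.lev_actL _ _).trans hu, ?_⟩
  intro i hi j hj hij l hl he
  rw [← C.actL_append, eq_comm, C.actL_eq_comm, ← C.actL_append, eq_comm] at he
  have hi' : i * (R + 1) ≤ n * (R + 1) := Nat.mul_le_mul_right _ hi
  have hj' : j * (R + 1) ≤ n * (R + 1) := Nat.mul_le_mul_right _ hj
  have key := C.foldr_eq_of_actL_eq he (by
    rw [hu]
    simp only [List.length_append, List.length_reverse, hwl]
    nlinarith) f hf (by rwa [hu]) 0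
  have hrev : ∀ (l : List M) x y, l.reverse.foldr f x = y → x = l.foldr f y := by
    intro l
    induction l with
    | nil => intro x y h; exact h
    | cons c l ih =>
      intro x y h
      rw [List.reverse_cons, List.foldr_append] at h
      have := ih _ _ h
      rw [List.foldr_cons, List.foldr_nil] at this
      rw [List.foldr_cons, ← this, hf]
  rw [List.foldr_append] at key
  have key2 := hrev _ _ _ key
  rw [List.foldr_append, hw, hw] at key2
  have h3 := hfl l (-((i * (R + 1) : ℕ) : ℤ))
  rw [key2] at h3
  have hlR : (l.length : ℤ) ≤ R := by exact_mod_cast hl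
  push_cast at h3
  rcases Nat.lt_or_gt_of_ne hij with h | h
  · have h4 : ((i : ℤ) + 1) * (R + 1) ≤ j * (R + 1) := by
      have : (i : ℤ) + 1 ≤ j := by exact_mod_cast h
      gcongr
    have h5 : (0 : ℤ) ≤ (i : ℤ) * (R + 1) := by positivity
    rcases h3 with h3 | h3 <;> rw [abs_le] at h3 <;> nlinarith [h3.1, h3.2]
  · have h4 : ((j : ℤ) + 1) * (R + 1) ≤ i * (R + 1) := by
      have : (j : ℤ) + 1 ≤ i := by exact_mod_cast h
      gcongr
    have h5 : (0 : ℤ) ≤ (j : ℤ) * (R + 1) := by positivity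
    rcases h3 with h3 | h3 <;> rw [abs_le] at h3 <;> nlinarith [h3.1, h3.2]

/-- `y` is not obtained from `v` by a word of length at most `R`. -/
def Coding.Far (R : ℕ) (v y : C.V) : Prop :=
  ∀ l : List M, l.length ≤ R → C.actL l v ≠ y

/-- Among vertices that no word of length `2 * R` joins, each `u i` is near at most one. So one more
of them than there are indices suffices. -/
theorem Coding.exists_far (β : Type) [Finite β] (R : ℕ) : ∃ K : ℕ, ∀ k, K ≤ k →
    ∀ u : β → C.V, ∃ y, C.lev y = k ∧ ∀ i, C.Far R (u i) y := by
  classical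
  have := Fintype.ofFinite β
  refine ⟨4 * Fintype.card β * (2 * R + 1) + 2 * R + 2, fun k hk u => ?_⟩
  obtain ⟨v, hv, hfar⟩ := C.exists_pairwise_far _ _ _ hk
  by_contra hcon
  have hnear : ∀ j : Fin (Fintype.card β + 1), ∃ i, ∃ l : List M, l.length ≤ R ∧
      C.actL l (u i) = v j := by
    intro j
    by_contra hj
    refine hcon ⟨v j, hv j, fun i l hl he => hj ⟨i, l, hl, he⟩⟩
  choose i l hl he using hnear
  obtain ⟨j, j', hne, hjj⟩ := Fintype.exists_ne_map_eq_of_card_lt i (by simp)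
  refine hfar j (Nat.lt_succ_iff.1 j.2) j' (Nat.lt_succ_iff.1 j'.2)
    (fun h => hne (Fin.ext h)) (l j' ++ (l j).reverse) ?_ ?_
  · have := hl j
    have := hl j'
    simp only [List.length_append, List.length_reverse]
    omega
  · rw [C.actL_append, ← C.actL_eq_comm.1 (he j), hjj, he]

theorem Coding.finite_lev_lt (C : Coding D) (N : ℕ) : {f : C.V | C.lev f < N}.Finite := by
  have : {f : C.V | C.lev f < N} = ⋃ k ∈ {k | k < N}, {f | C.lev f = k} := by
    ext; simp
  rw [this]
  exact (Set.finite_lt_nat _).biUnion fun k _ => C.finite k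

end Action

end GraphCoding

namespace GraphCoding

/-! ### Relations definable without quantifiers over vertices -/

section Simple

variable {L : FirstOrder.Language.{0, 0}} {M : Type} [L.Structure M] {E : L.Relations 2}
  {D : Layering M E}

/-- The relations between colours and vertices that are definable, with parameters, from the
structure on the colours, the levels and the action of colours on vertices, without
quantification over vertices. -/
inductive Simple (C : Coding D) (β : Type) : {α : Type} → ((α → M) → (β → C.V) → Prop) → Prop
  | eq {α : Type} (a b : α) : Simple C β fun x _ => x a = x b
  | const {α : Type} (a : α) (c : M) : Simple C β fun x _ => x a = c
  | rel {α : Type} {n : ℕ} (R : L.Relations n) (a : Fin n → α) :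
      Simple C β fun x _ => Structure.RelMap R fun i => x (a i)
  | lev {α : Type} (a : α) (i : β) : Simple C β fun x v => D.lev (x a) = C.lev (v i)
  | act {α : Type} (l : List α) (i j : β) : Simple C β fun x v => C.actL (l.map x) (v i) = v j
  | vconst {α : Type} (i : β) (f : C.V) : Simple C β fun (_ : α → M) v => v i = f
  | not {α : Type} {Q : (α → M) → (β → C.V) → Prop} (h : Simple C β Q) :
      Simple C β fun x v => ¬ Q x v
  | and {α : Type} {Q Q' : (α → M) → (β → C.V) → Prop} (h : Simple C β Q) (h' : Simple C β Q') :
      Simple C β fun x v => Q x v ∧ Q' x v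
  | ex {α : Type} {Q : (Option α → M) → (β → C.V) → Prop} (h : Simple C β Q) :
      Simple C β fun x v => ∃ c, Q (fun o => o.elim c x) v

variable {C : Coding D} {α α' β β' : Type}

namespace Simple

theorem congr {Q Q' : (α → M) → (β → C.V) → Prop} (h : Simple C β Q)
    (e : ∀ x v, Q x v ↔ Q' x v) : Simple C β Q' := by
  have : Q = Q' := by
    funext x v
    exact propext (e x v)
  rwa [← this]

theorem or {Q Q' : (α → M) → (β → C.V) → Prop} (h : Simple C β Q) (h' : Simple C β Q') :
    Simple C β fun x v => Q x v ∨ Q' x v :=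
  (h.not.and h'.not).not.congr fun x v => by tauto

theorem prop [Nonempty M] (p : Prop) : Simple C β fun (_ : α → M) _ => p := by
  have h : Simple C β fun (_ : α → M) _ => True :=
    (Simple.ex (Simple.eq (none : Option α) none)).congr fun x v => by simp
  by_cases hp : p
  · exact h.congr fun _ _ => by simp [hp]
  · exact h.not.congr fun _ _ => by simp [hp]

theorem exists_finite [Nonempty M] {ι : Type} {s : Set ι} (hs : s.Finite)
    {Q : ι → (α → M) → (β → C.V) → Prop} (h : ∀ i ∈ s, Simple C β (Q i)) :
    Simple C β fun x v => ∃ i ∈ s, Q i x v := by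
  induction s, hs using Set.Finite.induction_on with
  | empty => exact (prop False).congr fun x v => by simp
  | @insert a s ha hs ih =>
    refine ((h a (Set.mem_insert _ _)).or
      (ih fun i hi => h i (Set.mem_insert_of_mem _ hi))).congr fun x v => ?_
    simp

theorem exists_index [Nonempty M] {ι : Type} [Finite ι]
    {Q : ι → (α → M) → (β → C.V) → Prop} (h : ∀ i, Simple C β (Q i)) :
    Simple C β fun x v => ∃ i, Q i x v :=
  (exists_finite (Set.toFinite Set.univ) fun i _ => h i).congr fun x v => by simp

theorem forall_index [Nonempty M] {ι : Type} [Finite ι]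
    {Q : ι → (α → M) → (β → C.V) → Prop} (h : ∀ i, Simple C β (Q i)) :
    Simple C β fun x v => ∀ i, Q i x v :=
  (exists_index fun i => (h i).not).not.congr fun x v => by simp

/-- Renaming of the variables for colours. -/
theorem relabel {Q : (α → M) → (β → C.V) → Prop} (h : Simple C β Q) (τ : α → α') :
    Simple C β fun x v => Q (fun a => x (τ a)) v := by
  induction h generalizing α' with
  | eq a b => exact Simple.eq (τ a) (τ b)
  | const a c => exact Simple.const (τ a) c
  | rel R a => exact Simple.rel R fun i => τ (a i)
  | lev a i => exact Simple.lev (τ a) i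
  | act l i j =>
    refine (Simple.act (l.map τ) i j).congr fun x v => ?_
    rw [List.map_map]
    rfl
  | vconst i f => exact Simple.vconst i f
  | not _ ih => exact (ih τ).not
  | and _ _ ih ih' => exact (ih τ).and (ih' τ)
  | ex _ ih =>
    refine (Simple.ex (ih (Option.map τ))).congr fun x v => ?_
    refine exists_congr fun c => ?_
    refine iff_of_eq (congrArg₂ _ (funext fun o => ?_) rfl)
    cases o <;> rfl

theorem exists_tuple {n : ℕ} {Q : (α ⊕ Fin n → M) → (β → C.V) → Prop} (h : Simple C β Q) :
    Simple C β fun x v => ∃ w : Fin n → M, Q (Sum.elim x w) v := by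
  induction n generalizing α with
  | zero =>
    refine (h.relabel (Sum.elim id Fin.elim0)).congr fun x v => ?_
    have : ∀ w : Fin 0 → M, (fun a => x (Sum.elim id Fin.elim0 a)) = Sum.elim x w := by
      intro w
      funext a
      rcases a with a | a
      · rfl
      · exact a.elim0
    constructor
    · intro hx
      exact ⟨Fin.elim0, by rwa [← this]⟩
    · rintro ⟨w, hw⟩
      rwa [this w]
  | succ n ih =>
    have h1 := h.relabel (α' := Option α ⊕ Fin n)
      (Sum.elim (fun a => .inl (some a)) (Fin.cases (.inl none) .inr))
    refine (ih h1).ex.congr fun x v => ?_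
    have key : ∀ (c : M) (w : Fin n → M),
        (fun a => Sum.elim (fun o : Option α => o.elim c x) w
          (Sum.elim (fun a => .inl (some a)) (Fin.cases (.inl none) .inr) a)) =
        Sum.elim x (Fin.cons c w : Fin (n + 1) → M) := by
      intro c w
      funext a
      rcases a with a | a
      · rfl
      · refine Fin.cases ?_ (fun i => ?_) a <;> rfl
    constructor
    · rintro ⟨c, w, hw⟩
      exact ⟨Fin.cons c w, by rwa [← key]⟩
    · rintro ⟨w, hw⟩
      refine ⟨w 0, Fin.tail w, ?_⟩
      rw [key, Fin.cons_self_tail]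
      exact hw

theorem lev_const (a : α) (k : ℕ) : Simple C β fun (x : α → M) _ => D.lev (x a) = k := by
  obtain ⟨d, hd⟩ := D.nonempty k
  refine (((Simple.const (none : Option α) d)).and
    (Simple.rel E ![some a, none])).ex.congr fun x v => ?_
  have key : ∀ c, (Structure.RelMap E fun i =>
      ((![some a, none] : Fin 2 → Option α) i).elim c x) ↔ D.lev (x a) = D.lev c := by
    intro c
    rw [← D.rel_iff]
    refine iff_of_eq (congrArg _ (funext fun i => ?_))
    fin_cases i <;> rfl
  simp only [key]
  simp only [Option.elim_none, exists_eq_left]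
  rw [show D.lev d = k from hd]

theorem lev_eq (a b : α) : Simple C β fun (x : α → M) _ => D.lev (x a) = D.lev (x b) := by
  refine (Simple.rel E ![a, b]).congr fun x v => ?_
  rw [← D.rel_iff]
  refine iff_of_eq (congrArg _ (funext fun i => ?_))
  fin_cases i <;> rfl

theorem le_lev [Nonempty M] (a : α) (k : ℕ) :
    Simple C β fun (x : α → M) _ => k ≤ D.lev (x a) := by
  refine (exists_finite (Set.finite_lt_nat k)
    fun j _ => lev_const (C := C) (β := β) a j).not.congr fun x v => ?_
  simp

/-- The outermost letter moves to the other side of the equation. Either it is one of the finitely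
many colours of the level of `g`, or it fixes `g`. -/
theorem act_const_const [Nonempty M] (l : List α) (f g : C.V) :
    Simple C β fun (x : α → M) _ => C.actL (l.map x) f = g := by
  induction l generalizing g with
  | nil => exact prop (C := C) (f = g)
  | cons a l ih =>
    refine ((exists_finite (D.finite (C.lev g)) fun c _ =>
      (Simple.const a c).and (ih (C.act c g))).or ((lev_const a (C.lev g)).not.and (ih g))).congr
      fun x v => ?_
    rw [List.map_cons, C.actL_cons, C.act_eq_comm]
    by_cases h : D.lev (x a) = C.lev g
    · simp [h]
    · rw [C.act_of_ne h]
      simp only [Set.mem_ofPred_eq, h, not_false_eq_true, true_and, or_iff_right_iff_imp]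
      rintro ⟨c, hc, rfl, -⟩
      exact absurd hc h

theorem act_const [Nonempty M] (l : List α) (i : β) (f : C.V) :
    Simple C β fun x v => C.actL (l.map x) (v i) = f := by
  refine (exists_finite (C.finite (C.lev f)) fun g _ =>
    (Simple.vconst i g).and (act_const_const l g f)).congr fun x v => ?_
  constructor
  · rintro ⟨g, -, rfl, hg⟩
    exact hg
  · intro h
    refine ⟨v i, ?_, rfl, h⟩
    rw [Set.mem_ofPred_eq, ← h, C.lev_actL]

/-- Substitution of constants and of words applied to vertices for the variables for vertices. -/
theorem subst [Nonempty M] {Q : (α → M) → (β → C.V) → Prop} (h : Simple C β Q)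
    (σ : β → C.V ⊕ List α × β') :
    Simple C β' fun x v => Q x fun i => (σ i).elim id fun p => C.actL (p.1.map x) (v p.2) := by
  induction h with
  | eq a b => exact Simple.eq a b
  | const a c => exact Simple.const a c
  | rel R a => exact Simple.rel R a
  | lev a i =>
    rcases hi : σ i with f | ⟨l, k⟩
    · refine (lev_const a (C.lev f)).congr fun x v => by simp [hi]
    · refine (Simple.lev a k).congr fun x v => by simp [hi, C.lev_actL]
  | act l i j =>
    rcases hi : σ i with f | ⟨l', k⟩ <;> rcases hj : σ j with g | ⟨l'', k'⟩
    · exact (act_const_const l f g).congr fun x v => by simp [hi, hj]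
    · refine (act_const (l.reverse ++ l'') k' f).congr fun x v => ?_
      simp only [hi, hj, Sum.elim_inl, Sum.elim_inr, id]
      rw [List.map_append, C.actL_append, List.map_reverse, eq_comm, ← C.actL_eq_comm]
    · refine (act_const (l ++ l') k g).congr fun x v => ?_
      simp only [hi, hj, Sum.elim_inl, Sum.elim_inr, id]
      rw [List.map_append, C.actL_append]
    -- Moving `l''` across as its inverse leaves a single word applied to `v k`.
    · refine (Simple.act (l''.reverse ++ (l ++ l')) k k').congr fun x v => ?_
      simp only [hi, hj, Sum.elim_inr]
      rw [List.map_append, C.actL_append, List.map_append, C.actL_append, List.map_reverse,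
        eq_comm, ← C.actL_eq_comm, eq_comm]
  | vconst i f =>
    rcases hi : σ i with g | ⟨l, k⟩
    · exact (prop (g = f)).congr fun x v => by simp [hi]
    · exact (act_const l k f).congr fun x v => by simp [hi]
  | not _ ih => exact (ih σ).not
  | and _ _ ih ih' => exact (ih σ).and (ih' σ)
  | ex _ ih =>
    refine (Simple.ex (ih fun i => (σ i).map id fun p => (p.1.map some, p.2))).congr fun x v => ?_
    refine exists_congr fun c => iff_of_eq (congrArg _ (funext fun i => ?_))
    rcases hi : σ i with g | ⟨l, k⟩
    · simp
    · simp [Function.comp_def]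

theorem vrelabel [Nonempty M] {Q : (α → M) → (β → C.V) → Prop} (h : Simple C β Q) (τ : β → β') :
    Simple C β' fun x v => Q x fun i => v (τ i) :=
  h.subst fun i => .inr ([], τ i)

/-! ### Elimination of quantifiers over vertices -/

/-- For pieces of high level, triviality of words is definable on the side of colours. The letters
in `s` form a reduced word. -/
theorem trivial_word_aux [Nonempty M] (l s : List α) :
    ∃ T : (Option α → M) → (β → C.V) → Prop, Simple C β T ∧
      ∀ (x : α → M) (e : M) (y : C.V) (v : β → C.V), D.lev e = C.lev y →
        (∀ a ∈ s, D.lev (x a) = C.lev y) → (s.map x).IsChain (· ≠ ·) →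
        s.length + l.length ≤ C.lev y →
        (C.actL ((l.reverse ++ s).map x) y = y ↔ T (fun o => o.elim e x) v) := by
  induction l generalizing s with
  | nil =>
    refine ⟨_, prop (s = []), fun x e y v _ hs hch hlen => ⟨fun h => ?_, fun h => ?_⟩⟩
    · by_contra hne
      refine C.actL_ne_of_reduced (l := s.map x) (v := y) (by simpa using hne) hch ?_ ?_ h
      · intro c hc
        obtain ⟨a, ha, rfl⟩ := List.mem_map.1 hc
        exact hs a ha
      · rw [List.length_map]
        exact (Nat.le_add_right _ _).trans (hlen.trans (D.lt_size _).le)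
    · simp [h]
  -- Free cancellation is simulated with `s` as a stack: a letter whose level is not that of `e` is
  -- dropped, a letter equal to the head of `s` cancels it, any other letter is put on `s`.
  | cons a l ih =>
    obtain ⟨T₁, hT₁, h₁⟩ := ih s
    obtain ⟨T₂, hT₂, h₂⟩ := ih s.tail
    obtain ⟨T₃, hT₃, h₃⟩ := ih (a :: s)
    have hhead : Simple C β fun (x : Option α → M) _ => ∃ b ∈ {b | s.head? = some b},
        x (some a) = x (some b) :=
      exists_finite ((Set.finite_singleton s.head?).preimage
        (Option.some_injective α).injOn |>.subset fun b hb => hb.symm) fun b _ => Simple.eq _ _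
    refine ⟨_, ((lev_eq (some a) none).not.and hT₁).or
      ((lev_eq (some a) none).and ((hhead.and hT₂).or (hhead.not.and hT₃))), ?_⟩
    intro x e y v he hs hch hlen
    simp only [List.length_cons] at hlen
    simp only [Option.elim_some, Option.elim_none, Set.mem_ofPred_eq]
    rw [List.reverse_cons, List.append_assoc, List.singleton_append]
    by_cases ha : D.lev (x a) = D.lev e
    · simp only [ha, not_true, false_and, false_or, true_and]
      by_cases hh : ∃ b, s.head? = some b ∧ x a = x b
      · simp only [hh, true_and, not_true, false_and, or_false]
        obtain ⟨b, hb, hab⟩ := hh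
        obtain ⟨s', rfl⟩ : ∃ s', s = b :: s' := List.head?_eq_some_iff.1 hb
        simp only [List.length_cons] at hlen
        rw [← h₂ x e y v he (fun c hc => hs c (List.mem_cons_of_mem _ hc)) hch.tail
          (by simp only [List.tail_cons]; omega)]
        simp only [List.map_append, List.map_cons, C.actL_append, C.actL_cons, List.tail_cons,
          hab, C.act_act]
      · simp only [hh, false_and, not_false_eq_true, true_and, false_or]
        refine h₃ x e y v he ?_ ?_ (by simp only [List.length_cons]; omega)
        · intro c hc
          rcases List.mem_cons.1 hc with rfl | hc
          exacts [ha.trans he, hs c hc]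
        · rw [List.map_cons]
          refine List.isChain_cons.2 ⟨fun c hc => ?_, hch⟩
          rintro rfl
          rw [List.head?_map] at hc
          obtain ⟨b, hb, hab⟩ := Option.map_eq_some_iff.1 hc
          exact hh ⟨b, hb, hab.symm⟩
    · simp only [ha, not_false_eq_true, true_and, false_and, or_false]
      rw [← h₁ x e y v he hs hch (by omega)]
      simp only [List.map_append, List.map_cons, C.actL_append, C.actL_cons]
      rw [C.act_of_ne]
      rwa [C.lev_actL, ← he]

theorem trivial_word [Nonempty M] (l : List α) :
    ∃ T : (Option α → M) → (β → C.V) → Prop, Simple C β T ∧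
      ∀ (x : α → M) (e : M) (y : C.V) (v : β → C.V), D.lev e = C.lev y → l.length ≤ C.lev y →
        (C.actL (l.map x) y = y ↔ T (fun o => o.elim e x) v) := by
  obtain ⟨T, hT, h⟩ := trivial_word_aux (C := C) (β := β) l.reverse []
  refine ⟨T, hT, fun x e y v he hl => ?_⟩
  simpa using h x e y v he (by simp) (by simp) (by simpa using hl)

/-- For a vertex that is far from all others in the relation, only its level matters. -/
theorem generic [Nonempty M] {Q : (α → M) → (Option β → C.V) → Prop}
    (h : Simple C (Option β) Q) : ∃ N : ℕ, ∃ G : (Option α → M) → (β → C.V) → Prop,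
      Simple C β G ∧ ∀ (x : α → M) (v : β → C.V) (y : C.V) (e : M), N ≤ C.lev y →
        D.lev e = C.lev y → (∀ i, C.Far N (v i) y) →
        (Q x (fun o => o.elim y v) ↔ G (fun o => o.elim e x) v) := by
  induction h with
  | eq a b => exact ⟨0, _, Simple.eq (some a) (some b), fun _ _ _ _ _ _ _ => Iff.rfl⟩
  | const a c => exact ⟨0, _, Simple.const (some a) c, fun _ _ _ _ _ _ _ => Iff.rfl⟩
  | rel R a => exact ⟨0, _, Simple.rel R fun i => some (a i), fun _ _ _ _ _ _ _ => Iff.rfl⟩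
  | lev a i =>
    rcases i with _ | i
    · refine ⟨0, _, lev_eq (some a) none, fun x v y e _ he _ => ?_⟩
      simp [he]
    · exact ⟨0, _, Simple.lev (some a) i, fun _ _ _ _ _ _ _ => Iff.rfl⟩
  -- A word joining `y` to itself is decided by free cancellation; no short word joins `y` to
  -- another vertex.
  | act l i j =>
    rcases i with _ | i <;> rcases j with _ | j
    · obtain ⟨T, hT, h⟩ := trivial_word (C := C) (β := β) l
      exact ⟨l.length, T, hT, fun x v y e hy he _ => h x e y v he hy⟩
    · refine ⟨l.length, _, prop False, fun x v y e _ _ hf => ?_⟩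
      simp only [Option.elim_none, Option.elim_some, iff_false]
      intro h
      rw [C.actL_eq_comm] at h
      exact hf j _ (by simp) h.symm
    · refine ⟨l.length, _, prop False, fun x v y e _ _ hf => ?_⟩
      simp only [Option.elim_none, Option.elim_some, iff_false]
      exact hf i _ (by simp)
    · refine ⟨0, _, Simple.act (l.map some) i j, fun x v y e _ _ _ => ?_⟩
      simp [Function.comp_def]
  | vconst i f =>
    rcases i with _ | i
    · refine ⟨C.lev f + 1, _, prop False, fun x v y e hy _ _ => ?_⟩
      simp only [Option.elim_none, iff_false]
      rintro rfl
      omega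
    · exact ⟨0, _, Simple.vconst i f, fun _ _ _ _ _ _ _ => Iff.rfl⟩
  | not _ ih =>
    obtain ⟨N, G, hG, h⟩ := ih
    exact ⟨N, _, hG.not, fun x v y e h1 h2 h3 => not_congr (h x v y e h1 h2 h3)⟩
  | and _ _ ih ih' =>
    obtain ⟨N, G, hG, h⟩ := ih
    obtain ⟨N', G', hG', h'⟩ := ih'
    refine ⟨max N N', _, hG.and hG', fun x v y e h1 h2 h3 => and_congr
      (h x v y e (le_of_max_le_left h1) h2 fun i l hl => h3 i l (hl.trans (le_max_left _ _)))
      (h' x v y e (le_of_max_le_right h1) h2 fun i l hl => h3 i l (hl.trans (le_max_right _ _)))⟩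
  -- A quantified colour adds no vertex, so neither `N` nor the condition of being far changes.
  | @ex α Q _ ih =>
    obtain ⟨N, G, hG, h⟩ := ih
    let τ : Option (Option α) → Option (Option α)
      | none => some none
      | some none => none
      | some (some a) => some (some a)
    refine ⟨N, _, (hG.relabel τ).ex, fun x v y e h1 h2 h3 => exists_congr fun c => ?_⟩
    refine (h _ v y e h1 h2 h3).trans (iff_of_eq (congrArg₂ _ (funext fun o => ?_) rfl))
    rcases o with _ | _ | o <;> rfl

theorem exists_length_le (N : ℕ) (P : List M → Prop) :
    (∃ l : List M, l.length ≤ N ∧ P l) ↔ ∃ n : Fin (N + 1), ∃ w : Fin n → M, P (List.ofFn w) := by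
  constructor
  · rintro ⟨l, hl, h⟩
    refine ⟨⟨l.length, Nat.lt_succ_of_le hl⟩, l.get, ?_⟩
    rwa [List.ofFn_get]
  · rintro ⟨n, w, h⟩
    exact ⟨_, by simpa using Nat.lt_succ_iff.1 n.2, h⟩

/-- The word formed by a tuple of new variables for colours. -/
def newWord (α : Type) (n : ℕ) : List (α ⊕ Fin n) :=
  List.ofFn Sum.inr

theorem map_newWord {n : ℕ} (x : α → M) (w : Fin n → M) :
    (newWord α n).map (Sum.elim x w) = List.ofFn w := by
  rw [newWord, List.map_ofFn]
  rfl

theorem far [Nonempty M] (N : ℕ) (i j : β) :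
    Simple C β fun (_ : α → M) v => C.Far N (v i) (v j) := by
  refine (exists_index fun n : Fin (N + 1) =>
    (Simple.act (newWord α n) i j).exists_tuple).not.congr fun x v => ?_
  simp only [map_newWord]
  rw [← exists_length_le N fun l => C.actL l (v i) = v j]
  simp [Coding.Far]

/-- The relation with the last vertex replaced by a constant. -/
theorem low [Nonempty M] {Q : (α → M) → (Option β → C.V) → Prop} (h : Simple C (Option β) Q)
    (f : C.V) : Simple C β fun x v => Q x fun o => o.elim f v := by
  refine (h.subst fun o : Option β => o.elim (.inl f) fun i => .inr ([], i)).congr fun x v => ?_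
  refine iff_of_eq (congrArg _ (funext fun o => ?_))
  cases o <;> rfl

/-- The relation with the last vertex replaced by a word applied to another vertex. -/
theorem near [Nonempty M] {Q : (α → M) → (Option β → C.V) → Prop} (h : Simple C (Option β) Q)
    (i : β) (n : ℕ) : Simple C β fun (x : α ⊕ Fin n → M) v =>
      Q (fun a => x (.inl a)) fun o => o.elim (C.actL ((newWord α n).map x) (v i)) v := by
  refine ((h.relabel (Sum.inl : α → α ⊕ Fin n)).subst fun o : Option β =>
    o.elim (.inr (newWord α n, i)) fun i => .inr ([], i)).congr fun x v => ?_
  refine iff_of_eq (congrArg _ (funext fun o => ?_))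
  cases o <;> rfl

/-- The closure of simple relations under quantification over vertices. -/
theorem exV [Nonempty M] [Finite β] {Q : (α → M) → (Option β → C.V) → Prop}
    (h : Simple C (Option β) Q) : Simple C β fun x v => ∃ y, Q x fun o => o.elim y v := by
  obtain ⟨N, G, hG, hgen⟩ := h.generic
  obtain ⟨K, hK⟩ := C.exists_far β N
  -- A witness is one of finitely many vertices of low level, or is given by a short word of
  -- quantified colours applied to some `v i`, or is far. In the last case only its level matters,
  -- which the colour `e` represents; conversely every level from `K` on contains a far vertex.
  refine ((exists_finite (C.finite_lev_lt (max K N)) fun f _ => h.low f).or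
    ((exists_index fun i : β => exists_index fun n : Fin (N + 1) => (h.near i n).exists_tuple).or
      ((le_lev none (max K N)).and hG).ex)).congr fun x v => ?_
  simp only [map_newWord, Sum.elim_inl, Option.elim_none]
  have hnear : ∀ i, (∃ n : Fin (N + 1), ∃ w : Fin n → M,
      Q x fun o => o.elim (C.actL (List.ofFn w) (v i)) v) ↔
      ∃ l : List M, l.length ≤ N ∧ Q x fun o => o.elim (C.actL l (v i)) v :=
    fun i => (exists_length_le N fun l => Q x fun o => o.elim (C.actL l (v i)) v).symm
  simp only [hnear]
  constructor
  · rintro (⟨f, -, hf⟩ | ⟨i, l, -, hl⟩ | ⟨e, he, hGe⟩)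
    · exact ⟨f, hf⟩
    · exact ⟨_, hl⟩
    · obtain ⟨y, hy, hfar⟩ := hK (D.lev e) (le_of_max_le_left he) v
      exact ⟨y, (hgen x v y e (hy ▸ le_of_max_le_right he) hy.symm hfar).2 hGe⟩
  · rintro ⟨y, hy⟩
    by_cases hlow : C.lev y < max K N
    · exact .inl ⟨y, hlow, hy⟩
    by_cases hfar : ∀ i, C.Far N (v i) y
    · obtain ⟨e, he⟩ := D.nonempty (C.lev y)
      refine .inr (.inr ⟨e, ?_, (hgen x v y e ?_ he hfar).1 hy⟩)
      · rw [show D.lev e = _ from he]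
        exact not_lt.1 hlow
      · exact (le_max_right _ _).trans (not_lt.1 hlow)
    · right
      left
      unfold Coding.Far at hfar
      push Not at hfar
      obtain ⟨i, l, hl, rfl⟩ := hfar
      exact ⟨i, l, hl, hy⟩

end Simple

end Simple

end GraphCoding

namespace GraphCoding

/-! ### Simple relations and definability -/

section Interface

variable {L : FirstOrder.Language.{0, 0}} {M : Type} [L.Structure M] {E : L.Relations 2}
  {D : Layering M E} {C : Coding D} {α β : Type}

theorem exists_eq_var {K : FirstOrder.Language.{0, 0}} [K.IsRelational] {γ : Type}
    (t : K.Term γ) : ∃ g, t = Term.var g := by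
  cases t with
  | var g => exact ⟨g, rfl⟩
  | func f _ => exact isEmptyElim f

instance : (codeLanguage L).IsRelational :=
  fun _ => inferInstanceAs (IsEmpty Empty)

theorem Coding.exists_color_eq_iff {u v : C.V} {c : M} :
    (∃ h : C.S.Adj u v, C.color h = c) ↔ D.lev c = C.lev u ∧ C.act c u = v := by
  constructor
  · rintro ⟨h, rfl⟩
    exact ⟨C.lev_color h, (C.act_eq_iff (C.lev_color h)).2 ⟨h, rfl⟩⟩
  · rintro ⟨h, h'⟩
    exact (C.act_eq_iff h).1 h'

theorem Coding.relMap_par_iff (w : Fin 4 → C.V) : C.relMap (CodeRel.par : CodeRel L 4) w ↔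
    ∃ (h : C.S.Adj (w 0) (w 1)) (h' : C.S.Adj (w 2) (w 3)), C.color h = C.color h' := by
  refine exists_congr fun h => exists_congr fun h' => ?_
  unfold Coding.color
  rw [C.π.apply_eq_iff_eq]
  exact Quotient.eq.symm

theorem Coding.exists_edge (c : M) : ∃ (u v : C.V) (h : C.S.Adj u v), C.color h = c := by
  obtain ⟨u, hu⟩ := C.nonempty (D.lev c)
  exact ⟨u, _, C.adj_act hu.symm, C.color_adj_act hu.symm⟩

namespace Simple

theorem color (a : α) (i j : β) :
    Simple C β fun x v => ∃ h : C.S.Adj (v i) (v j), C.color h = x a := by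
  refine ((Simple.lev a i).and (Simple.act [a] i j)).congr fun x v => ?_
  rw [Coding.exists_color_eq_iff]
  rfl

/-- The colours of the edges, or a colour of the common level, are supplied by existential
quantifiers over colours. -/
theorem of_relMap [Nonempty M] {n : ℕ} (R : CodeRel L n) (τ : Fin n → β) :
    Simple C β fun (_ : α → M) v => C.relMap R fun i => v (τ i) := by
  cases R with
  | @coded n R =>
    refine ((forall_index fun i : Fin n => color (Sum.inr i : α ⊕ Fin n)
      (τ (finProdFinEquiv (i, 0))) (τ (finProdFinEquiv (i, 1)))).and
        (Simple.rel R Sum.inr)).exists_tuple.congr fun x v => ?_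
    constructor
    · rintro ⟨w, hw, hR⟩
      choose h hh using hw
      refine ⟨h, ?_⟩
      simp only [hh]
      exact hR
    · rintro ⟨h, hR⟩
      exact ⟨fun i => C.color (h i), fun i => ⟨h i, rfl⟩, hR⟩
  | cls =>
    refine ((Simple.lev none (τ 0)).and (Simple.lev none (τ 1))).ex.congr fun x v => ?_
    constructor
    · rintro ⟨c, h, h'⟩
      exact h.symm.trans h'
    · intro h
      obtain ⟨c, hc⟩ := D.nonempty (C.lev (v (τ 0)))
      exact ⟨c, hc, Eq.trans hc h⟩
  | edge =>
    refine (color (none : Option α) (τ 0) (τ 1)).ex.congr fun x v => ?_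
    constructor
    · rintro ⟨c, h, -⟩
      exact h
    · intro h
      exact ⟨C.color h, h, rfl⟩
  | par =>
    refine ((color (none : Option α) (τ 0) (τ 1)).and
      (color (none : Option α) (τ 2) (τ 3))).ex.congr fun x v => ?_
    rw [Coding.relMap_par_iff]
    constructor
    · rintro ⟨c, ⟨h, hc⟩, h', hc'⟩
      exact ⟨h, h', hc.trans hc'.symm⟩
    · rintro ⟨h, h', hc⟩
      exact ⟨_, ⟨h, rfl⟩, h', hc.symm⟩

/-- The quantifier step is `exV`, which is why `β` must be finite. -/
theorem of_codeBoundedFormula [Nonempty M] [Finite β] {n : ℕ}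
    (φ : (codeLanguage L).BoundedFormula β n) :
    Simple C (β ⊕ Fin n) fun (_ : α → M) v =>
      φ.Realize (fun i => v (.inl i)) fun j => v (.inr j) := by
  induction φ with
  | falsum => exact prop False
  | equal t t' =>
    obtain ⟨g, rfl⟩ := exists_eq_var t
    obtain ⟨g', rfl⟩ := exists_eq_var t'
    refine (Simple.act [] g g').congr fun x v => ?_
    rcases g with g | g <;> rcases g' with g' | g' <;> rfl
  | rel R ts =>
    choose g hg using fun i => exists_eq_var (ts i)
    refine (of_relMap R g).congr fun x v => ?_
    refine iff_of_eq (congrArg (C.relMap R) (funext fun i => ?_))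
    rw [hg]
    rcases g i with j | j <;> rfl
  | imp _ _ ih ih' =>
    exact (ih.and ih'.not).not.congr fun x v => by
      simp only [BoundedFormula.realize_imp]
      tauto
  | @all n φ ih =>
    let τ : β ⊕ Fin (n + 1) → Option (β ⊕ Fin n) :=
      Sum.elim (fun i => some (.inl i)) (Fin.snoc (fun j => some (.inr j)) none)
    refine ((ih.not.vrelabel τ).exV).not.congr fun x v => ?_
    simp only [BoundedFormula.realize_all, not_exists, not_not]
    refine forall_congr' fun y => iff_of_eq (congrArg₂ φ.Realize rfl (funext fun j => ?_))
    refine Fin.lastCases ?_ (fun j => ?_) j <;> simp [τ]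

theorem of_codeFormula [Nonempty M] [Finite β] (φ : (codeLanguage L).Formula β) :
    Simple C β fun (_ : α → M) v => φ.Realize v := by
  refine ((of_codeBoundedFormula φ).vrelabel (Sum.elim id Fin.elim0 : β ⊕ Fin 0 → β)).congr
    fun x v => ?_
  refine iff_of_eq (congrArg₂ (BoundedFormula.Realize φ) rfl (Subsingleton.elim _ _))

theorem of_boundedFormula [Nonempty M] [L.IsRelational] {n : ℕ} (φ : L.BoundedFormula α n) :
    Simple C β fun (x : α ⊕ Fin n → M) _ =>
      φ.Realize (fun i => x (.inl i)) fun j => x (.inr j) := by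
  induction φ with
  | falsum => exact prop False
  | equal t t' =>
    obtain ⟨g, rfl⟩ := exists_eq_var t
    obtain ⟨g', rfl⟩ := exists_eq_var t'
    refine (Simple.eq g g').congr fun x v => ?_
    rcases g with g | g <;> rcases g' with g' | g' <;> rfl
  | rel R ts =>
    choose g hg using fun i => exists_eq_var (ts i)
    refine (Simple.rel R g).congr fun x v => ?_
    refine iff_of_eq (congrArg (Structure.RelMap R) (funext fun i => ?_))
    rw [hg]
    rcases g i with j | j <;> rfl
  | imp _ _ ih ih' =>
    exact (ih.and ih'.not).not.congr fun x v => by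
      simp only [BoundedFormula.realize_imp]
      tauto
  | @all n φ ih =>
    let τ : α ⊕ Fin (n + 1) → Option (α ⊕ Fin n) :=
      Sum.elim (fun i => some (.inl i)) (Fin.snoc (fun j => some (.inr j)) none)
    refine ((ih.not.relabel τ).ex).not.congr fun x v => ?_
    simp only [BoundedFormula.realize_all, not_exists, not_not]
    refine forall_congr' fun y => iff_of_eq (congrArg₂ φ.Realize rfl (funext fun j => ?_))
    refine Fin.lastCases ?_ (fun j => ?_) j <;> simp [τ]

theorem of_pDef [Nonempty M] [L.IsRelational] {P : (α → M) → Prop} (h : PDef L P) :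
    Simple C β fun x _ => P x := by
  obtain ⟨φ, hφ⟩ := h
  obtain ⟨n, g, ψ, hψ⟩ := exists_formula_fin (M := M) φ
  have h1 : Simple C β fun (x : Fin n → M) _ => ψ.Realize x := by
    refine ((of_boundedFormula ψ).relabel (Sum.elim id Fin.elim0 : Fin n ⊕ Fin 0 → Fin n)).congr
      fun x v => ?_
    refine iff_of_eq (congrArg₂ (BoundedFormula.Realize ψ) rfl (Subsingleton.elim _ _))
  have h2 : ∀ i, Simple C β fun (x : α ⊕ Fin n → M) _ =>
      x (.inr i) = Sum.elim (fun a => x (.inl a)) id (g i) := by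
    intro i
    rcases hg : g i with a | c
    · exact Simple.eq _ _
    · exact Simple.const _ c
  refine ((forall_index h2).and (h1.relabel Sum.inr)).exists_tuple.congr fun x v => ?_
  rw [← hφ, hψ]
  constructor
  · rintro ⟨w, hw, h⟩
    have : w = fun i => Sum.elim x id (g i) := funext hw
    rw [← this]
    exact h
  · exact fun h => ⟨_, fun i => rfl, h⟩

/-- Simple relations between colours are definable in `M`. -/
theorem pDef [IsEmpty β] {Q : (α → M) → (β → C.V) → Prop} (h : Simple C β Q) (v : β → C.V) :
    PDef L fun x => Q x v := by
  induction h with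
  | eq a b => exact PDef.eq a b
  | const a c => exact PDef.eqConst a c
  | rel R a => exact PDef.rel R a
  | lev a i => exact isEmptyElim i
  | act l i j => exact isEmptyElim i
  | vconst i f => exact isEmptyElim i
  | not _ ih => exact ih.not
  | and _ _ ih ih' => exact ih.and ih'
  | ex _ ih => exact ih.ex

/-- Simple relations are definable in the coding if colours are represented by edges. -/
theorem exists_pDef_code {Q : (α → M) → (β → C.V) → Prop} (h : Simple C β Q) :
    ∃ P : ((α ⊕ α) ⊕ β → C.V) → Prop, PDef (codeLanguage L) P ∧
      ∀ (p q : α → C.V) (v : β → C.V) (h : ∀ a, C.S.Adj (p a) (q a)),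
        P (Sum.elim (Sum.elim p q) v) ↔ Q (fun a => C.color (h a)) v := by
  have rel_par : ∀ {γ : Type} (s : Fin 4 → γ), PDef (codeLanguage L) fun z : γ → C.V =>
      C.relMap (CodeRel.par : CodeRel L 4) fun i => z (s i) :=
    fun s => PDef.rel (L := codeLanguage L) (CodeRel.par : CodeRel L 4) s
  have rel_cls : ∀ {γ : Type} (a b : γ), PDef (codeLanguage L) fun z : γ → C.V =>
      C.lev (z a) = C.lev (z b) :=
    fun a b => PDef.rel (L := codeLanguage L) (CodeRel.cls : CodeRel L 2) ![a, b]
  induction h with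
  | eq a b =>
    refine ⟨_, rel_par ![.inl (.inl a), .inl (.inr a), .inl (.inl b), .inl (.inr b)],
      fun p q v h => ?_⟩
    rw [Coding.relMap_par_iff]
    exact ⟨fun ⟨_, _, h⟩ => h, fun h' => ⟨h a, h b, h'⟩⟩
  | const a c =>
    obtain ⟨u, w, huw, rfl⟩ := C.exists_edge c
    refine ⟨_, (rel_par id).subst (![.inl (.inl (.inl a)), .inl (.inl (.inr a)), .inr u, .inr w]),
      fun p q v h => ?_⟩
    rw [Coding.relMap_par_iff]
    exact ⟨fun ⟨_, _, h⟩ => h, fun h' => ⟨h a, huw, h'⟩⟩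
  | @rel α n R a =>
    refine ⟨_, PDef.rel (L := codeLanguage L) (CodeRel.coded R : CodeRel L (n * 2)) fun i =>
      .inl (if (finProdFinEquiv.symm i).2 = 0 then .inl (a (finProdFinEquiv.symm i).1)
        else .inr (a (finProdFinEquiv.symm i).1)), fun p q v h => ?_⟩
    have key : ∀ w : Fin (n * 2) → C.V, (∀ i, w (finProdFinEquiv (i, 0)) = p (a i)) →
        (∀ i, w (finProdFinEquiv (i, 1)) = q (a i)) → (C.relMap (CodeRel.coded R) w ↔
          Structure.RelMap R fun i => C.color (h (a i))) := by
      intro w hp hq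
      have hc : ∀ i (hi : C.S.Adj (w (finProdFinEquiv (i, 0))) (w (finProdFinEquiv (i, 1)))),
          C.color hi = C.color (h (a i)) := by
        intro i hi
        revert hi
        rw [hp, hq]
        exact fun _ => rfl
      constructor
      · rintro ⟨h', hR⟩
        simpa only [hc] using hR
      · intro hR
        refine ⟨fun i => ?_, ?_⟩
        · rw [hp, hq]
          exact h (a i)
        · simpa only [hc] using hR
    refine key _ (fun i => ?_) fun i => ?_ <;> simp
  | lev a i =>
    refine ⟨_, rel_cls (.inl (.inl a)) (.inr i), fun p q v h => ?_⟩
    change _ ↔ D.lev (C.color (h a)) = C.lev (v i)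
    rw [C.lev_color]
    rfl
  | @act α l i j =>
    have key : ∃ P : (Option ((α ⊕ α) ⊕ β) → C.V) → Prop, PDef (codeLanguage L) P ∧
        ∀ (p q : α → C.V) (v : β → C.V) (h : ∀ a, C.S.Adj (p a) (q a)) (t : C.V),
          P (fun o => o.elim t (Sum.elim (Sum.elim p q) v)) ↔
            C.actL (l.map fun a => C.color (h a)) (v i) = t := by
      induction l with
      | nil => exact ⟨_, PDef.eq (some (.inr i)) none, fun p q v h t => Iff.rfl⟩
      | cons a l ih =>
        obtain ⟨P, hP, h⟩ := ih
        let γ := Option (Option ((α ⊕ α) ⊕ β))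
        let τ : Option ((α ⊕ α) ⊕ β) → γ := fun o => o.elim none fun g => some (some g)
        have h1 := hP.comp τ
        have h2 := rel_par (γ := γ) ![some (some (.inl (.inl a))), some (some (.inl (.inr a))),
          none, some none]
        have h3 := rel_cls (γ := γ) (some (some (.inl (.inl a)))) none
        have h4 := PDef.eq (L := codeLanguage L) (M := C.V) (γ := γ) none (some none)
        -- With an auxiliary vertex for the value of the remaining word, the letter `a` either leads
        -- along an edge `U`-equivalent to the one representing it, or has another level and changes
        -- nothing.
        refine ⟨_, (h1.and (h2.or (h3.not.and h4))).ex, fun p q v hh t => ?_⟩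
        have e : ∀ t' : C.V, (fun g => Option.elim (τ g) t' fun o : Option ((α ⊕ α) ⊕ β) =>
            o.elim t (Sum.elim (Sum.elim p q) v)) =
            fun o : Option ((α ⊕ α) ⊕ β) => o.elim t' (Sum.elim (Sum.elim p q) v) := by
          intro t'
          funext o
          cases o <;> rfl
        simp only [e, h p q v hh, exists_eq_left', Coding.relMap_par_iff]
        rw [List.map_cons, C.actL_cons]
        generalize C.actL (l.map fun a => C.color (hh a)) (v i) = w
        change ((∃ (_ : C.S.Adj (p a) (q a)) (h' : C.S.Adj w t), C.color (hh a) = C.color h') ∨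
          ¬ C.lev (p a) = C.lev w ∧ w = t) ↔ _
        rw [← C.lev_color (hh a)]
        by_cases hl : D.lev (C.color (hh a)) = C.lev w
        · rw [C.act_eq_iff hl]
          constructor
          · rintro (⟨_, h', hc⟩ | ⟨hn, -⟩)
            · exact ⟨h', hc.symm⟩
            · exact absurd hl hn
          · rintro ⟨h', hc⟩
            exact .inl ⟨hh a, h', hc.symm⟩
        · rw [C.act_of_ne hl]
          constructor
          · rintro (⟨_, h', hc⟩ | ⟨-, h'⟩)
            · rw [hc, C.lev_color] at hl
              exact absurd rfl hl
            · exact h'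
          · exact fun h' => .inr ⟨hl, h'⟩
    obtain ⟨P, hP, h⟩ := key
    refine ⟨_, hP.comp fun o => o.elim (.inr j) id, fun p q v hh => ?_⟩
    refine Iff.trans ?_ (h p q v hh (v j))
    refine iff_of_eq (congrArg P (funext fun o => ?_))
    cases o <;> rfl
  | vconst i f => exact ⟨_, PDef.eqConst (.inr i) f, fun p q v h => Iff.rfl⟩
  | not _ ih =>
    obtain ⟨P, hP, h⟩ := ih
    exact ⟨_, hP.not, fun p q v hh => not_congr (h p q v hh)⟩
  | and _ _ ih ih' =>
    obtain ⟨P, hP, h⟩ := ih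
    obtain ⟨P', hP', h'⟩ := ih'
    exact ⟨_, hP.and hP', fun p q v hh => and_congr (h p q v hh) (h' p q v hh)⟩
  | @ex α Q _ ih =>
    obtain ⟨P, hP, h⟩ := ih
    let γ := Option (Option ((α ⊕ α) ⊕ β))
    let τ : (Option α ⊕ Option α) ⊕ β → γ
      | .inl (.inl none) => none
      | .inl (.inl (some a)) => some (some (.inl (.inl a)))
      | .inl (.inr none) => some none
      | .inl (.inr (some a)) => some (some (.inl (.inr a)))
      | .inr i => some (some (.inr i))
    have h1 := hP.comp τ
    have h2 : PDef (codeLanguage L) fun z : γ → C.V => C.S.Adj (z none) (z (some none)) :=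
      PDef.rel (L := codeLanguage L) (CodeRel.edge : CodeRel L 2) ![none, some none]
    -- A quantifier over colours becomes one over pairs of adjacent vertices.
    refine ⟨_, (h2.and h1).ex.ex, fun p q v hh => ?_⟩
    have e : ∀ s t : C.V, (fun g => Option.elim (τ g) s fun o : Option ((α ⊕ α) ⊕ β) =>
        o.elim t (Sum.elim (Sum.elim p q) v)) =
        Sum.elim (Sum.elim (fun o : Option α => o.elim s p) fun o : Option α => o.elim t q) v := by
      intro s t
      funext g
      rcases g with ((_ | _) | (_ | _)) | _ <;> rfl
    have hadj : ∀ s t : C.V, C.S.Adj s t → ∀ o : Option α, C.S.Adj (o.elim s p) (o.elim t q) := by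
      intro s t hst o
      cases o with
      | none => exact hst
      | some a => exact hh a
    have hcol : ∀ (s t : C.V) (hst : C.S.Adj s t), (fun o => C.color (hadj s t hst o)) =
        fun o : Option α => o.elim (C.color hst) fun a => C.color (hh a) := by
      intro s t hst
      funext o
      cases o <;> rfl
    simp only [e, Option.elim_none, Option.elim_some]
    constructor
    · rintro ⟨t, s, hst, hPst⟩
      rw [h _ _ v (hadj s t hst), hcol s t hst] at hPst
      exact ⟨_, hPst⟩
    · rintro ⟨c, hc⟩
      obtain ⟨s, t, hst, rfl⟩ := C.exists_edge c
      refine ⟨t, s, hst, ?_⟩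
      rw [h _ _ v (hadj s t hst), hcol s t hst]
      exact hc

theorem pDef_code {Q : (Empty → M) → (β → C.V) → Prop} (h : Simple C β Q) :
    PDef (codeLanguage L) fun v => Q Empty.elim v := by
  obtain ⟨P, hP, h⟩ := h.exists_pDef_code
  refine (hP.comp (Sum.elim (Sum.elim Empty.elim Empty.elim) id)).congr fun v => ?_
  rw [show (Empty.elim : Empty → M) = fun a => C.color (u := a.elim) (v := a.elim) a.elim from
    Subsingleton.elim _ _, ← h Empty.elim Empty.elim v fun a => a.elim]
  refine iff_of_eq (congrArg P (funext fun o => ?_))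
  rcases o with (o | o) | o
  · exact o.elim
  · exact o.elim
  · rfl

end Simple

end Interface

end GraphCoding

namespace GraphCoding

/-! ### Transfer of NIP -/

section Transfer

variable {L : FirstOrder.Language.{0, 0}} {M : Type} [L.Structure M] {E : L.Relations 2}
  {D : Layering M E} {C : Coding D}

theorem Layering.nonempty_type (D : Layering M E) : Nonempty M :=
  (D.nonempty 0).to_type

/-- This trichotomy drives both the transfer of NIP and that of definability. -/
theorem Coding.low_or_near_or_far (C : Coding D) {β : Type} (N : ℕ) (v : β → C.V) (y : C.V) :
    C.lev y < N ∨ (∃ i, ∃ n : Fin (N + 1), ∃ w : Fin n → M, y = C.actL (List.ofFn w) (v i)) ∨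
      (N ≤ C.lev y ∧ ∀ i, C.Far N (v i) y) := by
  rcases Nat.lt_or_ge (C.lev y) N with h | h
  · exact .inl h
  by_cases hf : ∀ i, C.Far N (v i) y
  · exact .inr (.inr ⟨h, hf⟩)
  · unfold Coding.Far at hf
    push Not at hf
    obtain ⟨i, l, hl, rfl⟩ := hf
    obtain ⟨n, w, hw⟩ := (Simple.exists_length_le N fun l' => C.actL l (v i) = C.actL l' (v i)).1
      ⟨l, hl, rfl⟩
    exact .inr (.inl ⟨i, n, w, hw⟩)

/-- If there are no vertices among the objects of a simple relation, the vertices among its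
parameters can be eliminated. -/
theorem Simple.polyBounded_params (h : IsNIP (L.completeTheory M)) (β' : Type) [Finite β'] :
    ∀ (α α' : Type) (Q : (α ⊕ α' → M) → (β' → C.V) → Prop), Simple C β' Q →
      PolyBounded fun (x : α → M) (b : (α' → M) × (β' → C.V)) => Q (Sum.elim x b.1) b.2 := by
  have := D.nonempty_type
  induction β' using Finite.induction_empty_option with
  | @of_equiv β₁ β₂ e ih =>
    intro α α' Q hQ
    refine ((ih α α' _ (hQ.vrelabel e.symm)).comp id fun b : (α' → M) × (β₂ → C.V) =>
      (b.1, fun i => b.2 (e i))).congr fun x b => ?_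
    simp
  | h_empty =>
    intro α α' Q hQ
    refine ((h.polyBounded_pDef (hQ.pDef PEmpty.elim)).comp id
      fun b : (α' → M) × (PEmpty → C.V) => b.1).congr fun x b => ?_
    rw [Subsingleton.elim b.2 PEmpty.elim]
    rfl
  | @h_option β' _ ih =>
    intro α α' Q hQ
    obtain ⟨N, G, hG, hgen⟩ := hQ.generic
    have hfin := C.finite_lev_lt N
    have : Finite {f : C.V // C.lev f < N} := hfin
    -- The last parameter vertex is a constant, or comes from another one by a word whose letters
    -- become colour parameters, or is far and gives way to a colour of its level.
    let I := {f : C.V // C.lev f < N} ⊕ (β' × Fin (N + 1)) ⊕ Unit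
    let Z : I → Type := Sum.elim (fun _ => (α' → M) × (β' → C.V)) (Sum.elim
      (fun p => (α' ⊕ Fin p.2 → M) × (β' → C.V)) fun _ => (Option α' → M) × (β' → C.V))
    let P : ∀ i : I, (α → M) → Z i → Prop := fun i => match i with
      | .inl f => fun x (b : (α' → M) × (β' → C.V)) =>
          Q (Sum.elim x b.1) fun o => o.elim f.1 b.2
      | .inr (.inl p) => fun x (b : (α' ⊕ Fin p.2 → M) × (β' → C.V)) =>
          Q (Sum.elim x fun a => b.1 (.inl a)) fun o =>
            o.elim (C.actL (List.ofFn fun j => b.1 (.inr j)) (b.2 p.1)) b.2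
      | .inr (.inr _) => fun x (b : (Option α' → M) × (β' → C.V)) =>
          G (fun o => o.elim (b.1 none) (Sum.elim x fun a => b.1 (some a))) b.2
    refine PolyBounded.of_param_cover (I := I) (Z := Z) (P := P) ?_ ?_
    · rintro (f | ⟨i, n⟩ | u)
      · exact ih α α' _ (hQ.low f.1)
      · have h1 := (hQ.near i n).relabel (α' := α ⊕ (α' ⊕ Fin n))
          (Sum.elim (Sum.elim .inl fun a => .inr (.inl a)) fun j => .inr (.inr j))
        refine (ih α (α' ⊕ Fin n) _ h1).congr fun x b => ?_
        refine iff_of_eq (congrArg₂ Q (funext fun a => ?_) (funext fun o => ?_))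
        · rcases a with a | a <;> rfl
        · cases o with
          | some o => rfl
          | none =>
            simp only [Option.elim_none, newWord, List.map_ofFn]
            rfl
      · have h1 := hG.relabel (α' := α ⊕ Option α')
          fun o => o.elim (.inr none) (Sum.elim .inl fun a => .inr (some a))
        refine (ih α (Option α') _ h1).congr fun x b => ?_
        refine iff_of_eq (congrArg₂ G (funext fun a => ?_) rfl)
        rcases a with _ | a | a <;> rfl
    · rintro ⟨y, z⟩
      have hz : z = fun o : Option β' => o.elim (z none) fun i => z (some i) := by
        funext o
        cases o <;> rfl
      rcases C.low_or_near_or_far N (fun i => z (some i)) (z none) with hl | ⟨i, n, w, hw⟩ | ⟨hl, hf⟩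
      · refine ⟨.inl ⟨z none, hl⟩, (y, fun i => z (some i)), fun x => ?_⟩
        exact iff_of_eq (congrArg (Q (Sum.elim x y)) hz)
      · refine ⟨.inr (.inl (i, n)), (Sum.elim y w, fun i => z (some i)), fun x => ?_⟩
        change Q (Sum.elim x y) z ↔ Q (Sum.elim x y) fun o =>
          o.elim (C.actL (List.ofFn w) (z (some i))) fun i => z (some i)
        rw [← hw, ← hz]
      · obtain ⟨e, he⟩ := D.nonempty (C.lev (z none))
        refine ⟨.inr (.inr ()), (fun o => o.elim e y, fun i => z (some i)), fun x => ?_⟩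
        have := hgen (Sum.elim x y) (fun i => z (some i)) (z none) e hl he hf
        rw [← hz] at this
        exact this

/-- Simple relations are polynomially bounded if `M` is NIP. -/
theorem Simple.polyBounded (h : IsNIP (L.completeTheory M)) (β : Type) [Finite β] :
    ∀ (α α' β' : Type) [Finite β'] (Q : (α ⊕ α' → M) → (β ⊕ β' → C.V) → Prop),
      Simple C (β ⊕ β') Q →
      PolyBounded fun (x : (α → M) × (β → C.V)) (b : (α' → M) × (β' → C.V)) =>
        Q (Sum.elim x.1 b.1) (Sum.elim x.2 b.2) := by
  have := D.nonempty_type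
  induction β using Finite.induction_empty_option with
  | @of_equiv β₁ β₂ e ih =>
    intro α α' β' _ Q hQ
    refine ((ih α α' β' _ (hQ.vrelabel (Sum.map e.symm id))).comp
      (fun x : (α → M) × (β₂ → C.V) => (x.1, fun i => x.2 (e i))) id).congr fun x b => ?_
    refine iff_of_eq (congrArg (Q _) (funext fun o => ?_))
    rcases o with o | o <;> simp
  | h_empty =>
    intro α α' β' _ Q hQ
    refine ((Simple.polyBounded_params h β' α α' _
      (hQ.vrelabel (Sum.elim PEmpty.elim id))).comp
      (fun x : (α → M) × (PEmpty → C.V) => x.1) id).congr fun x b => ?_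
    refine iff_of_eq (congrArg (Q _) (funext fun o => ?_))
    rcases o with o | o
    · exact o.elim
    · rfl
  | @h_option β _ ih =>
    intro α α' β' _ Q hQ
    let τ : Option β ⊕ β' → Option (β ⊕ β') :=
      Sum.elim (fun o => o.elim none fun i => some (.inl i)) fun j => some (.inr j)
    obtain ⟨Q₁, hQ₁, hQQ₁⟩ : ∃ Q₁ : (α ⊕ α' → M) → (Option (β ⊕ β') → C.V) → Prop,
        Simple C (Option (β ⊕ β')) Q₁ ∧ ∀ (x : α ⊕ α' → M) (v : Option β → C.V) (z : β' → C.V),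
          Q x (Sum.elim v z) ↔
            Q₁ x fun o => o.elim (v none) (Sum.elim (fun i => v (some i)) z) := by
      refine ⟨_, hQ.vrelabel τ, fun x v z => ?_⟩
      refine iff_of_eq (congrArg (Q x) (funext fun o => ?_))
      rcases o with (_ | o) | o <;> rfl
    obtain ⟨N, G, hG, hgen⟩ := hQ₁.generic
    have hfin := C.finite_lev_lt N
    have : Finite {f : C.V // C.lev f < N} := hfin
    -- The last object vertex is low, or near another object vertex, or near a vertex of one of the
    -- parameters, or far from all vertices of the object and of the whole family of parameters.
    let I := {f : C.V // C.lev f < N} ⊕ (β × Fin (N + 1)) ⊕ (β' × Fin (N + 1)) ⊕ Unit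
    let W : I → Type := Sum.elim (fun _ => (α → M) × (β → C.V)) (Sum.elim
      (fun p => (α ⊕ Fin p.2 → M) × (β → C.V)) (Sum.elim
      (fun p => (α ⊕ Fin p.2 → M) × (β → C.V)) fun _ => (Option α → M) × (β → C.V)))
    let Z : I → Type := Sum.elim (fun _ => (α' → M) × (β' → C.V)) (Sum.elim
      (fun _ => (α' → M) × (β' → C.V)) (Sum.elim
      (fun _ => (α' → M) × (Option β' → C.V)) fun _ => (α' → M) × (β' → C.V)))
    let P : ∀ i : I, W i → Z i → Prop := fun i => match i with
      | .inl f => fun (x : (α → M) × (β → C.V)) (b : (α' → M) × (β' → C.V)) =>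
          Q₁ (Sum.elim x.1 b.1) fun o => o.elim f.1 (Sum.elim x.2 b.2)
      | .inr (.inl p) => fun (x : (α ⊕ Fin p.2 → M) × (β → C.V)) (b : (α' → M) × (β' → C.V)) =>
          Q₁ (Sum.elim (fun a => x.1 (.inl a)) b.1) fun o =>
            o.elim (C.actL (List.ofFn fun j => x.1 (.inr j)) (x.2 p.1)) (Sum.elim x.2 b.2)
      | .inr (.inr (.inl p)) => fun (x : (α ⊕ Fin p.2 → M) × (β → C.V))
          (b : (α' → M) × (Option β' → C.V)) =>
          Q₁ (Sum.elim (fun a => x.1 (.inl a)) b.1) fun o =>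
            o.elim (C.actL (List.ofFn fun j => x.1 (.inr j)) (b.2 none))
              (Sum.elim x.2 fun i => b.2 (some i))
      | .inr (.inr (.inr _)) => fun (x : (Option α → M) × (β → C.V))
          (b : (α' → M) × (β' → C.V)) =>
          G (fun o => o.elim (x.1 none) (Sum.elim (fun a => x.1 (some a)) b.1))
            (Sum.elim x.2 b.2)
    refine PolyBounded.of_object_cover (I := I) (W := W) (Z := Z) (P := P) 1 ?_ ?_
    · rintro (f | ⟨i, n⟩ | ⟨i, n⟩ | u)
      · exact ih α α' β' _ (hQ₁.low f.1)
      · have h1 := (hQ₁.near (.inl i) n).relabel (α' := (α ⊕ Fin n) ⊕ α')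
          (Sum.elim (Sum.elim (fun a => .inl (.inl a)) .inr) fun j => .inl (.inr j))
        refine (ih (α ⊕ Fin n) α' β' _ h1).congr fun x b => ?_
        refine iff_of_eq (congrArg₂ Q₁ (funext fun a => ?_) (funext fun o => ?_))
        · rcases a with a | a <;> rfl
        · cases o with
          | some o => rfl
          | none =>
            simp only [Option.elim_none, newWord, List.map_ofFn]
            rfl
      · have h1 := (hQ₁.relabel (α' := (α ⊕ Fin n) ⊕ α')
            (Sum.elim (fun a => .inl (.inl a)) .inr)).subst (β' := β ⊕ Option β')
          fun o => o.elim (.inr (List.ofFn fun j => .inl (.inr j), .inr none))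
            (Sum.elim (fun i => .inr ([], .inl i)) fun i => .inr ([], .inr (some i)))
        refine (ih (α ⊕ Fin n) α' (Option β') _ h1).congr fun x b => ?_
        refine iff_of_eq (congrArg₂ Q₁ (funext fun a => ?_) (funext fun o => ?_))
        · rcases a with a | a <;> rfl
        · rcases o with _ | o | o
          · simp only [Option.elim_none, Sum.elim_inr, List.map_ofFn]
            rfl
          · rfl
          · rfl
      · have h1 := hG.relabel (α' := Option α ⊕ α')
          fun o => o.elim (.inl none) (Sum.elim (fun a => .inl (some a)) .inr)
        refine (ih (Option α) α' β' _ h1).congr fun x b => ?_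
        refine iff_of_eq (congrArg₂ G (funext fun a => ?_) rfl)
        rcases a with _ | a | a <;> rfl
    · intro T _ b
      refine ⟨fun i => match i with
        | .inl _ => fun _ t => b t
        | .inr (.inl _) => fun _ t => b t
        -- The vertex of the chosen parameter to which the object vertex is near is added to every
        -- parameter. The choice is always made in this case, so the default `t` is irrelevant.
        | .inr (.inr (.inl p)) => fun o t =>
            ((b t).1, fun i => i.elim ((b ((o 0).getD t)).2 p.1) (b t).2)
        | .inr (.inr (.inr _)) => fun _ t => b t, ?_⟩
      rintro ⟨x, v⟩
      rcases C.low_or_near_or_far N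
          (Sum.elim (fun i => v (some i)) fun p : T × β' => (b p.1).2 p.2) (v none) with
        hl | ⟨i | ⟨t₀, i⟩, n, w, hw⟩ | ⟨hl, hf⟩
      · exact ⟨.inl ⟨v none, hl⟩, fun _ => none, (x, fun i => v (some i)), fun t => hQQ₁ _ _ _⟩
      · refine ⟨.inr (.inl (i, n)), fun _ => none, (Sum.elim x w, fun i => v (some i)),
          fun t => (hQQ₁ _ _ _).trans ?_⟩
        exact iff_of_eq (congrArg (fun s => Q₁ (Sum.elim x (b t).1) fun o =>
          o.elim s (Sum.elim (fun i => v (some i)) (b t).2)) hw)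
      · refine ⟨.inr (.inr (.inl (i, n))), fun _ => some t₀,
          (Sum.elim x w, fun i => v (some i)), fun t => (hQQ₁ _ _ _).trans ?_⟩
        exact iff_of_eq (congrArg (fun s => Q₁ (Sum.elim x (b t).1) fun o =>
          o.elim s (Sum.elim (fun i => v (some i)) (b t).2)) hw)
      · obtain ⟨e, he⟩ := D.nonempty (C.lev (v none))
        refine ⟨.inr (.inr (.inr ())), fun _ => none,
          (fun o => o.elim e x, fun i => v (some i)), fun t => (hQQ₁ _ _ _).trans ?_⟩
        refine hgen (Sum.elim x (b t).1) (Sum.elim (fun i => v (some i)) (b t).2) (v none) e hl he ?_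
        rintro (i | i)
        · exact hf (.inl i)
        · exact hf (.inr (t, i))

/-- Codings of NIP structures are NIP. -/
theorem Coding.isNIP (C : Coding D) (h : IsNIP (L.completeTheory M)) :
    IsNIP ((codeLanguage L).completeTheory C.V) := by
  have := D.nonempty_type
  refine isNIP_of_polyBounded fun n m φ => ?_
  have h1 : Simple C (Fin m ⊕ Fin n) fun (_ : Empty ⊕ Empty → M) v => φ.Realize fun i => v i.swap :=
    (Simple.of_codeFormula φ).vrelabel Sum.swap
  refine ((Simple.polyBounded h (Fin m) Empty Empty (Fin n) _ h1).comp
    (fun b : Fin m → C.V => (Empty.elim, b)) fun a : Fin n → C.V => (Empty.elim, a)).congr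
    fun b a => ?_
  refine iff_of_eq (congrArg φ.Realize (funext fun o => ?_))
  rcases o with o | o <;> rfl

/-! ### Transfer of definability of types -/

/-- For an ultrafilter on colours, the definability of the sets of parameters for which almost all
levels satisfy a relation passes from relations between colours to all simple relations. -/
theorem Simple.eventually_lev [L.IsRelational] (u : Ultrafilter M)
    (hu : ∀ (α : Type) (Q : (Option α → M) → Prop), PDef L Q →
      PDef L fun y : α → M => ∀ᶠ e in u, ∃ e', D.lev e' = D.lev e ∧ Q fun o => o.elim e' y)
    (β : Type) [Finite β] :
    ∀ (α : Type) (Q : (Option α → M) → (β → C.V) → Prop), Simple C β Q →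
      Simple C β fun y z => ∀ᶠ e in u, ∃ e', D.lev e' = D.lev e ∧ Q (fun o => o.elim e' y) z := by
  have := D.nonempty_type
  induction β using Finite.induction_empty_option with
  | @of_equiv β₁ β₂ e ih =>
    intro α Q hQ
    refine ((ih α _ (hQ.vrelabel e.symm)).vrelabel e).congr fun y z => ?_
    simp
  | h_empty =>
    intro α Q hQ
    refine (Simple.of_pDef (hu α _ (hQ.pDef PEmpty.elim))).congr fun y z => ?_
    rw [Subsingleton.elim z PEmpty.elim]
  | @h_option β _ ih =>
    intro α Q hQ
    obtain ⟨N, G, hG, hgen⟩ := hQ.generic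
    have h1 : ∀ f : C.V, Simple C (Option β) fun y z => z none = f ∧ ∀ᶠ e in u, ∃ e',
        D.lev e' = D.lev e ∧ Q (fun o => o.elim e' y) fun o => o.elim f fun i => z (some i) :=
      fun f => (Simple.vconst none f).and ((ih α _ (hQ.low f)).vrelabel some)
    have h2 : ∀ (i : β) (n : Fin (N + 1)), Simple C (Option β) fun y z => ∃ w : Fin n → M,
        z none = C.actL (List.ofFn w) (z (some i)) ∧ ∀ᶠ e in u, ∃ e', D.lev e' = D.lev e ∧
          Q (fun o => o.elim e' y) fun o =>
            o.elim (C.actL (List.ofFn w) (z (some i))) fun i => z (some i) := by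
      intro i n
      have h3 := (hQ.near i n).relabel (α' := Option (α ⊕ Fin n))
        (Sum.elim (Option.map .inl) fun j => some (.inr j))
      refine ((Simple.act (newWord α n) (some i) none).and
        ((ih (α ⊕ Fin n) _ h3).vrelabel some)).exists_tuple.congr fun y z => ?_
      simp only [map_newWord]
      refine exists_congr fun w => and_congr eq_comm ?_
      refine Filter.eventually_congr (Filter.Eventually.of_forall fun e => ?_)
      refine exists_congr fun e' => and_congr_right fun _ => ?_
      refine iff_of_eq (congrArg₂ Q (funext fun o => ?_) (funext fun o => ?_))
      · cases o <;> rfl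
      · cases o with
        | some o => rfl
        | none =>
          simp only [Option.elim_none, newWord, List.map_ofFn]
          rfl
    -- In the far case a colour `g` of the level of `z none` replaces that vertex, and the induction
    -- hypothesis applies with `g` as an extra colour parameter.
    have h3 : Simple C (Option β) fun y z => (∀ i, C.Far N (z (some i)) (z none)) ∧ ∃ g : M,
        D.lev g = C.lev (z none) ∧ N ≤ D.lev g ∧ ∀ᶠ e in u, ∃ e', D.lev e' = D.lev e ∧
          G (fun o => o.elim g fun o => o.elim e' y) fun i => z (some i) := by
      have h4 := hG.relabel (α' := Option (Option α))
        fun o => o.elim (some none) fun o => o.elim none fun a => some (some a)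
      refine (forall_index fun i => far N (some i) none).and (((Simple.lev none none).and
        ((le_lev none N).and ((ih (Option α) _ h4).vrelabel some))).ex.congr fun y z => ?_)
      refine exists_congr fun g => and_congr_right fun _ => and_congr_right fun _ => ?_
      refine Filter.eventually_congr (Filter.Eventually.of_forall fun e => ?_)
      refine exists_congr fun e' => and_congr_right fun _ => ?_
      refine iff_of_eq (congrArg₂ G (funext fun o => ?_) rfl)
      rcases o with _ | _ | o <;> rfl
    refine ((exists_finite (C.finite_lev_lt N) fun f _ => h1 f).or
      ((exists_index fun i => exists_index fun n => h2 i n).or h3)).congr fun y z => ?_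
    have hz : z = fun o : Option β => o.elim (z none) fun i => z (some i) := by
      funext o
      cases o <;> rfl
    have hg : ∀ g, D.lev g = C.lev (z none) → N ≤ C.lev (z none) →
        (∀ i, C.Far N (z (some i)) (z none)) → ((∀ᶠ e in u, ∃ e', D.lev e' = D.lev e ∧
          G (fun o => o.elim g fun o => o.elim e' y) fun i => z (some i)) ↔
          ∀ᶠ e in u, ∃ e', D.lev e' = D.lev e ∧ Q (fun o => o.elim e' y) z) := by
      intro g hg hN hf
      refine Filter.eventually_congr (Filter.Eventually.of_forall fun e => ?_)
      refine exists_congr fun e' => and_congr_right fun _ => ?_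
      rw [← hgen (fun o => o.elim e' y) (fun i => z (some i)) (z none) g hN hg hf, ← hz]
    constructor
    · rintro (⟨f, -, hf, h⟩ | ⟨i, n, w, hw, h⟩ | ⟨hf, g, hgl, hN, h⟩)
      · rwa [← hf, ← hz] at h
      · rwa [← hw, ← hz] at h
      · exact (hg g hgl (hgl ▸ hN) hf).1 h
    · intro h
      rcases C.low_or_near_or_far N (fun i => z (some i)) (z none) with hl | ⟨i, n, w, hw⟩ | ⟨hl, hf⟩
      · refine .inl ⟨z none, hl, rfl, ?_⟩
        rwa [← hz]
      · refine .inr (.inl ⟨i, n, w, hw, ?_⟩)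
        rwa [← hw, ← hz]
      · obtain ⟨g, hgl⟩ := D.nonempty (C.lev (z none))
        exact .inr (.inr ⟨hf, g, hgl, (hl.trans_eq hgl.symm), (hg g hgl hl hf).2 h⟩)

/-- The quantifier over `e'` closes the relation under `E`, so it belongs to the imaginary type
given by the limit along `u`. By `hu` this is the type of a new class. -/
theorem NewClassTypesDefinable.pDef (h : NewClassTypesDefinable M E) (D : Layering M E)
    (u : Ultrafilter M) (hu : ∀ k, ∀ᶠ e in u, k ≤ D.lev e) (α : Type) (Q : (Option α → M) → Prop)
    (hQ : PDef L Q) :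
    PDef L fun y : α → M => ∀ᶠ e in u, ∃ e', D.lev e' = D.lev e ∧ Q fun o => o.elim e' y := by
  classical
  obtain ⟨x₀⟩ := D.nonempty_type
  have : Nonempty M := ⟨x₀⟩
  obtain ⟨φ, hφ⟩ := hQ
  obtain ⟨n, g, ψ, hψ⟩ := exists_formula_fin (M := M) φ
  let χ : L.Formula (Fin 1 ⊕ Fin n) :=
    ((E.formula₂ (Term.var (.inl (.inl 0))) (Term.var (.inr ()))) ⊓
      ψ.relabel fun i => if g i = .inl none then Sum.inr () else .inl (.inr i)).iExs Unit
  have hχ : ∀ (e : M) (b : Fin n → M), χ.Realize (Sum.elim ![e] b) ↔ ∃ e', D.lev e' = D.lev e ∧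
      ψ.Realize fun i => if g i = .inl none then e' else b i := by
    intro e b
    simp only [χ, Formula.realize_iExs, Formula.realize_inf, Formula.realize_rel₂,
      Formula.realize_relabel]
    have key : ∀ w : Unit → M, ((Sum.elim (Sum.elim ![e] b) w) ∘ fun i =>
        if g i = .inl none then Sum.inr () else .inl (.inr i)) =
        fun i => if g i = .inl none then w () else b i := by
      intro w
      funext i
      by_cases hi : g i = .inl none <;> simp [hi]
    constructor
    · rintro ⟨w, hw, hw'⟩
      rw [key] at hw'
      refine ⟨w (), ?_, hw'⟩
      exact ((D.rel_iff _ _).1 hw).symm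
    · rintro ⟨e', he, he'⟩
      refine ⟨fun _ => e', (D.rel_iff _ _).2 he.symm, ?_⟩
      rw [key]
      exact he'
  obtain ⟨p, hp⟩ := exists_type_of_ultrafilter (L := L) u fun e : M => ![e]
  have h1 := h p (by
    intro b hb
    rw [hp] at hb
    obtain ⟨e, he, hl⟩ := (hb.and (hu (D.lev b + 1))).exists
    rw [Formula.realize_rel₂] at he
    have := (D.rel_iff _ _).1 he
    change D.lev e = D.lev b at this
    omega) n χ (by
    intro a a' b haa
    rw [hχ, hχ, (D.rel_iff _ _).1 haa])
  rw [definable_iff_pDef] at h1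
  -- `χ` does not read the coordinates that stand for `e'`; they receive the default `x₀`.
  refine (h1.subst fun i => Sum.elim (fun o => o.elim (.inr x₀) .inl) .inr (g i)).congr fun y => ?_
  change plug χ _ ∈ p ↔ _
  rw [hp]
  refine Filter.eventually_congr (Filter.Eventually.of_forall fun e => ?_)
  rw [hχ]
  refine exists_congr fun e' => and_congr_right fun _ => ?_
  rw [← hφ, hψ]
  refine iff_of_eq (congrArg ψ.Realize (funext fun i => ?_))
  rcases hg : g i with (_ | a) | c <;> simp

/-- In a coding of a structure in which the imaginary types of new classes are definable, the sets
of parameters for which almost all vertices satisfy a formula are definable. -/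
theorem Coding.pDef_eventually [L.IsRelational] (C : Coding D) (h : NewClassTypesDefinable M E)
    (u : Ultrafilter C.V) {β : Type} [Finite β] {Q : (Empty → M) → (Option β → C.V) → Prop}
    (hQ : Simple C (Option β) Q) :
    PDef (codeLanguage L) fun z : β → C.V => ∀ᶠ y in u, Q Empty.elim fun o => o.elim y z := by
  have := D.nonempty_type
  -- If the levels do not tend to infinity, `u` contains a finite set and is principal.
  by_cases hu : ∀ k, ∀ᶠ y in u, k ≤ C.lev y
  · obtain ⟨N, G, hG, hgen⟩ := hQ.generic
    choose s hs using D.nonempty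
    have hs : ∀ k, D.lev (s k) = k := hs
    let u' : Ultrafilter M := u.map fun y => s (C.lev y)
    have hu' : ∀ k, ∀ᶠ e in u', k ≤ D.lev e := by
      intro k
      refine Filter.eventually_map.2 ((hu k).mono fun y hy => ?_)
      rwa [hs]
    have h1 := Simple.eventually_lev u' (h.pDef D u' hu') β Empty G hG
    refine h1.pDef_code.congr fun z => ?_
    refine Filter.eventually_map.trans (Filter.eventually_congr ?_)
    -- Words preserve levels, so a vertex in a piece above those of all `z i` is far from them at
    -- every radius.
    have hz : ∀ᶠ y in (u : Filter C.V), ∀ i, C.lev (z i) + 1 ≤ C.lev y :=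
      Filter.eventually_all.2 fun i => hu _
    filter_upwards [hu N, hz] with y hN hy
    have hf : ∀ i, C.Far N (z i) y := by
      rintro i l - rfl
      have := hy i
      rw [C.lev_actL] at this
      omega
    constructor
    · rintro ⟨e, he, hGe⟩
      exact (hgen _ z y e hN (he.trans (hs _)) hf).2 hGe
    · intro hy
      exact ⟨s (C.lev y), rfl, (hgen _ z y _ hN (hs _) hf).1 hy⟩
  · push Not at hu
    obtain ⟨k, hk⟩ := hu
    obtain ⟨f, -, rfl⟩ := Ultrafilter.eq_pure_of_finite_mem (C.finite_lev_lt k) hk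
    exact (hQ.low f).pDef_code

theorem Coding.isDefinableType [L.IsRelational] (C : Coding D) (h : NewClassTypesDefinable M E)
    (p : TypeOver (codeLanguage L) C.V 1) : IsDefinableType p := by
  have := D.nonempty_type
  intro m φ
  rw [definable_iff_pDef]
  obtain ⟨u, hu⟩ := exists_ultrafilter_of_type p
  have h1 : Simple C (Option (Fin m)) fun (_ : Empty → M) v =>
      φ.Realize fun i => v (Sum.elim (fun _ => none) some i) :=
    (Simple.of_codeFormula φ).vrelabel (Sum.elim (fun _ : Fin 1 => none) some)
  refine (C.pDef_eventually h (u.map fun x => x 0) h1).congr fun b => ?_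
  change _ ↔ plug φ b ∈ p
  rw [hu]
  refine Filter.eventually_map.trans (Filter.eventually_congr (Filter.Eventually.of_forall ?_))
  intro x
  refine iff_of_eq (congrArg φ.Realize (funext fun o => ?_))
  rcases o with o | o
  · rw [Subsingleton.elim o 0]
    rfl
  · rfl

/-- The trace of a set defined over a single `a` is a limit along the ultrafilter of the type of
`a`, hence definable by `Coding.pDef_eventually`. Elementarity carries its definition over to `N`.
-/
theorem Coding.infStablyEmbedded_one [L.IsRelational] (C : Coding D)
    (h : NewClassTypesDefinable M E) {N : Type} [(codeLanguage L).Structure N]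
    (f : C.V ↪ₑ[codeLanguage L] N) : InfStablyEmbedded (codeLanguage L) (Set.range f) 1 := by
  have := D.nonempty_type
  intro n k hk φ a
  obtain ⟨u, hu⟩ := exists_ultrafilter_of_elementary f a
  suffices hP : PDef (codeLanguage L) fun z : Fin n → C.V =>
      φ.Realize (Sum.elim (fun i => f (z i)) a) by
    obtain ⟨ψ, hψ⟩ := hP
    obtain ⟨l, g, χ, hχ⟩ := exists_formula_fin (M := C.V) ψ
    obtain ⟨v₀, -⟩ := C.nonempty 0
    let g' : Fin l → Fin n ⊕ Fin l := fun i => Sum.elim .inl (fun _ => .inr i) (g i)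
    let b : Fin l → C.V := fun i => Sum.elim (fun _ => v₀) id (g i)
    refine ⟨l, χ.relabel g', f ∘ b, fun j => ⟨_, rfl⟩, fun x hx => ?_⟩
    choose z hz using hx
    obtain rfl : (fun i => f (z i)) = x := funext hz
    refine (hψ z).symm.trans ?_
    rw [hχ, ← f.map_formula, Formula.realize_relabel]
    refine iff_of_eq (congrArg χ.Realize (funext fun i => ?_))
    simp only [Function.comp_apply, g', b]
    rcases hg : g i with j | c <;> simp [hg]
  have hswap : ∀ z : Fin n → C.V, φ.Realize (Sum.elim (fun i => f (z i)) a) ↔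
      ∀ᶠ x in u, φ.Realize (Sum.elim z x) := by
    intro z
    have h1 := hu n (φ.relabel Sum.swap) z
    simp only [Formula.realize_relabel] at h1
    have e : ∀ {K : Type} (s : Fin k → K) (t : Fin n → K),
        Sum.elim s t ∘ Sum.swap = Sum.elim t s := by
      intro K s t
      funext o
      rcases o with o | o <;> rfl
    simp only [e] at h1
    exact h1
  refine PDef.congr ?_ fun z => (hswap z).symm
  rcases Nat.le_one_iff_eq_zero_or_eq_one.1 hk with rfl | rfl
  · refine ((PDef.of_formula φ).comp (Sum.elim id Fin.elim0 : Fin n ⊕ Fin 0 → Fin n)).congr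
      fun z => ?_
    have e : ∀ x : Fin 0 → C.V, Sum.elim z x =
        fun i => z ((Sum.elim id Fin.elim0 : Fin n ⊕ Fin 0 → Fin n) i) := by
      intro x
      funext o
      rcases o with o | o
      · rfl
      · exact o.elim0
    simp only [e]
    exact Filter.eventually_const.symm
  · have h1 : Simple C (Option (Fin n)) fun (_ : Empty → M) v =>
        φ.Realize fun i => v (Sum.elim some (fun _ => none) i) :=
      (Simple.of_codeFormula φ).vrelabel (Sum.elim some fun _ : Fin 1 => none)
    refine (C.pDef_eventually h (u.map fun x => x 0) h1).congr fun b => ?_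
    refine Filter.eventually_map.trans (Filter.eventually_congr (Filter.Eventually.of_forall ?_))
    intro x
    refine iff_of_eq (congrArg φ.Realize (funext fun o => ?_))
    rcases o with o | o
    · rfl
    · rw [Subsingleton.elim o 0]
      rfl

end Transfer

end GraphCoding

namespace GraphCoding

/-! ### Existence of codings -/

section Existence

variable {L : FirstOrder.Language.{0, 0}} {M : Type} [L.Structure M] {E : L.Relations 2}

/-- A coding is obtained from an action of the colours by involutions on finite pieces in which
short reduced words have no fixed points. -/
theorem exists_coding_of_action (D : Layering M E) {V : Type} (lev : V → ℕ)
    (hne : ∀ k, {v | lev v = k}.Nonempty) (hfin : ∀ k, {v | lev v = k}.Finite) (act : M → V → V)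
    (hlev : ∀ c v, lev (act c v) = lev v) (hinv : ∀ c v, act c (act c v) = v)
    (hfix : ∀ (l : List M) (v : V), l ≠ [] → l.IsChain (· ≠ ·) → (∀ c ∈ l, D.lev c = lev v) →
      l.length ≤ D.size (lev v) → l.foldr act v ≠ v) : Nonempty (Coding D) := by
  -- Words of length one exclude loops; words of length two make different colours lead to different
  -- neighbours.
  have hne1 : ∀ c v, D.lev c = lev v → act c v ≠ v := fun c v h =>
    hfix [c] v (by simp) (by simp) (by simpa using h)
      ((Nat.zero_le _).trans_lt (D.lt_size (lev v)))
  have hinj : ∀ c d v, D.lev c = lev v → D.lev d = lev v → act c v = act d v → c = d := by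
    intro c d v hc hd h
    by_contra hcd
    refine hfix [d, c] v (by simp) (by simpa using Ne.symm hcd) (by simp [hc, hd]) ?_ ?_
    · have h2 : ({c, d} : Set M) ⊆ {a | D.lev a = lev v} := by
        rintro a (rfl | rfl)
        exacts [hc, hd]
      have h3 := Set.ncard_le_ncard h2 (D.finite _)
      rw [Set.ncard_pair hcd] at h3
      exact h3
    · simp only [List.foldr_cons, List.foldr_nil]
      rw [h, hinv]
  let S : SimpleGraph V :=
    { Adj := fun u w => ∃ c, D.lev c = lev u ∧ act c u = w
      symm := ⟨by
        rintro u w ⟨c, hc, rfl⟩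
        exact ⟨c, hc.trans (hlev c u).symm, hinv c u⟩⟩
      loopless := ⟨by
        rintro u ⟨c, hc, h⟩
        exact hne1 c u hc h⟩ }
  have hlevadj : ∀ u v, S.Adj u v → lev u = lev v := by
    rintro u v ⟨c, -, rfl⟩
    exact (hlev c u).symm
  have hcol : ∀ e : S.edgeSet, ∃ c, ∀ v w, e.1 = s(v, w) → D.lev c = lev v ∧ act c v = w := by
    rintro ⟨e, he⟩
    induction e using Sym2.ind with
    | _ u w =>
    obtain ⟨c, hc, hw⟩ : ∃ c, D.lev c = lev u ∧ act c u = w := he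
    refine ⟨c, fun v w' h => ?_⟩
    rcases Sym2.eq_iff.1 h with ⟨rfl, rfl⟩ | ⟨rfl, rfl⟩
    · exact ⟨hc, hw⟩
    · exact ⟨hc.trans (hw ▸ (hlev c u).symm), hw ▸ hinv c u⟩
  choose col hcol using hcol
  have hadj : ∀ c v, D.lev c = lev v → S.Adj v (act c v) := fun c v h => ⟨c, h, rfl⟩
  have hcolact : ∀ c v (h : D.lev c = lev v), col ⟨s(v, act c v), hadj c v h⟩ = c := by
    intro c v h
    obtain ⟨h1, h2⟩ := hcol ⟨s(v, act c v), hadj c v h⟩ v (act c v) rfl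
    exact hinj _ _ v h1 h h2
  have hsurj : Function.Surjective col := by
    intro c
    obtain ⟨v, hv⟩ := hne (D.lev c)
    exact ⟨_, hcolact c v hv.symm⟩
  have hπ : ∀ e : S.edgeSet, Setoid.quotientKerEquivOfSurjective col hsurj
      (Quotient.mk (Setoid.ker col) e) = col e := fun e => rfl
  -- The colours along a trail form a reduced word, since a repeated letter would go back along the
  -- edge just used. A short cycle would thus be a short reduced word with a fixed point.
  have hwalk : ∀ {u v : V} (p : S.Walk u v), p.IsTrail → ∃ l : List M, l.length = p.length ∧
      (∀ c ∈ l, D.lev c = lev v) ∧ l.foldr act v = u ∧ l.IsChain (· ≠ ·) ∧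
      ∀ d, l.head? = some d → s(u, act d u) ∈ p.edges := by
    intro u v p hp
    induction p with
    | nil => exact ⟨[], by simp⟩
    | @cons u w v h p ih =>
      rw [SimpleGraph.Walk.isTrail_cons] at hp
      obtain ⟨l, h1, h2, h3, h4, h5⟩ := ih hp.1
      obtain ⟨c, hc, hw⟩ := h
      have hlw : lev w = lev v := by
        rw [← h3]
        clear h1 h2 h3 h4 h5
        induction l with
        | nil => rfl
        | cons c l ih => rw [List.foldr_cons, hlev, ih]
      refine ⟨c :: l, by simp [h1], ?_, ?_, ?_, ?_⟩
      · intro d hd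
        rcases List.mem_cons.1 hd with rfl | hd
        · rw [hc, ← hlw, ← hw, hlev]
        · exact h2 d hd
      · rw [List.foldr_cons, h3, ← hw, hinv]
      · refine List.isChain_cons.2 ⟨fun d hd => ?_, h4⟩
        rintro rfl
        refine hp.2 ?_
        have := h5 _ hd
        have hwu : act c w = u := by rw [← hw, hinv]
        rwa [hwu, Sym2.eq_swap] at this
      · intro d hd
        obtain rfl : c = d := by simpa using hd
        have : s(u, act c u) = s(u, w) := by rw [hw]
        exact this ▸ List.mem_cons_self
  refine ⟨{
    V := V
    lev := lev
    nonempty := hne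
    finite := hfin
    S := S
    lev_eq_of_adj := hlevadj
    regular := fun v => ?_
    no_short_cycle := fun v p hp => ?_
    U := Setoid.ker col
    π := Setoid.quotientKerEquivOfSurjective col hsurj
    lev_π := ?_
    existsUnique_edge := ?_ }⟩
  · have : S.neighborSet v = (fun c => act c v) '' {c | D.lev c = lev v} := by
      ext w
      simp [S]
    have hio : Set.InjOn (fun c => act c v) {c | D.lev c = lev v} :=
      fun c hc d hd h => hinj c d v hc hd h
    rw [this, hio.ncard_image]
    rfl
  · by_contra hlen
    obtain ⟨l, h1, h2, h3, h4, -⟩ := hwalk p hp.isTrail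
    refine hfix l v ?_ h4 h2 (h1.trans_le (not_lt.1 hlen)) h3
    rintro rfl
    have := hp.three_le_length
    rw [← h1] at this
    simp at this
  · intro e v hv
    rw [hπ]
    obtain ⟨w, hw⟩ := Sym2.mem_iff_exists.1 hv
    exact (hcol e v w hw).1
  · intro v q hq
    refine Quotient.inductionOn q (fun e he => ?_) hq
    rw [hπ] at he
    refine ⟨⟨s(v, act (col e) v), hadj _ v he⟩, ⟨Sym2.mem_mk_left _ _, ?_⟩, ?_⟩
    · exact Quotient.sound (hcolact _ v he)
    · rintro e' ⟨hv, he'⟩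
      obtain ⟨w, hw⟩ := Sym2.mem_iff_exists.1 hv
      have h1 : col e' = col e := Quotient.exact he'
      have h2 := (hcol e' v w hw).2
      refine Subtype.ext ?_
      rw [hw, ← h2, h1]

/-- Reduced words of length at most `n` in the letters `A`. -/
abbrev ReducedWord (A : Type) (n : ℕ) : Type :=
  {l : List A // l.IsChain (· ≠ ·) ∧ l.length ≤ n}

instance (A : Type) (n : ℕ) [Finite A] : Finite (ReducedWord A n) :=
  ((List.finite_length_le A n).subset fun _ hl => hl.2 : Set.Finite
    {l : List A | l.IsChain (· ≠ ·) ∧ l.length ≤ n})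

open Classical in
/-- Multiplication by a letter from the left, where defined. -/
noncomputable def ReducedWord.toggle {A : Type} {n : ℕ} (c : A) (w : ReducedWord A n) :
    ReducedWord A n :=
  if h : w.1.head? = some c then
    ⟨w.1.tail, w.2.1.tail, (List.tail_sublist _).length_le.trans w.2.2⟩
  else if h' : w.1.length < n then
    ⟨c :: w.1, List.isChain_cons.2 ⟨fun _ hd hcd => h (hcd ▸ hd), w.2.1⟩, h'⟩
  else w

theorem ReducedWord.toggle_of_lt {A : Type} {n : ℕ} {c : A} {w : ReducedWord A n}
    (h : w.1.head? ≠ some c) (h' : w.1.length < n) : (w.toggle c).1 = c :: w.1 := by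
  rw [toggle, dif_neg h, dif_pos h']

theorem ReducedWord.toggle_toggle {A : Type} {n : ℕ} (c : A) (w : ReducedWord A n) :
    (w.toggle c).toggle c = w := by
  by_cases h : w.1.head? = some c
  · obtain ⟨l, hl⟩ : ∃ l, w.1 = c :: l := List.head?_eq_some_iff.1 h
    have h1 : (w.toggle c).1 = l := by
      rw [toggle, dif_pos h]
      simp [hl]
    have h2 := w.2
    rw [hl] at h2
    refine Subtype.ext ?_
    rw [toggle_of_lt, h1, hl]
    · rw [h1]
      intro h3
      exact (List.isChain_cons.1 h2.1).1 c h3 rfl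
    · rw [h1]
      exact h2.2
  · by_cases h' : w.1.length < n
    · have h1 := toggle_of_lt h h'
      refine Subtype.ext ?_
      have h2 : (w.toggle c).1.head? = some c := by
        rw [h1]
        rfl
      rw [toggle, dif_pos h2]
      simp [h1]
    · have h1 : w.toggle c = w := by rw [toggle, dif_neg h, dif_neg h']
      rw [h1, h1]

/-- The piece of level `k` is the group of permutations of the reduced words of length at most
`D.size k` in the colours of that level; a colour acts by left multiplication with its
`ReducedWord.toggle`. A short nonempty reduced word takes the empty word to itself spelled out, so
its permutation is not `1`, and left multiplication by it fixes nothing. On the words themselves the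
action would not do, as `toggle` fixes some words of full length. -/
theorem nonempty_coding (D : Layering M E) : Nonempty (Coding D) := by
  classical
  let A : ℕ → Type := fun k => {c : M // D.lev c = k}
  have hA : ∀ k, Finite (A k) := fun k => D.finite k
  let X : ℕ → Type := fun k => ReducedWord (A k) (D.size k)
  have hX : ∀ k, Finite (X k) := fun k => inferInstanceAs (Finite (ReducedWord _ _))
  let σ : ∀ k, A k → Equiv.Perm (X k) := fun k c =>
    Function.Involutive.toPerm (ReducedWord.toggle c) (ReducedWord.toggle_toggle c)
  let act : M → (Σ k, Equiv.Perm (X k)) → Σ k, Equiv.Perm (X k) := fun c v =>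
    if h : D.lev c = v.1 then ⟨v.1, σ v.1 ⟨c, h⟩ * v.2⟩ else v
  have hword : ∀ (k : ℕ) (g : Equiv.Perm (X k)) (l : List M), l.IsChain (· ≠ ·) →
      (∀ c ∈ l, D.lev c = k) → l.length ≤ D.size k → ∃ τ : Equiv.Perm (X k),
        l.foldr act ⟨k, g⟩ = ⟨k, τ * g⟩ ∧
          (τ ⟨[], List.isChain_nil, Nat.zero_le _⟩).1.map Subtype.val = l := by
    intro k g l
    induction l with
    | nil => exact fun _ _ _ => ⟨1, rfl, rfl⟩
    | cons c l ih =>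
      intro h1 h2 h3
      have hc := h2 c List.mem_cons_self
      have hlt : l.length < D.size k := h3
      obtain ⟨τ, hτ, hτ'⟩ := ih h1.tail (fun d hd => h2 d (List.mem_cons_of_mem _ hd)) hlt.le
      refine ⟨σ k ⟨c, hc⟩ * τ, ?_, ?_⟩
      · rw [List.foldr_cons, hτ, mul_assoc]
        exact dif_pos hc
      · change (ReducedWord.toggle (⟨c, hc⟩ : A k)
          (τ ⟨[], List.isChain_nil, Nat.zero_le _⟩)).1.map Subtype.val = _
        rw [ReducedWord.toggle_of_lt, List.map_cons, hτ']
        · intro hh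
          have h4 : l.head? = some c := by
            rw [← hτ', List.head?_map, hh]
            rfl
          exact (List.isChain_cons.1 h1).1 c h4 rfl
        · rw [← List.length_map (f := Subtype.val), hτ']
          exact hlt
  refine exists_coding_of_action D (V := Σ k, Equiv.Perm (X k)) (fun v => v.1)
    (fun k => ⟨⟨k, 1⟩, rfl⟩) (fun k => ?_) act (fun c v => ?_) (fun c v => ?_) ?_
  · refine (Set.finite_range fun g : Equiv.Perm (X k) =>
      (⟨k, g⟩ : Σ k, Equiv.Perm (X k))).subset ?_
    rintro ⟨k', g⟩ (rfl : k' = k)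
    exact ⟨g, rfl⟩
  · by_cases h : D.lev c = v.1 <;> simp [act, h]
  · by_cases h : D.lev c = v.1
    · have h1 : act c v = ⟨v.1, σ v.1 ⟨c, h⟩ * v.2⟩ := dif_pos h
      rw [h1]
      refine (dif_pos h).trans ?_
      refine Sigma.ext rfl (heq_of_eq (Equiv.ext fun x => ?_))
      exact ReducedWord.toggle_toggle _ _
    · have h1 : act c v = v := dif_neg h
      rw [h1, h1]
  · rintro l ⟨k, g⟩ hne hch hl hlen heq
    obtain ⟨τ, hτ, hτ'⟩ := hword k g l hch hl hlen
    rw [hτ] at heq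
    have h1 : τ * g = g := eq_of_heq (Sigma.ext_iff.1 heq).2
    have h2 : τ = 1 := by simpa using h1
    rw [h2] at hτ'
    exact hne hτ'.symm

end Existence

end GraphCoding

namespace GraphCoding

/-! ### Longest common prefixes -/

section Tree

/-- The length of the longest common prefix. -/
def lcp : List Bool → List Bool → ℕ
  | a :: x, b :: y => if a = b then lcp x y + 1 else 0
  | [], _ => 0
  | _ :: _, [] => 0

theorem le_lcp_iff {k : ℕ} {x y : List Bool} :
    k ≤ lcp x y ↔ ∀ i < k, ∃ b, x[i]? = some b ∧ y[i]? = some b := by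
  induction x generalizing y k with
  | nil =>
    rcases k with _ | k
    · simp
    · simp only [lcp]
      exact ⟨fun h => by omega, fun h => by simpa using h 0 (by omega)⟩
  | cons a x ih =>
    rcases k with _ | k
    · simp
    rcases y with _ | ⟨b, y⟩
    · simp only [lcp]
      exact ⟨fun h => by omega, fun h => by simpa using h 0 (by omega)⟩
    by_cases hab : a = b
    · simp only [lcp, hab, if_true, Nat.add_le_add_iff_right, ih]
      constructor
      · rintro h (_ | i) hi
        · exact ⟨b, by simp⟩
        · simpa using h i (by omega)
      · intro h i hi
        simpa using h (i + 1) (by omega)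
    · simp only [lcp, hab, if_false]
      refine ⟨fun h => by omega, fun h => ?_⟩
      obtain ⟨c, hc, hc'⟩ := h 0 (by omega)
      simp only [List.getElem?_cons_zero, Option.some.injEq] at hc hc'
      exact absurd (hc.trans hc'.symm) hab

theorem succ_le_lcp_iff {k : ℕ} {x y : List Bool} :
    k + 1 ≤ lcp x y ↔ k ≤ lcp x y ∧ ∃ b, x[k]? = some b ∧ y[k]? = some b := by
  simp only [le_lcp_iff]
  refine ⟨fun h => ⟨fun i hi => h i (by omega), h k (by omega)⟩, fun h i hi => ?_⟩
  rcases Nat.lt_succ_iff_lt_or_eq.1 hi with hi | rfl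
  · exact h.1 i hi
  · exact h.2

theorem lcp_comm (x y : List Bool) : lcp x y = lcp y x := by
  refine eq_of_forall_le_iff fun k => ?_
  simp only [le_lcp_iff, and_comm]

theorem lcp_self (x : List Bool) : lcp x x = x.length := by
  induction x with
  | nil => rfl
  | cons a x ih => simp [lcp, ih]

theorem lcp_nil_right (x : List Bool) : lcp x [] = 0 :=
  lcp_comm x []

theorem min_le_lcp (x y z : List Bool) : min (lcp x y) (lcp y z) ≤ lcp x z := by
  refine le_lcp_iff.2 fun i hi => ?_
  rw [lt_min_iff] at hi
  obtain ⟨b, h1, h2⟩ := le_lcp_iff.1 hi.1 i (Nat.lt_succ_self i)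
  obtain ⟨c, h3, h4⟩ := le_lcp_iff.1 hi.2 i (Nat.lt_succ_self i)
  rw [h2, Option.some_inj] at h3
  exact ⟨b, h1, by rw [h4, h3]⟩

theorem lcp_le_length (x y : List Bool) : lcp x y ≤ x.length := by
  have := min_le_lcp x y x
  rwa [lcp_comm y x, min_self, lcp_self] at this

/-- The ultrametric law. If `y` has the longest common prefix with `x` in a family, then `lcp x y`
and the prefixes `y` shares determine those `x` shares with all members. -/
theorem lcp_eq_min {x y z : List Bool} (h : lcp x z ≤ lcp x y) :
    lcp x z = min (lcp x y) (lcp y z) := by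
  refine le_antisymm (le_min h ?_) (min_le_lcp x y z)
  have := min_le_lcp y x z
  rwa [lcp_comm y x, min_eq_right h] at this

theorem isPrefix_iff_lcp {x y : List Bool} : x <+: y ↔ x.length ≤ lcp x y := by
  rw [List.prefix_iff_getElem?, le_lcp_iff]
  refine forall₂_congr fun i hi => ?_
  simp [List.getElem?_eq_getElem hi, eq_comm]

theorem eq_iff_lcp {x y : List Bool} : x = y ↔ lcp x x ≤ lcp x y ∧ lcp y y ≤ lcp x y := by
  refine ⟨by rintro rfl; simp, fun h => ?_⟩
  rw [lcp_self, lcp_self, ← isPrefix_iff_lcp, lcp_comm x y, ← isPrefix_iff_lcp] at h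
  exact h.1.eq_of_length (le_antisymm h.1.length_le h.2.length_le)

theorem lcp_append {x y : List Bool} (h : y.length ≤ x.length) (w : List Bool) :
    lcp (x ++ w) y = lcp x y := by
  refine eq_of_forall_le_iff fun k => ?_
  simp only [le_lcp_iff]
  refine forall₂_congr fun i _ => exists_congr fun b => and_congr_left fun hb => ?_
  have : i < y.length := (List.getElem?_eq_some_iff.1 hb).1
  rw [List.getElem?_append_left (by omega)]

/-! ### Similarity of families -/

/-- The differences of the members of two families of numbers agree up to `N`. -/
def NumSim (N : ℕ) {ι : Type} (ν ν' : ι → ℕ) : Prop :=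
  ∀ p q, ∀ k ≤ N, ν p + k ≤ ν q ↔ ν' p + k ≤ ν' q

theorem NumSim.symm {N : ℕ} {ι : Type} {ν ν' : ι → ℕ} (h : NumSim N ν ν') : NumSim N ν' ν :=
  fun p q k hk => (h p q k hk).symm

theorem NumSim.mono {N N' : ℕ} {ι : Type} {ν ν' : ι → ℕ} (h : NumSim N ν ν') (hN : N' ≤ N) :
    NumSim N' ν ν' :=
  fun p q k hk => h p q k (hk.trans hN)

theorem NumSim.reindex {N : ℕ} {ι κ : Type} {ν ν' : ι → ℕ} (h : NumSim N ν ν') {μ μ' : κ → ℕ}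
    (hr : ∀ p, ∃ r, μ p = ν r ∧ μ' p = ν' r) : NumSim N μ μ' := by
  intro p q k hk
  obtain ⟨r, h1, h2⟩ := hr p
  obtain ⟨s, h3, h4⟩ := hr q
  rw [h1, h2, h3, h4]
  exact h r s k hk

theorem NumSim.of_split {N : ℕ} {ι : Type} {ν ν' : ι → ℕ} {B n n' : ℕ} (hn : B + N < n)
    (hn' : B + N < n') (h : ∀ p, ν p = ν' p ∧ ν p ≤ B ∨ ν p = n ∧ ν' p = n') : NumSim N ν ν' := by
  intro p q k hk
  rcases h p with h1 | h1 <;> rcases h q with h2 | h2 <;> omega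

/-- The back-and-forth step for numbers. If `n` is within `N` of some `ν p`, its offset is copied.
Otherwise `n` lies in a gap, of width at least `2 * N + 2` if bounded above, over the largest `ν p`
below it, and `ν' p + N + 1` fits into the corresponding gap. The value `0` at `o` provides such a
`p` and keeps subtractions exact. -/
theorem NumSim.exists_option {N : ℕ} {ι : Type} [Finite ι] {ν ν' : ι → ℕ}
    (h : NumSim (2 * N + 2) ν ν') {o : ι} (ho : ν o = 0) (ho' : ν' o = 0) (n : ℕ) :
    ∃ n', NumSim N (fun p : Option ι => p.elim n ν) (fun p : Option ι => p.elim n' ν') := by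
  suffices ∃ n', ∀ q, ∀ k ≤ N, (n + k ≤ ν q ↔ n' + k ≤ ν' q) ∧ (ν q + k ≤ n ↔ ν' q + k ≤ n') by
    obtain ⟨n', hn'⟩ := this
    refine ⟨n', ?_⟩
    rintro (_ | p) (_ | q) k hk
    · simp only [Option.elim_none]
      omega
    · exact (hn' q k hk).1
    · exact (hn' p k hk).2
    · exact h p q k (by omega)
  by_cases h1 : ∃ p, ∃ d ≤ N, n = ν p + d
  · obtain ⟨p, d, hd, rfl⟩ := h1
    refine ⟨ν' p + d, fun q k hk => ?_⟩
    have h2 := h p q (d + k) (by omega)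
    have h3 := h q p (k - d) (by omega)
    have h4 := h p q (d - k + 1) (by omega)
    omega
  by_cases h2 : ∃ p, ∃ d ≤ N, n + d = ν p
  · obtain ⟨p, d, hd, hp⟩ := h2
    have h3 := h o p d (by omega)
    refine ⟨ν' p - d, fun q k hk => ?_⟩
    have h4 := h q p (d + k) (by omega)
    have h5 := h p q (k - d) (by omega)
    have h6 := h q p (d - k + 1) (by omega)
    omega
  obtain ⟨p, hp, hmax⟩ := Set.exists_max_image {p | ν p ≤ n} ν (Set.toFinite _)
    ⟨o, by simp [ho]⟩
  have hfar : ∀ q, ν q + N < n ∨ n + N < ν q := by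
    intro q
    by_contra hq
    rcases le_total (ν q) n with hle | hle
    · exact h1 ⟨q, n - ν q, by omega, by omega⟩
    · exact h2 ⟨q, ν q - n, by omega, by omega⟩
  refine ⟨ν' p + N + 1, fun q k hk => ?_⟩
  have hp' : ν p ≤ n := hp
  have h3 := hfar p
  have h4 := h q p 0 (by omega)
  have h5 := h p q (2 * N + 2) le_rfl
  rcases hfar q with hq | hq
  · have h6 := hmax q (show ν q ≤ n by omega)
    omega
  · omega

/-- The tuple together with the root. -/
def withRoot {γ : Type} (z : γ → List Bool) (o : Option γ) : List Bool :=
  o.elim [] z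

/-- The lengths of the longest common prefixes of the members of the tuple and the root. -/
def meets {γ : Type} (z : γ → List Bool) (p : Option γ × Option γ) : ℕ :=
  lcp (withRoot z p.1) (withRoot z p.2)

/-- Tuples of which the meets have differences that agree up to `N`. -/
def Sim (N : ℕ) {γ : Type} (z z' : γ → List Bool) : Prop :=
  NumSim N (meets z) (meets z')

theorem Sim.comp {N : ℕ} {γ δ : Type} {z z' : γ → List Bool} (h : Sim N z z') (g : δ → γ) :
    Sim N (fun d => z (g d)) fun d => z' (g d) := by
  refine NumSim.reindex h fun p => ⟨(p.1.map g, p.2.map g), ?_⟩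
  rcases p with ⟨_ | p, _ | q⟩ <;> exact ⟨rfl, rfl⟩

/-- A node that branches off from a given one at a given height, away from finitely many others. -/
theorem exists_branch {γ : Type} {z : γ → List Bool} {i : γ} {n m : ℕ} (hn : n ≤ (z i).length)
    (hnm : n ≤ m) (hb : n < m → ∃ b, ∀ j, n ≤ lcp (z i) (z j) → (z j)[n]? ≠ some b) :
    ∃ y : List Bool, y.length = m ∧ ∀ j, lcp y (z j) = min n (lcp (z i) (z j)) := by
  obtain ⟨b, hb⟩ : ∃ b, n < m → ∀ j, n ≤ lcp (z i) (z j) → (z j)[n]? ≠ some b := by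
    by_cases h : n < m
    · obtain ⟨b, hb⟩ := hb h
      exact ⟨b, fun _ => hb⟩
    · exact ⟨true, fun h' => absurd h' h⟩
  have hlen : ((z i).take n).length = n := by simp [hn]
  refine ⟨(z i).take n ++ List.replicate (m - n) b, by simp [hn, hnm], fun j => ?_⟩
  set y := (z i).take n ++ List.replicate (m - n) b with hy
  have hylen : y.length = m := by simp [hy, hn, hnm]
  have hyi : n ≤ lcp y (z i) := by
    refine le_lcp_iff.2 fun k hk => ⟨(z i)[k], ?_, List.getElem?_eq_getElem (by omega)⟩
    rw [hy, List.getElem?_append_left (by omega), List.getElem?_take_of_lt hk,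
      List.getElem?_eq_getElem]
  have hle : lcp y (z j) ≤ n := by
    by_contra hlt
    have h1 : n + 1 ≤ lcp y (z j) := by omega
    obtain ⟨h2, c, hc, hc'⟩ := succ_le_lcp_iff.1 h1
    have h3 := lcp_le_length y (z j)
    have h4 : n < m := by omega
    have h5 := min_le_lcp (z i) y (z j)
    rw [lcp_comm (z i) y] at h5
    have h6 : y[n]? = some b := by
      rw [hy, List.getElem?_append_right (by omega), hlen, List.getElem?_replicate]
      simp [h4]
    rw [h6, Option.some_inj] at hc
    refine hb h4 j (by omega) (by rw [hc', hc])
  have h1 := min_le_lcp y (z i) (z j)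
  have h2 := min_le_lcp (z i) y (z j)
  rw [lcp_comm (z i) y] at h2
  omega

/-- The back-and-forth step for the tree. By `lcp_eq_min`, a new node adds only two numbers: the
length `n` of its longest meet with the old nodes and its own length. Two uses of
`NumSim.exists_option` explain the constant. -/
theorem Sim.exists_option {N : ℕ} {γ : Type} [Finite γ] {z z' : γ → List Bool}
    (h : Sim (2 * (2 * N + 2) + 2) z z') (y : List Bool) :
    ∃ y', Sim N (fun o : Option γ => o.elim y z) (fun o : Option γ => o.elim y' z') := by
  obtain ⟨i, hi⟩ := Finite.exists_max fun i => lcp y (withRoot z i)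
  have hmin : ∀ j, lcp y (withRoot z j) =
      min (lcp y (withRoot z i)) (lcp (withRoot z i) (withRoot z j)) := fun j => lcp_eq_min (hi j)
  set n := lcp y (withRoot z i) with hn
  obtain ⟨n', hn'⟩ := NumSim.exists_option h (o := (none, none)) rfl rfl n
  obtain ⟨m', hm'⟩ := NumSim.exists_option hn' (o := some (none, none)) rfl rfl y.length
  have e1 : ∀ j k, ∀ d ≤ 1, n + d ≤ lcp (withRoot z j) (withRoot z k) ↔
      n' + d ≤ lcp (withRoot z' j) (withRoot z' k) := fun j k d hd =>
    hn' none (some (j, k)) d (by omega)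
  have e2 : n ≤ y.length ↔ n' ≤ m' := hm' (some none) none 0 (Nat.zero_le _)
  have e3 : y.length ≤ n ↔ m' ≤ n' := hm' none (some none) 0 (Nat.zero_le _)
  have e4 : ∀ j k, lcp (withRoot z j) (withRoot z k) ≤ n ↔
      lcp (withRoot z' j) (withRoot z' k) ≤ n' := fun j k =>
    hn' (some (j, k)) none 0 (Nat.zero_le _)
  obtain ⟨y', hy', hmin'⟩ := exists_branch (z := withRoot z') (i := i) (n := n') (m := m')
    (by
      rw [← lcp_self]
      refine (e1 i i 0 (by omega)).1 ?_
      rw [lcp_self, hn, lcp_comm]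
      exact lcp_le_length _ _)
    (e2.1 (lcp_le_length _ _)) (by
      -- If old nodes occupied both directions at height `n'`, the corresponding nodes would do so
      -- at height `n`. Then `y`, being longer than `n`, would share more than `n` entries with one
      -- of them.
      intro hlt
      by_contra! hc
      obtain ⟨j, hj, hj'⟩ := hc false
      obtain ⟨k, hk, hk'⟩ := hc true
      have hj1 : n' + 1 ≤ lcp (withRoot z' j) (withRoot z' j) := succ_le_lcp_iff.2
        ⟨hj.trans ((lcp_comm _ _).trans_le ((lcp_le_length _ _).trans_eq (lcp_self _).symm)),
          false, hj', hj'⟩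
      have hk1 : n' + 1 ≤ lcp (withRoot z' k) (withRoot z' k) := succ_le_lcp_iff.2
        ⟨hk.trans ((lcp_comm _ _).trans_le ((lcp_le_length _ _).trans_eq (lcp_self _).symm)),
          true, hk', hk'⟩
      have hjk : ¬ n' + 1 ≤ lcp (withRoot z' j) (withRoot z' k) := by
        intro hle
        obtain ⟨-, b, hb, hb'⟩ := succ_le_lcp_iff.1 hle
        rw [hj', Option.some_inj] at hb
        rw [hk', Option.some_inj, ← hb] at hb'
        cases hb'
      rw [← e1 _ _ 1 le_rfl] at hj1 hk1 hjk
      have hj0 := (e1 i j 0 (by omega)).2 hj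
      have hk0 := (e1 i k 0 (by omega)).2 hk
      have hyj : n ≤ lcp y (withRoot z j) := by
        rw [hmin j]
        exact le_min le_rfl hj0
      have hyk : n ≤ lcp y (withRoot z k) := by
        rw [hmin k]
        exact le_min le_rfl hk0
      obtain ⟨-, b, hb, -⟩ := succ_le_lcp_iff.1 hj1
      obtain ⟨-, c, hc, -⟩ := succ_le_lcp_iff.1 hk1
      have hy1 : n < y.length := by omega
      have hyb : y[n]? = some y[n] := List.getElem?_eq_getElem hy1
      have hbc : b ≠ c := by
        rintro rfl
        refine hjk (succ_le_lcp_iff.2 ⟨?_, b, hb, hc⟩)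
        have := min_le_lcp (withRoot z j) y (withRoot z k)
        rw [lcp_comm _ y] at this
        omega
      have hor : ∀ b c d : Bool, b ≠ c → b = d ∨ c = d := by decide
      rcases hor b c y[n] hbc with rfl | rfl
      · have := succ_le_lcp_iff.2 ⟨hyj, _, hyb, hb⟩
        have := hi j
        omega
      · have := succ_le_lcp_iff.2 ⟨hyk, _, hyb, hc⟩
        have := hi k
        omega)
  have hcross : ∀ j, ∃ r : Option (Option (Option γ × Option γ)),
      lcp y (withRoot z j) = r.elim y.length (fun p => p.elim n (meets z)) ∧
        lcp y' (withRoot z' j) = r.elim m' (fun p => p.elim n' (meets z')) := by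
    intro j
    rw [hmin j, hmin' j]
    rcases le_total n (lcp (withRoot z i) (withRoot z j)) with hle | hle
    · exact ⟨some none, min_eq_left hle, min_eq_left ((e1 i j 0 (by omega)).1 hle)⟩
    · exact ⟨some (some (i, j)), min_eq_right hle, min_eq_right ((e4 i j).1 hle)⟩
  refine ⟨y', NumSim.reindex hm' ?_⟩
  have hz : ∀ (x : List Bool) (w : γ → List Bool) (j : Option γ), withRoot
      (fun o : Option γ => o.elim x w) (j.map some) = withRoot w j := by
    rintro x w (_ | j) <;> rfl
  have hsplit : ∀ o : Option (Option γ), o = some none ∨ ∃ j : Option γ, o = j.map some := by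
    rintro (_ | _ | j)
    · exact Or.inr ⟨none, rfl⟩
    · exact Or.inl rfl
    · exact Or.inr ⟨some j, rfl⟩
  have hy0 : ∀ (x : List Bool) (w : γ → List Bool), withRoot
      (fun o : Option γ => o.elim x w) (some none) = x := fun _ _ => rfl
  rintro ⟨p, q⟩
  simp only [meets]
  rcases hsplit p with rfl | ⟨j, rfl⟩ <;> rcases hsplit q with rfl | ⟨k, rfl⟩
  · exact ⟨none, lcp_self y, (lcp_self y').trans hy'⟩
  · simp only [hz, hy0]
    exact hcross k
  · simp only [hz, hy0]
    rw [lcp_comm _ y, lcp_comm _ y']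
    exact hcross j
  · simp only [hz]
    exact ⟨some (some (j, k)), rfl, rfl⟩

instance : treeLanguage.IsRelational := fun _ => inferInstanceAs (IsEmpty Empty)

/-- Similar tuples satisfy the same formulas. -/
theorem exists_sim_realize {α : Type} [Finite α] {n : ℕ} (φ : treeLanguage.BoundedFormula α n) :
    ∃ N, ∀ (v v' : α → List Bool) (xs xs' : Fin n → List Bool),
      Sim N (Sum.elim v xs) (Sum.elim v' xs') → (φ.Realize v xs ↔ φ.Realize v' xs') := by
  induction φ with
  | falsum => exact ⟨0, fun _ _ _ _ _ => Iff.rfl⟩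
  | equal t₁ t₂ =>
    obtain ⟨a, rfl⟩ := exists_eq_var t₁
    obtain ⟨b, rfl⟩ := exists_eq_var t₂
    refine ⟨0, fun v v' xs xs' h => ?_⟩
    have h1 := h (some a, some a) (some a, some b) 0 le_rfl
    have h2 := h (some b, some b) (some a, some b) 0 le_rfl
    change Sum.elim v xs a = Sum.elim v xs b ↔ Sum.elim v' xs' a = Sum.elim v' xs' b
    rw [eq_iff_lcp, eq_iff_lcp (x := Sum.elim v' xs' a)]
    exact and_congr h1 h2
  | rel R ts =>
    have ht : ∀ i, ∃ a, ts i = Term.var a := fun i => exists_eq_var (ts i)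
    choose a ha using ht
    obtain rfl : ts = fun i => Term.var (a i) := funext ha
    refine ⟨0, fun v v' xs xs' h => ?_⟩
    rcases R with _ | _
    · change Sum.elim v xs (a 0) <+: Sum.elim v xs (a 1) ↔
        Sum.elim v' xs' (a 0) <+: Sum.elim v' xs' (a 1)
      rw [isPrefix_iff_lcp, isPrefix_iff_lcp, ← lcp_self, ← lcp_self]
      exact h (some (a 0), some (a 0)) (some (a 0), some (a 1)) 0 le_rfl
    · change (Sum.elim v xs (a 0)).length = (Sum.elim v xs (a 1)).length ↔
        (Sum.elim v' xs' (a 0)).length = (Sum.elim v' xs' (a 1)).length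
      simp only [← lcp_self, le_antisymm_iff]
      exact and_congr (h (some (a 0), some (a 0)) (some (a 1), some (a 1)) 0 le_rfl)
        (h (some (a 1), some (a 1)) (some (a 0), some (a 0)) 0 le_rfl)
  | imp φ ψ ihφ ihψ =>
    obtain ⟨N, hN⟩ := ihφ
    obtain ⟨N', hN'⟩ := ihψ
    refine ⟨max N N', fun v v' xs xs' h => ?_⟩
    simp only [BoundedFormula.realize_imp]
    rw [hN v v' xs xs' (h.mono (le_max_left _ _)), hN' v v' xs xs' (h.mono (le_max_right _ _))]
  | @all n φ ih =>
    obtain ⟨N, hN⟩ := ih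
    refine ⟨2 * (2 * N + 2) + 2, fun v v' xs xs' h => ?_⟩
    have key : ∀ (v v' : α → List Bool) (xs xs' : Fin n → List Bool),
        Sim (2 * (2 * N + 2) + 2) (Sum.elim v xs) (Sum.elim v' xs') →
          (∀ y, φ.Realize v (Fin.snoc xs y)) → ∀ y, φ.Realize v' (Fin.snoc xs' y) := by
      intro v v' xs xs' h hall y
      obtain ⟨y', hy'⟩ := Sim.exists_option (NumSim.symm h) y
      refine (hN v v' _ _ ?_).1 (hall y')
      have e : ∀ (w : α → List Bool) (ws : Fin n → List Bool) (x : List Bool),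
          Sum.elim w (Fin.snoc ws x : Fin (n + 1) → List Bool) = fun d =>
            (Sum.elim (fun a => some (Sum.inl a))
              (Fin.snoc (fun i => some (Sum.inr i)) none : Fin (n + 1) → Option (α ⊕ Fin n))
              d : Option (α ⊕ Fin n)).elim x (Sum.elim w ws) := by
        intro w ws x
        funext d
        rcases d with d | d
        · rfl
        · refine Fin.lastCases ?_ (fun i => ?_) d <;> simp
      rw [e, e]
      exact NumSim.symm (Sim.comp hy' _)
    exact ⟨key v v' xs xs' h, key v' v xs' xs (NumSim.symm h)⟩

theorem exists_sim_formula_realize {α : Type} [Finite α] (φ : treeLanguage.Formula α) :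
    ∃ N, ∀ v v' : α → List Bool, Sim N v v' → (φ.Realize v ↔ φ.Realize v') := by
  obtain ⟨N, hN⟩ := exists_sim_realize φ
  refine ⟨N, fun v v' h => hN v v' _ _ ?_⟩
  have e : ∀ (w : α → List Bool) (xs : Fin 0 → List Bool), Sum.elim w xs =
      fun d => w (Sum.elim id (fun i : Fin 0 => i.elim0) d) := by
    intro w xs
    funext d
    rcases d with d | d
    · rfl
    · exact d.elim0
  rw [e, e]
  exact Sim.comp h _

/-! ### NIP for the tree -/

theorem PolyBounded.of_object {X Y : Type} (p : X → Prop) : PolyBounded fun x (_ : Y) => p x := by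
  classical
  refine PolyBounded.of_object_cover (I := Bool) (W := fun _ => Unit) (Z := fun _ => Unit)
    (P := fun i _ _ => i = true) 0 (fun i => PolyBounded.of_subsingleton _) fun T _ b => ?_
  exact ⟨fun _ _ _ => (), fun x => ⟨decide (p x), Fin.elim0, (), fun t => by simp⟩⟩

/-- On every family of parameters, the function is, up to the choice of a parameter, the minimum
of a number that depends only on the object and one that depends only on the parameter. -/
def MinSplit {X Y : Type} (τ : X → Y → ℕ) : Prop :=
  ∀ (T : Type) [Fintype T] (b : T → Y), ∃ h : Option T → T → ℕ∞, ∀ x, ∃ o, ∃ n : ℕ∞,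
    ∀ t, (τ x (b t) : ℕ∞) = min n (h o t)

/-- An inequality between two minima depends on the object only through three comparisons, each
bounded by `PolyBounded.of_object` or `PolyBounded.le`. -/
theorem MinSplit.polyBounded {X Y : Type} {τ τ' : X → Y → ℕ} (h : MinSplit τ) (h' : MinSplit τ')
    (k : ℕ) : PolyBounded fun x y => τ x y + k ≤ τ' x y := by
  have hP : PolyBounded fun w z : ℕ∞ × ℕ∞ => min w.1 z.1 + k ≤ min w.2 z.2 := by
    refine PolyBounded.of_determined (I := Fin 3) (P := ![fun w _ => w.1 + k ≤ w.2,
      fun w z => w.1 + k ≤ z.2, fun w z => z.1 + k ≤ w.2]) ?_ ?_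
    · intro i
      fin_cases i
      · exact PolyBounded.of_object fun w : ℕ∞ × ℕ∞ => w.1 + k ≤ w.2
      · exact PolyBounded.le.comp (fun w : ℕ∞ × ℕ∞ => w.1 + k) fun z : ℕ∞ × ℕ∞ => z.2
      · exact (PolyBounded.le (A := ℕ∞ᵒᵈ)).comp (fun w : ℕ∞ × ℕ∞ => OrderDual.toDual w.2)
          fun z : ℕ∞ × ℕ∞ => OrderDual.toDual (z.1 + k)
    · intro w w' z e
      have e0 : w.1 + k ≤ w.2 ↔ w'.1 + k ≤ w'.2 := e 0
      have e1 : w.1 + k ≤ z.2 ↔ w'.1 + k ≤ z.2 := e 1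
      have e2 : z.1 + k ≤ w.2 ↔ z.1 + k ≤ w'.2 := e 2
      have hm : ∀ a b : ℕ∞, min a b + k = min (a + k) (b + k) := fun a b =>
        (Monotone.map_min (f := fun c : ℕ∞ => c + k) fun _ _ h => add_le_add_left h _)
      simp only [hm, le_min_iff, min_le_iff, e0, e1, e2]
  refine PolyBounded.of_object_cover (I := Unit) (W := fun _ => ℕ∞ × ℕ∞) (Z := fun _ => ℕ∞ × ℕ∞)
    (P := fun _ w z => min w.1 z.1 + k ≤ min w.2 z.2) 2 (fun _ => hP) fun T _ b => ?_
  obtain ⟨f, hf⟩ := h T b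
  obtain ⟨f', hf'⟩ := h' T b
  refine ⟨fun _ o t => (f (o 0) t, f' (o 1) t), fun x => ?_⟩
  obtain ⟨o, n, hn⟩ := hf x
  obtain ⟨o', n', hn'⟩ := hf' x
  refine ⟨(), ![o, o'], (n, n'), fun t => ?_⟩
  simp only [Matrix.cons_val_zero, Matrix.cons_val_one, ← hn, ← hn']
  exact_mod_cast Iff.rfl

/-- The chosen parameter is one sharing the longest prefix with the object; `lcp_eq_min` gives the
rest. -/
theorem minSplit_lcp {β γ : Type} (i : β) (j : γ) :
    MinSplit fun (x : β → List Bool) (y : γ → List Bool) => lcp (x i) (y j) := by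
  intro T _ b
  refine ⟨fun o t => o.elim ⊤ fun s => (lcp (b s j) (b t j) : ℕ∞), fun x => ?_⟩
  rcases isEmpty_or_nonempty T with hT | hT
  · exact ⟨none, ⊤, fun t => hT.elim t⟩
  · obtain ⟨s, hs⟩ := Finite.exists_max fun t => lcp (x i) (b t j)
    refine ⟨some s, (lcp (x i) (b s j) : ℕ∞), fun t => ?_⟩
    simp only [Option.elim_some]
    rw [lcp_eq_min (hs t)]
    exact Nat.mono_cast.map_min

theorem minSplit_meets {β γ : Type} (p : Option (γ ⊕ β) × Option (γ ⊕ β)) :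
    MinSplit fun (x : β → List Bool) (y : γ → List Bool) => meets (Sum.elim y x) p := by
  have hobj : ∀ f : (β → List Bool) → ℕ, MinSplit fun x (_ : γ → List Bool) => f x :=
    fun f T _ b => ⟨fun _ _ => ⊤, fun x => ⟨none, f x, fun t => by simp⟩⟩
  have hpar : ∀ f : (γ → List Bool) → ℕ, MinSplit fun (_ : β → List Bool) y => f y :=
    fun f T _ b => ⟨fun _ t => f (b t), fun x => ⟨none, ⊤, fun t => by simp⟩⟩
  rcases p with ⟨_ | p | p, q⟩
  · exact hobj fun _ => 0
  · rcases q with _ | q | q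
    · exact hpar fun y => lcp (y p) []
    · exact hpar fun y => lcp (y p) (y q)
    · have := minSplit_lcp q p
      have e : (fun (x : β → List Bool) (y : γ → List Bool) => lcp (x q) (y p)) =
          fun x y => lcp (y p) (x q) := by
        funext x y
        exact lcp_comm _ _
      rw [e] at this
      exact this
  · rcases q with _ | q | q
    · exact hobj fun x => lcp (x p) []
    · exact minSplit_lcp p q
    · exact hobj fun x => lcp (x p) (x q)

theorem tree_isNIP : IsNIP (treeLanguage.completeTheory (List Bool)) := by
  refine isNIP_of_polyBounded fun n m φ => ?_
  obtain ⟨N, hN⟩ := exists_sim_formula_realize φ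
  refine PolyBounded.of_determined
    (I := ((Option (Fin n ⊕ Fin m) × Option (Fin n ⊕ Fin m)) ×
      (Option (Fin n ⊕ Fin m) × Option (Fin n ⊕ Fin m))) × Fin (N + 1))
    (P := fun i x y => meets (Sum.elim y x) i.1.1 + i.2 ≤ meets (Sum.elim y x) i.1.2)
    (fun i => (minSplit_meets _).polyBounded (minSplit_meets _) _) fun x x' y h => ?_
  exact hN _ _ fun p q k hk => h ((p, q), ⟨k, Nat.lt_succ_of_le hk⟩)

/-! ### Types of new levels, and a branch -/

theorem lcp_le_length_right (x y : List Bool) : lcp x y ≤ y.length :=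
  (lcp_comm x y).trans_le (lcp_le_length y x)

theorem exists_length_le {ι : Type} [Finite ι] (b : ι → List Bool) :
    ∃ B, ∀ j, (b j).length ≤ B :=
  (Set.finite_range fun j => (b j).length).bddAbove.imp fun _ hB j => hB ⟨j, rfl⟩

/-- Once `k` exceeds the lengths of the parameters, the meets of `0 ^ k` with them are constant.
Only its own length varies, far above all other numbers. -/
theorem exists_forall_realize_replicate {m : ℕ} (φ : treeLanguage.Formula (Fin 1 ⊕ Fin m))
    (b : Fin m → List Bool) : ∃ B, ∀ k k', B ≤ k → B ≤ k' →
      (φ.Realize (Sum.elim ![List.replicate k false] b) ↔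
        φ.Realize (Sum.elim ![List.replicate k' false] b)) := by
  obtain ⟨N, hN⟩ := exists_sim_formula_realize φ
  obtain ⟨B, hB⟩ := exists_length_le b
  refine ⟨B + N + 1, fun k k' hk hk' => hN _ _ (NumSim.of_split (B := B) (n := k) (n' := k')
    (by omega) (by omega) ?_)⟩
  have hrep : ∀ j l, B ≤ l → lcp (List.replicate l false) (b j) =
      lcp (List.replicate B false) (b j) := by
    intro j l hl
    obtain ⟨d, rfl⟩ := Nat.exists_eq_add_of_le hl
    rw [List.replicate_add, lcp_append]
    simpa using hB j
  have hcross : ∀ j, lcp (List.replicate k false) (b j) = lcp (List.replicate k' false) (b j) ∧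
      lcp (List.replicate k false) (b j) ≤ B := fun j =>
    ⟨(hrep j k (by omega)).trans (hrep j k' (by omega)).symm,
      (lcp_le_length_right _ _).trans (hB j)⟩
  rintro ⟨_ | i | i, q⟩
  · exact Or.inl ⟨rfl, Nat.zero_le _⟩
  · obtain rfl : i = 0 := Subsingleton.elim _ _
    rcases q with _ | j | j
    · exact Or.inl ⟨(lcp_nil_right _).trans (lcp_nil_right _).symm,
        (lcp_nil_right _).trans_le (Nat.zero_le _)⟩
    · obtain rfl : j = 0 := Subsingleton.elim _ _
      exact Or.inr ⟨(lcp_self _).trans List.length_replicate,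
        (lcp_self _).trans List.length_replicate⟩
    · exact Or.inl (hcross j)
  · rcases q with _ | j | j
    · exact Or.inl ⟨rfl, (lcp_le_length _ _).trans (hB i)⟩
    · obtain rfl : j = 0 := Subsingleton.elim _ _
      have := hcross i
      rw [lcp_comm _ (b i), lcp_comm _ (b i)] at this
      exact Or.inl this
    · exact Or.inl ⟨rfl, (lcp_le_length _ _).trans (hB i)⟩

/-- In the type of a new class the lengths tend to infinity, and by invariance a node may be
replaced by `0 ^ k` on its level. There the truth value stabilises, so the formula is in the type if
and only if it holds on all sufficiently high levels. -/
theorem tree_newClassTypesDefinable : NewClassTypesDefinable (List Bool) treeE := by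
  intro p hp m φ hφ
  obtain ⟨u, hu⟩ := exists_ultrafilter_of_type p
  have hlen : ∀ K, ∀ᶠ x : Fin 1 → List Bool in u, K ≤ (x 0).length := by
    intro K
    induction K with
    | zero => exact Filter.Eventually.of_forall fun _ => Nat.zero_le _
    | succ K ih =>
      have h1 := hp (List.replicate K false)
      rw [hu, ← Ultrafilter.eventually_not] at h1
      filter_upwards [ih, h1] with x hx hx'
      refine lt_of_le_of_ne hx fun h => hx' ?_
      rw [Formula.realize_rel₂]
      change (x 0).length = (List.replicate K false).length
      rw [List.length_replicate, h]
  have hinv : ∀ (x : List Bool) b, φ.Realize (Sum.elim ![x] b) ↔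
      φ.Realize (Sum.elim ![List.replicate x.length false] b) := fun x b =>
    hφ _ _ b (List.length_replicate (n := x.length) (a := false)).symm
  have hx1 : ∀ x : Fin 1 → List Bool, x = ![x 0] := fun x => by
    funext i
    rw [Subsingleton.elim i 0]
    rfl
  -- The premise on `e'` expresses that the level of `e` is at least that of `c`.
  have hdef : PDef treeLanguage fun b : Fin m → List Bool => ∃ c : List Bool, ∀ e : List Bool,
      (∃ e' : List Bool, e'.length = e.length ∧ c <+: e') → φ.Realize (Sum.elim ![e] b) := by
    have h0 : PDef treeLanguage fun v : Option (Option (Option (Fin m))) → List Bool =>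
        (v none).length = (v (some none)).length :=
      PDef.rel (L := treeLanguage) TreeRel.eqv ![none, some none]
    have h1 : PDef treeLanguage fun v : Option (Option (Option (Fin m))) → List Bool =>
        v (some (some none)) <+: v none :=
      PDef.rel (L := treeLanguage) TreeRel.le ![some (some none), none]
    have h2 : PDef treeLanguage fun v : Option (Option (Fin m)) → List Bool =>
        φ.Realize (Sum.elim ![v none] fun j => v (some (some j))) := by
      refine ((PDef.of_formula φ).comp (Sum.elim (fun _ => none) fun j => some (some j))).congr
        fun v => iff_of_eq (congrArg _ (funext ?_))
      rintro (i | i)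
      · rw [Subsingleton.elim i 0]
        rfl
      · rfl
    exact ((h0.and h1).ex.imp h2).all.ex
  rw [definable_iff_pDef]
  refine hdef.congr fun b => ?_
  change _ ↔ plug φ b ∈ p
  rw [hu]
  obtain ⟨B, hB⟩ := exists_forall_realize_replicate φ b
  have h1 : (∀ᶠ x in u, φ.Realize (Sum.elim x b)) ↔
      φ.Realize (Sum.elim ![List.replicate B false] b) := by
    rw [← Filter.eventually_const (f := (u : Filter (Fin 1 → List Bool)))
      (p := φ.Realize (Sum.elim ![List.replicate B false] b))]
    refine Filter.eventually_congr ?_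
    filter_upwards [hlen B] with x hx
    rw [hx1 x, hinv]
    exact hB _ _ hx le_rfl
  rw [h1]
  constructor
  · rintro ⟨c, hc⟩
    rw [hB B (max B c.length) le_rfl (le_max_left _ _)]
    refine hc _ ⟨c ++ List.replicate (max B c.length - c.length) false, ?_, List.prefix_append _ _⟩
    simp
  · intro h
    refine ⟨List.replicate B false, fun e he => ?_⟩
    obtain ⟨e', h2, h3⟩ := he
    have h4 := h3.length_le
    rw [List.length_replicate, h2] at h4
    rw [hinv, hB _ B h4 le_rfl]
    exact h

/-- For parameters of length at most `B`, the nodes `1 ^ B 1` and `1 ^ B 0` have equal lengths and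
equal meets with the parameters, but only the former lies on the branch. -/
theorem not_pDef_branch : ¬ PDef treeLanguage fun v : Unit → List Bool =>
    ∃ k, v () = List.replicate k true := by
  rintro ⟨φ, hφ⟩
  obtain ⟨n, g, ψ, hψ⟩ := exists_formula_fin (M := List Bool) φ
  obtain ⟨N, hN⟩ := exists_sim_formula_realize ψ
  obtain ⟨B, hB⟩ := exists_length_le fun i => Sum.elim (fun _ => []) id (g i)
  let z : List Bool → Fin n → List Bool := fun x i => Sum.elim (fun _ => x) id (g i)
  let x : Bool → List Bool := fun b => List.replicate B true ++ [b]
  have hroot : ∀ b (o : Option (Fin n)), withRoot (z (x b)) o = x b ∧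
      (∀ c, withRoot (z (x c)) o = x c) ∨ (∀ c, withRoot (z (x c)) o = withRoot (z (x b)) o) ∧
        (withRoot (z (x b)) o).length ≤ B := by
    rintro b (_ | i)
    · exact Or.inr ⟨fun _ => rfl, Nat.zero_le _⟩
    · have := hB i
      rcases hg : g i with a | a
      · exact Or.inl ⟨by simp [withRoot, z, hg], fun c => by simp [withRoot, z, hg]⟩
      · refine Or.inr ⟨fun c => by simp [withRoot, z, hg], ?_⟩
        simpa [withRoot, z, hg] using this
  have hxc : ∀ (b c : Bool) (y : List Bool), y.length ≤ B → lcp (x b) y = lcp (x c) y := by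
    intro b c y hy
    rw [lcp_append (by simpa using hy), lcp_append (by simpa using hy)]
  have hmeets : meets (z (x true)) = meets (z (x false)) := by
    funext p
    simp only [meets]
    rcases hroot true p.1 with ⟨h1, h1'⟩ | ⟨h1, h1'⟩ <;>
      rcases hroot true p.2 with ⟨h2, h2'⟩ | ⟨h2, h2'⟩
    · rw [h1, h2, h1', h2', lcp_self, lcp_self]
      simp [x]
    · rw [h1, h1', h2 false]
      exact hxc _ _ _ h2'
    · rw [h2, h2', h1 false, lcp_comm, lcp_comm _ (x false)]
      exact hxc _ _ _ h1'
    · rw [h1 false, h2 false]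
  have hsim : Sim N (z (x true)) (z (x false)) := by
    intro p q k _
    rw [hmeets]
  have key : ∀ b, ψ.Realize (z (x b)) ↔ ∃ k, x b = List.replicate k true := by
    intro b
    exact (hψ _).symm.trans (hφ fun _ => x b)
  have h1 := (key false).1 ((hN _ _ hsim).1 ((key true).2 ⟨B + 1, by
    simp [x, List.replicate_succ']⟩))
  obtain ⟨k, hk⟩ := h1
  have h2 : false ∈ x false := by simp [x]
  rw [hk] at h2
  simpa using List.eq_of_mem_replicate h2

end Tree

end GraphCoding

namespace GraphCoding

/-! ### A pair of vertices that codes a branch -/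

section Branch

/-- The colours of the edges in a definable set form a definable set. -/
theorem Coding.pDef_color {L : FirstOrder.Language.{0, 0}} {M : Type} [L.Structure M]
    {E : L.Relations 2} {D : Layering M E} (C : Coding D) {P : (Fin 2 → C.V) → Prop}
    (h : PDef (codeLanguage L) P) : PDef L fun x : Unit → M =>
      ∃ (p q : C.V) (h : C.S.Adj p q), C.color h = x () ∧ P ![p, q] := by
  have := D.nonempty_type
  obtain ⟨φ, hφ⟩ := h
  obtain ⟨n, g, ψ, hψ⟩ := exists_formula_fin (M := C.V) φ
  have h1 : Simple C (Option (Option Empty)) fun (_ : Unit → M) v =>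
      P ![v (some none), v none] := by
    refine ((Simple.of_codeFormula ψ).subst fun i =>
      Sum.elim (fun j => Sum.inr ([], ![some none, none] j)) Sum.inl (g i)).congr fun x v => ?_
    rw [← hφ, hψ]
    refine iff_of_eq (congrArg ψ.Realize (funext fun i => ?_))
    rcases g i with j | c
    · fin_cases j <;> rfl
    · rfl
  refine ((((Simple.color () (some none) none).and h1).exV.exV).pDef Empty.elim).congr fun x => ?_
  exact exists_congr fun p => exists_congr fun q => exists_and_right.symm

variable (C : Coding treeLayering)

/-- The formula saying that the pairs are edges and that the element coded by the first lies below
the one coded by the second. -/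
def codedLe {γ : Type} (a b c d : γ) : treeCodeLanguage.Formula γ :=
  Relations.formula (L := treeCodeLanguage) (CodeRel.coded TreeRel.le : CodeRel treeLanguage (2 * 2))
    fun j => Term.var (!![a, b; c, d] (finProdFinEquiv.symm j).1 (finProdFinEquiv.symm j).2)

theorem realize_codedLe {γ : Type} (a b c d : γ) (z : γ → C.V) :
    (codedLe a b c d).Realize z ↔
      ∃ (h : C.S.Adj (z a) (z b)) (h' : C.S.Adj (z c) (z d)), C.color h <+: C.color h' := by
  have key : ∀ (w : Fin (2 * 2) → C.V) (p q p' q' : C.V), w (finProdFinEquiv (0, 0)) = p →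
      w (finProdFinEquiv (0, 1)) = q → w (finProdFinEquiv (1, 0)) = p' →
      w (finProdFinEquiv (1, 1)) = q' →
      (C.relMap (CodeRel.coded TreeRel.le : CodeRel treeLanguage (2 * 2)) w ↔
        ∃ (h : C.S.Adj p q) (h' : C.S.Adj p' q'), C.color h <+: C.color h') := by
    rintro w p q p' q' rfl rfl rfl rfl
    constructor
    · rintro ⟨h, hR⟩
      exact ⟨h 0, h 1, hR⟩
    · rintro ⟨h, h', hR⟩
      exact ⟨Fin.forall_fin_two.2 ⟨h, h'⟩, hR⟩
  refine (Formula.realize_rel).trans (key _ _ _ _ _ ?_ ?_ ?_ ?_) <;> simp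

/-- The edges coding elements of the branch `1, 11, 111, …` of the tree. -/
def BranchEdge (v : Fin 2 → C.V) : Prop :=
  ∃ (h : C.S.Adj (v 0) (v 1)) (k : ℕ), C.color h = List.replicate k true

theorem not_pDef_branchEdge : ¬ PDef treeCodeLanguage (BranchEdge C) := by
  intro h
  refine not_pDef_branch ((C.pDef_color h).congr fun x => ?_)
  constructor
  · rintro ⟨p, q, h, hx, h', k, hk⟩
    exact ⟨k, hx.symm.trans hk⟩
  · rintro ⟨k, hk⟩
    obtain ⟨p, q, h, hx⟩ := C.exists_edge (x ())
    exact ⟨p, q, h, hx, h, k, hx.trans hk⟩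

/-- The edge from `p k` to `q k` codes `1 ^ k`, and a node lies below almost all `1 ^ k` if and only
if it is on the branch. The places of the variables are free, so that both a type and an external
definition can be read off. -/
theorem exists_eventually_codedLe : ∃ p q : ℕ → C.V, ∀ {γ : Type} (a b c d : γ)
    (z : ℕ → γ → C.V) (v : Fin 2 → C.V), (∀ k, z k a = v 0) → (∀ k, z k b = v 1) →
      (∀ k, z k c = p k) → (∀ k, z k d = q k) →
      ((∀ᶠ k in (Filter.hyperfilter ℕ : Filter ℕ), (codedLe a b c d).Realize (z k)) ↔
        BranchEdge C v) := by
  choose p q hpq hcol using fun k : ℕ => C.exists_edge (List.replicate k true)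
  refine ⟨p, q, fun a b c d z v ha hb hc hd => ?_⟩
  have hz : ∀ k, (codedLe a b c d).Realize (z k) ↔
      ∃ h : C.S.Adj (v 0) (v 1), C.color h <+: List.replicate k true := by
    intro k
    rw [realize_codedLe, ha, hb, hc, hd]
    refine exists_congr fun h => ⟨fun ⟨_, hle⟩ => ?_, fun hle => ⟨hpq k, ?_⟩⟩
    · exact hcol k ▸ hle
    · rw [hcol]
      exact hle
  simp only [hz]
  constructor
  · intro h
    obtain ⟨k, hk, hle⟩ := h.exists
    exact ⟨hk, _, List.prefix_replicate_iff.1 hle |>.2⟩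
  · rintro ⟨h, k, hk⟩
    have hge : ∀ᶠ l in (Filter.hyperfilter ℕ : Filter ℕ), k ≤ l :=
      Nat.hyperfilter_le_atTop (Filter.eventually_ge_atTop k)
    filter_upwards [hge] with l hl
    refine ⟨h, ?_⟩
    rw [hk]
    exact ⟨List.replicate (l - k) true, by rw [← List.replicate_add]; congr; omega⟩

theorem exists_not_isDefinableType {n : ℕ} (hn : 2 ≤ n) :
    ∃ p : TypeOver treeCodeLanguage C.V n, ¬ IsDefinableType p := by
  obtain ⟨p, q, hpq⟩ := exists_eventually_codedLe C
  have : Nonempty C.V := ⟨p 0⟩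
  obtain ⟨t, ht⟩ := exists_type_of_ultrafilter (L := treeCodeLanguage) (Filter.hyperfilter ℕ)
    -- From index `1` on, the tuple just repeats `q k`.
    fun (k : ℕ) (i : Fin n) => if i.1 = 0 then p k else q k
  refine ⟨t, fun h => not_pDef_branchEdge C ?_⟩
  have h1 := h 2 (codedLe (.inr 0) (.inr 1) (.inl ⟨0, by omega⟩) (.inl ⟨1, by omega⟩))
  rw [definable_iff_pDef] at h1
  refine h1.congr fun v => (ht _ _ v).trans ?_
  exact hpq _ _ _ _ _ v (fun _ => rfl) (fun _ => rfl) (fun _ => rfl) fun _ => rfl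

/-- In the ultrapower, the classes of `p` and `q` form a pair over which the edges of the branch are
definable. Since a pair is allowed for every `m ≥ 2`, one extension serves all `m`. -/
theorem exists_not_infStablyEmbedded :
    ∃ (N : Type) (_ : treeCodeLanguage.Structure N) (f : C.V ↪ₑ[treeCodeLanguage] N),
      ∀ m : ℕ, 2 ≤ m → ¬ InfStablyEmbedded treeCodeLanguage (Set.range f) m := by
  obtain ⟨p, q, hpq⟩ := exists_eventually_codedLe C
  have : Nonempty C.V := ⟨p 0⟩
  obtain ⟨N, i, f, c, hf, hc⟩ :=
    exists_ultrapower (L := treeCodeLanguage) (M := C.V) (Filter.hyperfilter ℕ)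
  refine ⟨N, i, f, fun m hm h => not_pDef_branchEdge C ?_⟩
  obtain ⟨l, ψ, b, hb, hψ⟩ := h 2 2 hm (codedLe (.inl 0) (.inl 1) (.inr 0) (.inr 1)) ![c p, c q]
  choose b' hb' using hb
  obtain rfl : (fun j => f (b' j)) = b := funext hb'
  refine ((PDef.of_formula ψ).subst (Sum.elim Sum.inl fun j => Sum.inr (b' j))).congr fun v => ?_
  rw [← f.map_formula]
  have e : (f ∘ fun g => Sum.elim v id (Sum.elim Sum.inl (fun j => Sum.inr (b' j)) g)) =
      Sum.elim (fun i => f (v i)) fun j => f (b' j) := by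
    funext o
    rcases o with o | o <;> rfl
  rw [e, ← hψ _ fun i => ⟨v i, rfl⟩]
  have e' : Sum.elim (fun i => f (v i)) ![c p, c q] =
      fun g => c (Sum.elim (fun i _ => v i) ![p, q] g) := by
    funext o
    rcases o with o | o
    · exact hf (v o)
    · fin_cases o <;> rfl
  rw [e', hc]
  exact hpq _ _ _ _ _ v (fun _ => rfl) (fun _ => rfl) (fun _ => rfl) fun _ => rfl

end Branch

end GraphCoding

theorem mainTheorem8 :
    -- the general construction
    (∀ (L : FirstOrder.Language.{0, 0}) [L.IsRelational] (M : Type) [L.Structure M] (E : L.Relations 2)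
        (D : GraphCoding.Layering M E),
      Nonempty (GraphCoding.Coding D) ∧
      ∀ C : GraphCoding.Coding D,
        (GraphCoding.IsNIP (L.completeTheory M) →
          GraphCoding.IsNIP ((GraphCoding.codeLanguage L).completeTheory C.V)) ∧
        (GraphCoding.NewClassTypesDefinable M E →
          ∀ p : GraphCoding.TypeOver (GraphCoding.codeLanguage L) C.V 1,
            GraphCoding.IsDefinableType p)) ∧
    -- the example obtained from the binary tree
    Nonempty (GraphCoding.Coding GraphCoding.treeLayering) ∧
    ∀ C : GraphCoding.Coding GraphCoding.treeLayering,
      GraphCoding.IsNIP (GraphCoding.treeCodeLanguage.completeTheory C.V) ∧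
      (∀ p : GraphCoding.TypeOver GraphCoding.treeCodeLanguage C.V 1,
        GraphCoding.IsDefinableType p) ∧
      (∀ n : ℕ, 2 ≤ n → ∃ p : GraphCoding.TypeOver GraphCoding.treeCodeLanguage C.V n,
        ¬ GraphCoding.IsDefinableType p) ∧
      (∀ (N : Type) [GraphCoding.treeCodeLanguage.Structure N] (f : C.V ↪ₑ[GraphCoding.treeCodeLanguage] N),
        GraphCoding.InfStablyEmbedded GraphCoding.treeCodeLanguage (Set.range f) 1) ∧
      (∃ (N : Type) (_ : GraphCoding.treeCodeLanguage.Structure N) (f : C.V ↪ₑ[GraphCoding.treeCodeLanguage] N),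
        ∀ m : ℕ, 2 ≤ m → ¬ GraphCoding.InfStablyEmbedded GraphCoding.treeCodeLanguage (Set.range f) m) := by
  refine ⟨fun L _ M _ E D => ⟨GraphCoding.nonempty_coding D, fun C => ⟨C.isNIP, C.isDefinableType⟩⟩,
    GraphCoding.nonempty_coding _, fun C => ⟨C.isNIP GraphCoding.tree_isNIP,
      C.isDefinableType GraphCoding.tree_newClassTypesDefinable,
      fun n hn => GraphCoding.exists_not_isDefinableType C hn,
      fun N _ f => C.infStablyEmbedded_one GraphCoding.tree_newClassTypesDefinable f,
      GraphCoding.exists_not_infStablyEmbedded C⟩⟩
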